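/- Let $Y$ be a spectrally negative Lévy process whose paths are not monotone and whose jumps are bounded: its Lévy measure $\Pi$ is supported on $[-k,0)$, where $k>0$ is the smallest such number. Let $$\psi_Y(z)=\ln\mathbb E[e^{zY_1}]=\tfrac12\sigma^2z^2+\mu z+\int_{[-k,0)}\bigl(e^{zx}-1-zx\,h\bigr)\,\Pi(dx),\qquad z\in\mathbb C,$$ be its Laplace exponent, where $\sigma\ge 0$, $\mu\in\mathbb R$, $h=0$ if $\int_{[-1,1]}|x|\,\Pi(dx)<\infty$ and $h=1$ otherwise. For $q\ge 0$ let $\Phi(q)$ be the largest solution of $\psi_Y(x)=q$ in $[0,\infty)$, and let the scale function $W^{(q)}$ be the function that vanishes on $(-\infty,0)$, is continuous on $[0,\infty)$ and satisfies $\int_0^\infty e^{-zx}W^{(q)}(x)\,dx=1/(\psi_Y(z)-q)$ for $\mathrm{Re}(z)>\Phi(q)$. Call a function piecewise $N$-times continuously differentiable on $[a,b]$ if there are finitely many points $a=x_1<\dots<x_m=b$ such that it is $C^N$ on $[a,b]\setminus\{x_1,\dots,x_m\}$ and its derivatives of orders $0,\dots,N$ have finite one-sided limits (from within $[a,b]$)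 at each $x_i$. Assume that $\Pi$ is regular: with $\bar\Pi^-(x)=\Pi((-\infty,x))$ for $x<0$, there is an integer $n\ge 0$ such that (a) for some real constants $C,\alpha$ and $C_j,\alpha_j$ ($1\le j\le m$) with $\alpha,\alpha_j\in(-\infty,1)\cup(1,2)$ and $\alpha_j<\alpha$, the function $\bar\Pi^-(x)-C|x|^{-\alpha}-\sum_{j=1}^m C_j|x|^{-\alpha_j}$ is piecewise $(n+1)$-times continuously differentiable on $[-k,0]$; (b) the right limit at $-k$ of the $n$-th derivative of $\bar\Pi^-$ is not $0$; (c) if $n\ge1$, then $\bar\Pi^-$ is $C^{n-1}$ on $(-\infty,0)$. Assume that $q>0$, or that $q=0$ and $\Phi(0)>0$, and that all solutions $z\in\mathbb C$ of $\psi_Y(z)=q$ are simple. Let $\zeta_0\ge 0$ be the real solution of $\psi_Y(-z)=q$ in $[0,\infty)$. Then the equation $\psi_Y(-z)=q$ has infinitely many solutions in the open first quadrant $\{\mathrm{Re}\,z>0,\ \mathrm{Im}\,z>0\}$; and if $\zeta_1,\zeta_2,\dots$ are these solutions in the order of increase of the absolute value, then for every $x>0$ $$W^{(q)}(x)=\frac{e^{\Phi(q)x}}{\psi_Y'(\Phi(q))}+\frac{e^{-\zeta_0x}}{\psi_Y'(-\zeta_0)}+2\sum_{n\ge1}\mathrm{Re}\left[\frac{e^{-\zeta_nx}}{\psi_Y'(-\zeta_n)}\right],$$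 and the series converges uniformly on $[\varepsilon,\infty)$ for every $\varepsilon>0$. -/

import Mathlib

open MeasureTheory ProbabilityTheory Filter Topology Set
open scoped NNReal ENNReal

namespace SNLevy

/-- `Y` is a real-valued Lévy process on the probability space `(Ω, P)`: it starts at `0`, has
independent and stationary increments, and almost surely right-continuous paths with left limits. -/
structure IsLevyProcess {Ω : Type*} [MeasurableSpace Ω] (P : Measure Ω) (Y : ℝ≥0 → Ω → ℝ) :
    Prop where
  measurable : ∀ t, Measurable (Y t)
  zero : ∀ᵐ ω ∂P, Y 0 ω = 0
  indep : HasIndepIncrements Y P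
  stationary : ∀ s t : ℝ≥0, IdentDistrib (fun ω => Y (s + t) ω - Y s ω) (Y t) P P
  cadlag : ∀ᵐ ω ∂P, ∀ t : ℝ≥0, ContinuousWithinAt (fun s => Y s ω) (Ici t) t ∧
    (0 < t → ∃ l : ℝ, Tendsto (fun s => Y s ω) (𝓝[<] t) (𝓝 l))

/-- `ν` is a Lévy measure on the line: no mass at `0` and `∫ min(1, x²) ν(dx) < ∞`. -/
structure IsLevyMeasure (ν : Measure ℝ) : Prop where
  zero : ν {0} = 0
  finite : ∫⁻ x, ENNReal.ofReal (min 1 (x ^ 2)) ∂ν < ∞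

/-- The jumps have bounded variation: `∫_{[-1,1]} |x| ν(dx) < ∞`. -/
def BoundedVariation (ν : Measure ℝ) : Prop :=
  IntegrableOn (fun x : ℝ => x) (Icc (-1) 1) ν

open Classical in
/-- The (constant) cutoff `h`: `h ≡ 0` if the jumps have bounded variation, so that the linear
coefficient is the drift, and `h ≡ 1` otherwise (the jumps will be bounded). -/
noncomputable def cutoff (ν : Measure ℝ) : ℝ := if BoundedVariation ν then 0 else 1

/-- The Lévy–Khintchine formula
`ψ(z) = σ² z² / 2 + μ z + ∫ (e^{zx} - 1 - z x h) ν(dx)`. -/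
noncomputable def laplaceExponent (σ μ : ℝ) (ν : Measure ℝ) (z : ℂ) : ℂ :=
  (σ : ℂ) ^ 2 / 2 * z ^ 2 + (μ : ℂ) * z +
    ∫ x : ℝ, (Complex.exp (z * x) - 1 - z * x * (cutoff ν : ℂ)) ∂ν

/-- `Y` is a Lévy process with Gaussian coefficient `σ`, linear coefficient `μ` and Lévy measure
`ν`: `E[exp(i θ Y₁)] = exp(ψ(i θ))` for all real `θ`. -/
structure HasTriplet {Ω : Type*} [MeasurableSpace Ω] (P : Measure Ω) (Y : ℝ≥0 → Ω → ℝ)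
    (σ μ : ℝ) (ν : Measure ℝ) : Prop where
  levy : IsLevyProcess P Y
  charFun_eq : ∀ θ : ℝ,
    charFun (P.map (Y 1)) θ = Complex.exp (laplaceExponent σ μ ν (θ * Complex.I))

/-- `ν` is supported on `[-k, 0)`, where `k > 0` is the smallest such number. -/
def SupportedExactly (ν : Measure ℝ) (k : ℝ) : Prop :=
  IsLeast {r : ℝ | 0 < r ∧ ν (Ico (-r) 0)ᶜ = 0} k

/-- The tail `x ↦ ν((-∞, x))`, `x < 0`. -/
noncomputable def leftTail (ν : Measure ℝ) (x : ℝ) : ℝ := (ν (Iio x)).toReal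

/-- `f` is piecewise `n`-times continuously differentiable on `[a, b]`: there is a finite set `s` of
points of `[a, b]`, containing `a` and `b`, such that `f` is `Cⁿ` on `[a, b] \ s` and the derivatives
of orders `0, …, n` have (finite) left and right limits at the points of `s` (only the limit from
inside the interval at `a` and at `b`). -/
def PiecewiseContDiff (n : ℕ) (f : ℝ → ℝ) (a b : ℝ) : Prop :=
  ∃ s : Finset ℝ, a ∈ s ∧ b ∈ s ∧ (s : Set ℝ) ⊆ Icc a b ∧
    ContDiffOn ℝ n f (Icc a b \ s) ∧
    ∀ j ≤ n, ∀ p ∈ s,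
      (a < p → ∃ l : ℝ, Tendsto (iteratedDeriv j f) (𝓝[<] p) (𝓝 l)) ∧
      (p < b → ∃ l : ℝ, Tendsto (iteratedDeriv j f) (𝓝[>] p) (𝓝 l))

/-- Regularity of a Lévy measure `ν` on `[-k, 0)`. -/
def IsRegular (ν : Measure ℝ) (k : ℝ) : Prop :=
  ∃ n : ℕ,
    (∃ (C α : ℝ) (m : ℕ) (C' α' : Fin m → ℝ),
      (α < 2 ∧ α ≠ 1) ∧ (∀ j, α' j ≠ 1 ∧ α' j < α) ∧
      PiecewiseContDiff (n + 1)
        (fun x => leftTail ν x - C * |x| ^ (-α) - ∑ j, C' j * |x| ^ (-α' j)) (-k) 0) ∧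
    (∃ l : ℝ, l ≠ 0 ∧ Tendsto (iteratedDeriv n (leftTail ν)) (𝓝[>] (-k)) (𝓝 l)) ∧
    (∀ i : ℕ, n = i + 1 → ContDiffOn ℝ i (leftTail ν) (Iio 0))

/-- `Φ(q)`: the largest nonnegative solution of `ψ(x) = q`; for `q > 0` this is the unique positive
one. -/
noncomputable def Phi (ψ : ℂ → ℂ) (q : ℝ) : ℝ := sSup {x : ℝ | 0 ≤ x ∧ ψ x = q}

/-- `W` is the `q`-scale function of the spectrally negative process with Laplace exponent `ψ`: it
vanishes on `(-∞, 0)`, is continuous on `[0, ∞)` and has Laplace transform `1 / (ψ(z) - q)` for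
`Re z > Φ(q)`. -/
structure IsScaleFunction (ψ : ℂ → ℂ) (q : ℝ) (W : ℝ → ℝ) : Prop where
  eq_zero : ∀ x < 0, W x = 0
  continuousOn : ContinuousOn W (Ici 0)
  integrableOn : ∀ z : ℂ, Phi ψ q < z.re →
    IntegrableOn (fun x : ℝ => Complex.exp (-z * x) * (W x : ℂ)) (Ioi 0)
  laplace : ∀ z : ℂ, Phi ψ q < z.re →
    ∫ x in Ioi (0 : ℝ), Complex.exp (-z * x) * (W x : ℂ) = 1 / (ψ z - q)

/-- `ζ₀ ≥ 0` is a real solution of `ψ(-z) = q`, and `ζ₁, ζ₂, …` list the solutions of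
`ψ(-z) = q` in the open first quadrant, each once, in the order of increase of the absolute
value. -/
structure IsRootSequence (ψ : ℂ → ℂ) (q : ℝ) (ζ : ℕ → ℂ) : Prop where
  im_zero : (ζ 0).im = 0
  re_zero : 0 ≤ (ζ 0).re
  eq_zero : ψ (-ζ 0) = q
  bijOn : BijOn ζ (Ici 1) {z : ℂ | 0 < z.re ∧ 0 < z.im ∧ ψ (-z) = q}
  mono : MonotoneOn (fun n => ‖ζ n‖) (Ici 1)

/-- `e^{Φ(q)x}/ψ'(Φ(q)) + e^{-ζ₀x}/ψ'(-ζ₀) + 2 ∑_{n=1}^{N} Re [e^{-ζₙx}/ψ'(-ζₙ)]`. -/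
noncomputable def partialSum (ψ : ℂ → ℂ) (q : ℝ) (ζ : ℕ → ℂ) (N : ℕ) (x : ℝ) : ℂ :=
  Complex.exp (Phi ψ q * x) / deriv ψ (Phi ψ q) +
    Complex.exp (-ζ 0 * x) / deriv ψ (-ζ 0) +
    2 * ((∑ n ∈ Finset.Icc 1 N, (Complex.exp (-ζ n * x) / deriv ψ (-ζ n)).re : ℝ) : ℂ)

end SNLevy

namespace SNLevy

/-- The tail `y ↦ ν((-∞, -y))` in the positive variable. -/
noncomputable def tail (ν : Measure ℝ) (y : ℝ) : ℝ := leftTail ν (-y)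

variable {ν : Measure ℝ} {k : ℝ}

lemma IsLevyMeasure.measure_lt_top (hν : IsLevyMeasure ν) {y : ℝ} (hy : 0 < y) :
    ν (Iio (-y)) < ∞ := by
  have h1 : Iio (-y) ⊆ {x : ℝ | ENNReal.ofReal (min 1 (y ^ 2)) ≤ ENNReal.ofReal (min 1 (x ^ 2))} := by
    intro x hx
    have hx' : x < -y := hx
    apply ENNReal.ofReal_le_ofReal
    apply min_le_min le_rfl
    nlinarith
  have h0 : ENNReal.ofReal (min 1 (y ^ 2)) ≠ 0 := by
    simp only [ne_eq, ENNReal.ofReal_eq_zero, not_le]; positivity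
  calc ν (Iio (-y)) ≤ _ := measure_mono h1
    _ ≤ _ := meas_ge_le_lintegral_div (by fun_prop) h0 ENNReal.ofReal_ne_top
    _ < ∞ := ENNReal.div_lt_top hν.finite.ne h0

lemma IsLevyMeasure.sigmaFinite (hν : IsLevyMeasure ν) : SigmaFinite ν := by
  refine ⟨⟨{
    set := fun n : ℕ => {0} ∪
      {x : ℝ | ENNReal.ofReal (1 / (n + 1)) ≤ ENNReal.ofReal (min 1 (x ^ 2))}
    set_mem := fun _ => trivial
    finite := ?_
    spanning := ?_ }⟩⟩
  · intro n
    have h0 : ENNReal.ofReal (1 / ((n : ℝ) + 1)) ≠ 0 := by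
      simp only [ne_eq, ENNReal.ofReal_eq_zero, not_le]; positivity
    refine (measure_union_le _ _).trans_lt (ENNReal.add_lt_top.2 ⟨by simp [hν.zero], ?_⟩)
    exact (meas_ge_le_lintegral_div (by fun_prop) h0 ENNReal.ofReal_ne_top).trans_lt
      (ENNReal.div_lt_top hν.finite.ne h0)
  · refine eq_univ_of_forall fun x => ?_
    rcases eq_or_ne x 0 with rfl | hx
    · simp
    · obtain ⟨n, hn⟩ := exists_nat_one_div_lt (show (0 : ℝ) < min 1 (x ^ 2) by positivity)
      exact mem_iUnion.2 ⟨n, Or.inr (ENNReal.ofReal_le_ofReal hn.le)⟩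

lemma SupportedExactly.pos (hk : SupportedExactly ν k) : 0 < k := hk.1.1

lemma SupportedExactly.ae_mem (hk : SupportedExactly ν k) : ∀ᵐ x ∂ν, x ∈ Ico (-k) 0 :=
  hk.1.2

lemma SupportedExactly.ne_zero (hk : SupportedExactly ν k) : ν ≠ 0 := by
  rintro rfl
  have h := hk.2 (show k / 2 ∈ _ from ⟨half_pos hk.pos, by simp⟩)
  linarith [hk.pos]

lemma tail_nonneg (y : ℝ) : 0 ≤ tail ν y := ENNReal.toReal_nonneg

lemma ofReal_tail (hν : IsLevyMeasure ν) {y : ℝ} (hy : 0 < y) :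
    ENNReal.ofReal (tail ν y) = ν (Iio (-y)) :=
  ENNReal.ofReal_toReal (hν.measure_lt_top hy).ne

lemma tail_antitoneOn (hν : IsLevyMeasure ν) : AntitoneOn (tail ν) (Ioi 0) := by
  intro a ha b _ hab
  exact ENNReal.toReal_mono (hν.measure_lt_top ha).ne
    (measure_mono (Iio_subset_Iio (neg_le_neg hab)))

lemma tail_eq_zero (hk : SupportedExactly ν k) {y : ℝ} (hy : k ≤ y) : tail ν y = 0 := by
  have : ν (Iio (-y)) = 0 := by
    refine measure_mono_null ?_ hk.1.2
    intro x hx hx'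
    have : x < -y := hx
    linarith [hx'.1]
  simp [tail, leftTail, this]

lemma measurable_tail : Measurable (tail ν) := by
  have h : Monotone fun x : ℝ => ν (Iio x) := fun a b hab => measure_mono (Iio_subset_Iio hab)
  exact (ENNReal.measurable_toReal.comp h.measurable).comp measurable_neg

lemma lintegral_tail (hν : IsLevyMeasure ν) (hk : SupportedExactly ν k) {g : ℝ → ℝ}
    (hg : Continuous g) (hg0 : ∀ t, 0 < t → 0 ≤ g t) :
    ∫⁻ t in Ioc 0 k, ENNReal.ofReal (g t * tail ν t) =
      ∫⁻ x, ENNReal.ofReal (∫ t in 0..(-x), g t) ∂ν := by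
  have h1 := lintegral_comp_eq_lintegral_meas_lt_mul ν (f := fun x : ℝ => -x) (g := g) ?_
    (by fun_prop) (fun t _ => hg.intervalIntegrable 0 t) ?_
  · rw [h1]
    have h2 : ∫⁻ t in Ioc 0 k, ENNReal.ofReal (g t * tail ν t) =
        ∫⁻ t in Ioi 0, ENNReal.ofReal (g t * tail ν t) := by
      rw [← Ioc_union_Ioi_eq_Ioi hk.pos.le, lintegral_union measurableSet_Ioi
        (Set.disjoint_left.2 fun x hx hx' => not_lt.2 hx.2 hx')]
      rw [setLIntegral_congr_fun (g := fun _ => 0) measurableSet_Ioi]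
      · simp
      · intro t ht
        simp [tail_eq_zero hk (le_of_lt ht)]
    rw [h2]
    refine setLIntegral_congr_fun measurableSet_Ioi fun t ht => ?_
    have : {a : ℝ | t < -a} = Iio (-t) := by ext a; simp [lt_neg]
    simp only [this]
    rw [← ofReal_tail hν ht, mul_comm, ENNReal.ofReal_mul (tail_nonneg _)]
  · filter_upwards [hk.ae_mem] with x hx
    simpa using hx.2.le
  · exact (ae_restrict_mem measurableSet_Ioi).mono fun t ht => hg0 t ht

lemma integrableOn_tail_iff (hν : IsLevyMeasure ν) (hk : SupportedExactly ν k) {g : ℝ → ℝ}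
    (hg : Continuous g) (hg0 : ∀ t, 0 < t → 0 ≤ g t) :
    IntegrableOn (fun t => g t * tail ν t) (Ioc 0 k) ↔
      Integrable (fun x => ∫ t in 0..(-x), g t) ν := by
  have hm : AEStronglyMeasurable (fun t => g t * tail ν t) (volume.restrict (Ioc 0 k)) :=
    (hg.measurable.mul measurable_tail).aestronglyMeasurable
  have hc : Continuous fun x : ℝ => ∫ t in 0..(-x), g t :=
    (intervalIntegral.continuous_primitive (fun a b => hg.intervalIntegrable a b) 0).comp
      continuous_neg
  rw [IntegrableOn, ← lintegral_ofReal_ne_top_iff_integrable hm,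
    ← lintegral_ofReal_ne_top_iff_integrable hc.aestronglyMeasurable, lintegral_tail hν hk hg hg0]
  · filter_upwards [hk.ae_mem] with x hx
    exact intervalIntegral.integral_nonneg_of_ae_restrict (by linarith [hx.2])
      ((ae_restrict_iff' measurableSet_Icc).2 (by
        have : ∀ᵐ t : ℝ, t ≠ 0 := by simp [ae_iff]
        filter_upwards [this] with t ht ht'
        exact hg0 t (lt_of_le_of_ne ht'.1 ht.symm)))
  · filter_upwards [ae_restrict_mem measurableSet_Ioc] with t ht
    exact mul_nonneg (hg0 t ht.1) (tail_nonneg _)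

lemma IsLevyMeasure.integrable_sq (hν : IsLevyMeasure ν) (hk : SupportedExactly ν k) :
    Integrable (fun x : ℝ => x ^ 2) ν := by
  have h1 : Integrable (fun x : ℝ => min 1 (x ^ 2)) ν := by
    refine (lintegral_ofReal_ne_top_iff_integrable (by fun_prop) ?_).1 hν.finite.ne
    exact ae_of_all _ fun x => le_min zero_le_one (sq_nonneg x)
  refine (h1.const_mul (1 + k ^ 2)).mono' (by fun_prop) ?_
  filter_upwards [hk.ae_mem] with x hx
  rw [Real.norm_of_nonneg (sq_nonneg x)]
  have : x ^ 2 ≤ k ^ 2 := by nlinarith [hx.1, hx.2]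
  rcases le_total 1 (x ^ 2) with h | h
  · rw [min_eq_left h]; nlinarith
  · rw [min_eq_right h]; nlinarith [sq_nonneg k, sq_nonneg x, mul_nonneg (sq_nonneg k) (sq_nonneg x)]

lemma integrableOn_mul_tail (hν : IsLevyMeasure ν) (hk : SupportedExactly ν k) :
    IntegrableOn (fun t => t * tail ν t) (Ioc 0 k) := by
  rw [integrableOn_tail_iff hν hk (g := fun t => t) continuous_id fun t ht => ht.le]
  refine ((hν.integrable_sq hk).div_const 2).congr (ae_of_all _ fun x => ?_)
  simp

lemma boundedVariation_iff_integrable (hν : IsLevyMeasure ν) (hk : SupportedExactly ν k) :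
    BoundedVariation ν ↔ Integrable (fun x : ℝ => x) ν := by
  refine ⟨fun h => ?_, fun h => h.integrableOn⟩
  have h2 : Integrable (fun x : ℝ => (Icc (-1 : ℝ) 1).indicator (fun x => x) x) ν :=
    (integrable_indicator_iff measurableSet_Icc).2 h
  refine (h2.norm.add (hν.integrable_sq hk)).mono' (by fun_prop) (ae_of_all _ fun x => ?_)
  by_cases hx : x ∈ Icc (-1 : ℝ) 1
  · simp [hx, sq_nonneg]
  · simp only [Pi.add_apply, indicator_of_notMem hx, Real.norm_eq_abs, abs_zero, zero_add]
    have : 1 < |x| := by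
      by_contra h'
      exact hx (abs_le.1 (not_lt.1 h'))
    rw [← sq_abs]; nlinarith

lemma boundedVariation_iff (hν : IsLevyMeasure ν) (hk : SupportedExactly ν k) :
    BoundedVariation ν ↔ IntegrableOn (tail ν) (Ioc 0 k) := by
  have h := integrableOn_tail_iff hν hk (g := fun _ => 1) continuous_const fun t ht => zero_le_one
  simp only [one_mul] at h
  rw [boundedVariation_iff_integrable hν hk, h]
  simp only [intervalIntegral.integral_const, smul_eq_mul, mul_one, sub_zero]
  exact integrable_neg_iff.symm

/-- Fubini for the tail. -/
lemma integral_tail (hν : IsLevyMeasure ν) (hk : SupportedExactly ν k) {g : ℝ → ℂ}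
    (hg : Continuous g) (hi : IntegrableOn (fun t => ‖g t‖ * tail ν t) (Ioc 0 k)) :
    Integrable (fun x => ∫ t in 0..(-x), g t) ν ∧
    ∫ x, (∫ t in 0..(-x), g t) ∂ν = ∫ t in 0..k, g t * tail ν t := by
  have := hν.sigmaFinite
  set F : ℝ × ℝ → ℂ := fun p => {p : ℝ × ℝ | p.1 < -p.2}.indicator (fun p => g p.2) p with hF
  have hmeas : MeasurableSet {p : ℝ × ℝ | p.1 < -p.2} :=
    measurableSet_lt measurable_fst measurable_snd.neg
  have hFm : Measurable F := (hg.measurable.comp measurable_snd).indicator hmeas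
  have hind : ∀ x t, F (x, t) = (Iio (-t)).indicator (fun _ => g t) x := by
    intro x t; simp [hF, indicator]
  have hFi : Integrable F (ν.prod (volume.restrict (Ioc 0 k))) := by
    rw [integrable_prod_iff' hFm.aestronglyMeasurable]
    constructor
    · filter_upwards [ae_restrict_mem measurableSet_Ioc] with t ht
      simp_rw [hind]
      exact (integrable_indicator_iff measurableSet_Iio).2
        (integrableOn_const (hs := (hν.measure_lt_top ht.1).ne))
    · refine hi.congr ?_
      filter_upwards [ae_restrict_mem measurableSet_Ioc] with t ht
      simp_rw [hind, norm_indicator_eq_indicator_norm]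
      rw [integral_indicator measurableSet_Iio, setIntegral_const, smul_eq_mul, mul_comm]
      rfl
  have hx : ∀ᵐ x ∂ν, ∫ t in Ioc 0 k, F (x, t) = ∫ t in 0..(-x), g t := by
    filter_upwards [hk.ae_mem] with x hx
    rw [intervalIntegral.integral_of_le (by linarith [hx.2]),
      ← integral_indicator measurableSet_Ioc, ← integral_indicator measurableSet_Ioc]
    refine integral_congr_ae ?_
    have h3 : ∀ᵐ t : ℝ, t ≠ -x := by simp [ae_iff]
    filter_upwards [h3] with t ht
    simp only [hF, indicator, mem_Ioc, mem_ofPred_eq]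
    have := hx.1
    by_cases h1 : 0 < t ∧ t ≤ -x
    · have h4 : t < -x := lt_of_le_of_ne h1.2 ht
      rw [if_pos h1, if_pos ⟨h1.1, by linarith⟩, if_pos (by linarith)]
    · rw [if_neg h1]
      split_ifs with h2 h3
      · exact absurd ⟨h2.1, by linarith⟩ h1
      · rfl
      · rfl
  refine ⟨hFi.integral_prod_left.congr hx, ?_⟩
  rw [← integral_congr_ae hx, integral_integral_swap hFi,
    intervalIntegral.integral_of_le hk.pos.le]
  refine setIntegral_congr_fun measurableSet_Ioc fun t ht => ?_
  simp only [hind]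
  rw [integral_indicator measurableSet_Iio, setIntegral_const, Complex.real_smul, mul_comm]
  rfl

variable {ν : Measure ℝ} {k : ℝ}

lemma hasDerivAt_exp_mul_ofReal (w : ℂ) (t : ℝ) :
    HasDerivAt (fun t : ℝ => Complex.exp (w * t)) (w * Complex.exp (w * t)) t := by
  have h1 : HasDerivAt (fun t : ℝ => w * (t : ℂ)) w t := by
    simpa using (Complex.ofRealCLM.hasDerivAt (x := t)).const_mul w
  simpa [mul_comm] using h1.cexp

lemma norm_exp_mul_ofReal_le (w : ℂ) {t b : ℝ} (ht : 0 ≤ t) (hb : t ≤ b) :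
    ‖Complex.exp (w * t)‖ ≤ Real.exp (‖w‖ * b) := by
  rw [Complex.norm_exp]
  apply Real.exp_le_exp.2
  calc (w * t).re ≤ ‖w * t‖ := Complex.re_le_norm _
    _ = ‖w‖ * t := by simp [abs_of_nonneg ht]
    _ ≤ _ := by gcongr

lemma norm_exp_mul_ofReal_sub_one_le (w : ℂ) {t b : ℝ} (ht : 0 ≤ t) (hb : t ≤ b) :
    ‖Complex.exp (w * t) - 1‖ ≤ ‖w‖ * Real.exp (‖w‖ * b) * t := by
  have h := Convex.norm_image_sub_le_of_norm_hasDerivWithin_le (𝕜 := ℝ)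
    (f := fun t : ℝ => Complex.exp (w * t)) (f' := fun t : ℝ => w * Complex.exp (w * t))
    (s := Icc 0 b) (x := 0) (y := t) (C := ‖w‖ * Real.exp (‖w‖ * b))
    (fun x _ => (hasDerivAt_exp_mul_ofReal w x).hasDerivWithinAt) (fun x hx => by
      rw [norm_mul]; gcongr; exact norm_exp_mul_ofReal_le w hx.1 hx.2)
    (convex_Icc 0 b) ⟨le_rfl, ht.trans hb⟩ ⟨ht, hb⟩
  simpa [abs_of_nonneg ht] using h

lemma cutoff_of_bv (h : BoundedVariation ν) : cutoff ν = 0 := if_pos h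

lemma cutoff_of_not_bv (h : ¬ BoundedVariation ν) : cutoff ν = 1 := if_neg h

lemma integrableOn_exp_sub_cutoff_mul_tail (hν : IsLevyMeasure ν) (hk : SupportedExactly ν k)
    (w : ℂ) : IntegrableOn (fun t : ℝ => ‖Complex.exp (w * t) - cutoff ν‖ * tail ν t)
      (Ioc 0 k) := by
  have hm : AEStronglyMeasurable (fun t : ℝ => ‖Complex.exp (w * t) - cutoff ν‖ * tail ν t)
      (volume.restrict (Ioc 0 k)) := by
    have h := measurable_tail (ν := ν)
    exact Measurable.aestronglyMeasurable (by fun_prop)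
  by_cases h : BoundedVariation ν
  · refine (((boundedVariation_iff hν hk).1 h).const_mul (Real.exp (‖w‖ * k))).mono' hm ?_
    filter_upwards [ae_restrict_mem measurableSet_Ioc] with t ht
    rw [Real.norm_of_nonneg (mul_nonneg (norm_nonneg _) (tail_nonneg _)), cutoff_of_bv h]
    gcongr
    · exact tail_nonneg _
    · simpa using norm_exp_mul_ofReal_le w ht.1.le ht.2
  · refine ((integrableOn_mul_tail hν hk).const_mul (‖w‖ * Real.exp (‖w‖ * k))).mono' hm ?_
    filter_upwards [ae_restrict_mem measurableSet_Ioc] with t ht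
    rw [Real.norm_of_nonneg (mul_nonneg (norm_nonneg _) (tail_nonneg _)), cutoff_of_not_bv h,
      ← mul_assoc]
    gcongr
    · exact tail_nonneg _
    · simpa using norm_exp_mul_ofReal_sub_one_le w ht.1.le ht.2

lemma laplaceExponent_aux (hν : IsLevyMeasure ν) (hk : SupportedExactly ν k) (w : ℂ) :
    Integrable (fun x : ℝ => Complex.exp (-w * x) - 1 - -w * x * (cutoff ν : ℂ)) ν ∧
    ∫ x : ℝ, (Complex.exp (-w * x) - 1 - -w * x * (cutoff ν : ℂ)) ∂ν =
      w * ∫ t in 0..k, (Complex.exp (w * t) - cutoff ν) * tail ν t := by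
  have hc : Continuous fun t : ℝ => w * (Complex.exp (w * t) - cutoff ν) := by fun_prop
  have h := integral_tail hν hk hc (by
    simp_rw [norm_mul, mul_assoc]
    exact (integrableOn_exp_sub_cutoff_mul_tail hν hk w).const_mul _)
  have h2 : ∀ x : ℝ, ∫ t in 0..(-x), w * (Complex.exp (w * t) - cutoff ν) =
      Complex.exp (-w * x) - 1 - -w * x * (cutoff ν : ℂ) := by
    intro x
    rw [intervalIntegral.integral_eq_sub_of_hasDerivAt
      (f := fun t : ℝ => Complex.exp (w * t) - w * t * cutoff ν)]
    · push_cast; simp; ring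
    · intro t _
      have h1 : HasDerivAt (fun t : ℝ => w * (t : ℂ)) w t := by
        simpa using (Complex.ofRealCLM.hasDerivAt (x := t)).const_mul w
      exact ((hasDerivAt_exp_mul_ofReal w t).sub (h1.mul_const (cutoff ν : ℂ))).congr_deriv
        (by ring)
    · exact hc.intervalIntegrable _ _
  simp_rw [h2, mul_assoc w, intervalIntegral.integral_const_mul] at h
  exact h

lemma integrable_laplaceExponent (hν : IsLevyMeasure ν) (hk : SupportedExactly ν k) (z : ℂ) :
    Integrable (fun x : ℝ => Complex.exp (z * x) - 1 - z * x * (cutoff ν : ℂ)) ν := by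
  simpa using (laplaceExponent_aux hν hk (-z)).1

lemma laplaceExponent_neg (σ μ : ℝ) (hν : IsLevyMeasure ν) (hk : SupportedExactly ν k) (w : ℂ) :
    laplaceExponent σ μ ν (-w) = (σ : ℂ) ^ 2 / 2 * w ^ 2 - μ * w +
      w * ∫ t in 0..k, (Complex.exp (w * t) - cutoff ν) * tail ν t := by
  rw [laplaceExponent, (laplaceExponent_aux hν hk w).2]; ring

lemma differentiable_integral_tail (hν : IsLevyMeasure ν) (hk : SupportedExactly ν k) :
    Differentiable ℂ fun w : ℂ => ∫ t in 0..k, (Complex.exp (w * t) - cutoff ν) * tail ν t := by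
  intro w
  have hT := measurable_tail (ν := ν)
  refine (intervalIntegral.hasDerivAt_integral_of_dominated_loc_of_deriv_le
    (F := fun (w : ℂ) (t : ℝ) => (Complex.exp (w * t) - cutoff ν) * tail ν t)
    (F' := fun w t => t * Complex.exp (w * t) * tail ν t)
    (bound := fun t => Real.exp ((‖w‖ + 1) * k) * (t * tail ν t)) (s := Metric.ball w 1)
    (Metric.ball_mem_nhds w one_pos) ?_ ?_ ?_ ?_ ?_ ?_).2.differentiableAt
  · exact Eventually.of_forall fun w => Measurable.aestronglyMeasurable (by fun_prop)
  · rw [intervalIntegrable_iff_integrableOn_Ioc_of_le hk.pos.le]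
    refine (integrableOn_exp_sub_cutoff_mul_tail hν hk w).mono' (by fun_prop) (ae_of_all _ ?_)
    intro t
    rw [norm_mul, Complex.norm_real, Real.norm_of_nonneg (tail_nonneg _)]
  · exact Measurable.aestronglyMeasurable (by fun_prop)
  · refine ae_of_all _ fun t ht z hz => ?_
    rw [uIoc_of_le hk.pos.le] at ht
    rw [norm_mul, norm_mul, Complex.norm_real, Complex.norm_real,
      Real.norm_of_nonneg (tail_nonneg _), Real.norm_of_nonneg ht.1.le, mul_comm t, mul_assoc]
    have h1 : ‖z‖ ≤ ‖w‖ + 1 := by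
      have : ‖z - w‖ < 1 := by simpa [dist_eq_norm] using hz
      linarith [norm_sub_norm_le z w]
    have h2 := ht.1.le
    have h3 := tail_nonneg (ν := ν) t
    gcongr
    refine (norm_exp_mul_ofReal_le z ht.1.le ht.2).trans (Real.exp_le_exp.2 ?_)
    have := hk.pos
    gcongr
  · rw [intervalIntegrable_iff_integrableOn_Ioc_of_le hk.pos.le]
    exact (integrableOn_mul_tail hν hk).const_mul _
  · refine ae_of_all _ fun t _ z _ => ?_
    have h1 : HasDerivAt (fun z : ℂ => z * (t : ℂ)) t z := by
      simpa using (hasDerivAt_id z).mul_const (t : ℂ)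
    exact ((h1.cexp.sub_const (cutoff ν : ℂ)).mul_const (tail ν t : ℂ)).congr_deriv (by ring)

lemma differentiable_laplaceExponent (σ μ : ℝ) (hν : IsLevyMeasure ν)
    (hk : SupportedExactly ν k) : Differentiable ℂ (laplaceExponent σ μ ν) := by
  have h1 : Differentiable ℂ fun w : ℂ => laplaceExponent σ μ ν (-w) := by
    simp_rw [laplaceExponent_neg σ μ hν hk]
    have := differentiable_integral_tail hν hk
    fun_prop
  have h2 : laplaceExponent σ μ ν = (fun w : ℂ => laplaceExponent σ μ ν (-w)) ∘ fun z => -z := by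
    ext z; simp
  rw [h2]
  exact h1.comp differentiable_neg

lemma laplaceExponent_conj (σ μ : ℝ) (ν : Measure ℝ) (z : ℂ) :
    laplaceExponent σ μ ν (starRingEnd ℂ z) = starRingEnd ℂ (laplaceExponent σ μ ν z) := by
  simp only [laplaceExponent, map_add, map_mul, map_div₀, map_pow, Complex.conj_ofReal,
    ← integral_conj, map_sub, map_one, ← Complex.exp_conj, map_ofNat]

variable {ν : Measure ℝ} {k : ℝ}

lemma SupportedExactly.ae_ne_zero (hk : SupportedExactly ν k) : ∀ᵐ x ∂ν, x ≠ 0 := by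
  filter_upwards [hk.ae_mem] with x hx using hx.2.ne

lemma integral_pos_of_ae_pos (hk : SupportedExactly ν k) {f : ℝ → ℝ} (hf : Integrable f ν)
    (hpos : ∀ x, x ≠ 0 → 0 < f x) : 0 < ∫ x, f x ∂ν := by
  have h0 : 0 ≤ᵐ[ν] f := by
    filter_upwards [hk.ae_ne_zero] with x hx using (hpos x hx).le
  rw [integral_pos_iff_support_of_nonneg_ae h0 hf]
  have h1 : ν (Function.support f)ᶜ = 0 := by
    refine measure_mono_null (fun x hx => ?_) (ae_iff.1 hk.ae_ne_zero)
    simp only [mem_compl_iff, Function.mem_support, not_not] at hx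
    intro hx0
    exact (hpos x hx0).ne' hx
  by_contra h2
  have h3 : ν (Function.support f) = 0 := by simpa using h2
  exact hk.ne_zero (Measure.measure_univ_eq_zero.1
    (by rw [← union_compl_self (Function.support f)]; exact measure_union_null h3 h1))

lemma re_integrand (z : ℂ) (x h : ℝ) : (Complex.exp (z * x) - 1 - z * x * (h : ℂ)).re =
    Real.exp (z.re * x) * Real.cos (z.im * x) - 1 - z.re * x * h := by
  simp [Complex.exp_re]

lemma im_integrand (z : ℂ) (x h : ℝ) : (Complex.exp (z * x) - 1 - z * x * (h : ℂ)).im =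
    Real.exp (z.re * x) * Real.sin (z.im * x) - z.im * x * h := by
  simp [Complex.exp_im]

variable (σ μ : ℝ) (hν : IsLevyMeasure ν) (hk : SupportedExactly ν k)

lemma integrable_re_integrand (hν : IsLevyMeasure ν) (hk : SupportedExactly ν k) (z : ℂ) :
    Integrable (fun x : ℝ =>
      Real.exp (z.re * x) * Real.cos (z.im * x) - 1 - z.re * x * cutoff ν) ν := by
  have h := (integrable_laplaceExponent hν hk z).re
  simp only [RCLike.re_to_complex, re_integrand] at h
  exact h

lemma re_laplaceExponent (hν : IsLevyMeasure ν) (hk : SupportedExactly ν k) (z : ℂ) :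
    (laplaceExponent σ μ ν z).re = σ ^ 2 / 2 * (z.re ^ 2 - z.im ^ 2) + μ * z.re +
      ∫ x : ℝ, (Real.exp (z.re * x) * Real.cos (z.im * x) - 1 - z.re * x * cutoff ν) ∂ν := by
  have h := integral_re (integrable_laplaceExponent hν hk z)
  simp only [RCLike.re_to_complex, re_integrand] at h
  rw [laplaceExponent, Complex.add_re, ← h, Complex.add_re]
  congr 2
  · rw [show (σ : ℂ) ^ 2 / 2 = ((σ ^ 2 / 2 : ℝ) : ℂ) by push_cast; ring, Complex.re_ofReal_mul]
    congr 1
    simp [sq]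
  · simp

lemma im_laplaceExponent (hν : IsLevyMeasure ν) (hk : SupportedExactly ν k) (z : ℂ) :
    (laplaceExponent σ μ ν z).im = σ ^ 2 / 2 * (2 * z.re * z.im) + μ * z.im +
      ∫ x : ℝ, (Real.exp (z.re * x) * Real.sin (z.im * x) - z.im * x * cutoff ν) ∂ν := by
  have h := integral_im (integrable_laplaceExponent hν hk z)
  simp only [RCLike.im_to_complex, im_integrand] at h
  rw [laplaceExponent, Complex.add_im, ← h, Complex.add_im]
  congr 2
  · rw [show (σ : ℂ) ^ 2 / 2 = ((σ ^ 2 / 2 : ℝ) : ℂ) by push_cast; ring, Complex.im_ofReal_mul]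
    congr 1
    simp [sq]; ring
  · simp

lemma integrable_realIntegrand (hν : IsLevyMeasure ν) (hk : SupportedExactly ν k) (x : ℝ) :
    Integrable (fun t : ℝ => Real.exp (x * t) - 1 - x * t * cutoff ν) ν := by
  simpa using integrable_re_integrand hν hk (x : ℂ)

/-- The Laplace exponent on the real line. -/
noncomputable def realExponent (σ μ : ℝ) (ν : Measure ℝ) (x : ℝ) : ℝ :=
  σ ^ 2 / 2 * x ^ 2 + μ * x + ∫ t : ℝ, (Real.exp (x * t) - 1 - x * t * cutoff ν) ∂ν

lemma laplaceExponent_ofReal (hν : IsLevyMeasure ν) (hk : SupportedExactly ν k) (x : ℝ) :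
    laplaceExponent σ μ ν x = realExponent σ μ ν x := by
  apply Complex.ext
  · simp only [re_laplaceExponent σ μ hν hk, Complex.ofReal_re, Complex.ofReal_im]
    simp [realExponent]
  · rw [im_laplaceExponent σ μ hν hk]; simp

lemma laplaceExponent_ofReal_eq_iff (hν : IsLevyMeasure ν) (hk : SupportedExactly ν k)
    (x q : ℝ) : laplaceExponent σ μ ν x = q ↔ realExponent σ μ ν x = q := by
  rw [laplaceExponent_ofReal σ μ hν hk]; norm_cast

lemma realExponent_zero : realExponent σ μ ν 0 = 0 := by simp [realExponent]

lemma realExponent_sub_re (hν : IsLevyMeasure ν) (hk : SupportedExactly ν k) (z : ℂ) :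
    Integrable (fun t : ℝ => Real.exp (z.re * t) * (1 - Real.cos (z.im * t))) ν ∧
    realExponent σ μ ν z.re - (laplaceExponent σ μ ν z).re =
      σ ^ 2 / 2 * z.im ^ 2 + ∫ t : ℝ, Real.exp (z.re * t) * (1 - Real.cos (z.im * t)) ∂ν := by
  have h1 := integrable_realIntegrand hν hk z.re
  have h2 := integrable_re_integrand hν hk z
  have h3 : (fun t : ℝ => Real.exp (z.re * t) * (1 - Real.cos (z.im * t))) = fun t =>
      (Real.exp (z.re * t) - 1 - z.re * t * cutoff ν) -
        (Real.exp (z.re * t) * Real.cos (z.im * t) - 1 - z.re * t * cutoff ν) := by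
    ext t; ring
  rw [h3, integral_sub h1 h2, re_laplaceExponent σ μ hν hk, realExponent]
  exact ⟨h1.sub h2, by ring⟩

lemma re_laplaceExponent_le (hν : IsLevyMeasure ν) (hk : SupportedExactly ν k) (z : ℂ) :
    (laplaceExponent σ μ ν z).re ≤ realExponent σ μ ν z.re := by
  have h := (realExponent_sub_re σ μ hν hk z).2
  have h1 : 0 ≤ ∫ t : ℝ, Real.exp (z.re * t) * (1 - Real.cos (z.im * t)) ∂ν :=
    integral_nonneg fun t => mul_nonneg (Real.exp_pos _).le (by linarith [Real.cos_le_one (z.im * t)])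
  nlinarith [mul_nonneg (sq_nonneg σ) (sq_nonneg z.im)]

/-- On a vertical line the real part attains its maximum only at real points, up to points where
the Laplace exponent is not real. -/
lemma im_eq_zero_of_re_eq (hν : IsLevyMeasure ν) (hk : SupportedExactly ν k)
    (hmono : 0 < σ ∨ ¬ BoundedVariation ν ∨ 0 < μ) {z : ℂ}
    (h : (laplaceExponent σ μ ν z).re = realExponent σ μ ν z.re)
    (him : (laplaceExponent σ μ ν z).im = 0) : z.im = 0 := by
  by_contra hz
  obtain ⟨hi, he⟩ := realExponent_sub_re σ μ hν hk z
  have hnn : ∀ t : ℝ, 0 ≤ Real.exp (z.re * t) * (1 - Real.cos (z.im * t)) := fun t =>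
    mul_nonneg (Real.exp_pos _).le (by linarith [Real.cos_le_one (z.im * t)])
  have h1 : 0 ≤ ∫ t : ℝ, Real.exp (z.re * t) * (1 - Real.cos (z.im * t)) ∂ν :=
    integral_nonneg hnn
  have h2 : 0 ≤ σ ^ 2 / 2 * z.im ^ 2 := by positivity
  have hσ : σ = 0 := by
    have h3 : σ ^ 2 / 2 * z.im ^ 2 = 0 := by linarith
    have h4 : z.im ^ 2 ≠ 0 := by positivity
    rcases mul_eq_zero.1 h3 with h | h
    · nlinarith
    · exact absurd h h4
  have h5 : ∫ t : ℝ, Real.exp (z.re * t) * (1 - Real.cos (z.im * t)) ∂ν = 0 := by linarith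
  rw [integral_eq_zero_iff_of_nonneg hnn hi] at h5
  have hcos : ∀ᵐ t ∂ν, Real.cos (z.im * t) = 1 := by
    filter_upwards [h5] with t ht
    have := mul_eq_zero.1 ht
    rcases this with h | h
    · exact absurd h (Real.exp_pos _).ne'
    · linarith
  have hbv : BoundedVariation ν := by
    rw [boundedVariation_iff_integrable hν hk]
    refine ((hν.integrable_sq hk).const_mul |z.im|).mono' (by fun_prop) ?_
    filter_upwards [hcos, hk.ae_ne_zero] with t ht ht0
    obtain ⟨m, hm⟩ := (Real.cos_eq_one_iff _).1 ht
    have hm0 : m ≠ 0 := by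
      rintro rfl
      simp only [Int.cast_zero, zero_mul] at hm
      exact mul_ne_zero hz ht0 hm.symm
    have h6 : (1 : ℝ) ≤ |(m : ℝ)| := by exact_mod_cast Int.one_le_abs hm0
    have h7 : 1 ≤ |z.im| * |t| := by
      rw [← abs_mul, ← hm, abs_mul, abs_of_pos (by positivity : (0 : ℝ) < 2 * Real.pi)]
      nlinarith [Real.pi_gt_three]
    rw [Real.norm_eq_abs, ← sq_abs]
    nlinarith [abs_nonneg t]
  have hμ : 0 < μ := by
    rcases hmono with h | h | h
    · exact absurd hσ h.ne'
    · exact absurd hbv h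
    · exact h
  have h8 : ∫ x : ℝ, (Real.exp (z.re * x) * Real.sin (z.im * x) - z.im * x * cutoff ν) ∂ν = 0 := by
    rw [cutoff_of_bv hbv]
    refine integral_eq_zero_of_ae ?_
    filter_upwards [hcos] with t ht
    have : Real.sin (z.im * t) = 0 := by
      have := Real.sin_sq_add_cos_sq (z.im * t)
      rw [ht] at this
      nlinarith
    simp [this]
  rw [im_laplaceExponent σ μ hν hk, h8, hσ] at him
  have : μ * z.im = 0 := by linarith
  exact (mul_ne_zero hμ.ne' hz) this

lemma strictConvexOn_realExponent (hν : IsLevyMeasure ν) (hk : SupportedExactly ν k) :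
    StrictConvexOn ℝ univ (realExponent σ μ ν) := by
  refine ⟨convex_univ, fun x _ y _ hxy a b ha hb hab => ?_⟩
  have hx := (integrable_realIntegrand hν hk x).const_mul a
  have hy := (integrable_realIntegrand hν hk y).const_mul b
  have hxy' := integrable_realIntegrand hν hk (a * x + b * y)
  have hpos := integral_pos_of_ae_pos hk ((hx.add hy).sub hxy') (fun t ht => by
    have := strictConvexOn_exp.2 (mem_univ (x * t)) (mem_univ (y * t))
      (fun h => hxy (mul_right_cancel₀ ht h)) ha hb hab
    simp only [smul_eq_mul] at this
    simp only [Pi.add_apply, Pi.sub_apply]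
    rw [show (a * x + b * y) * t = a * (x * t) + b * (y * t) by ring]
    have hb' : b = 1 - a := by linarith
    subst hb'
    nlinarith)
  rw [integral_sub' (hx.add hy) hxy', integral_add' hx hy, integral_const_mul,
    integral_const_mul] at hpos
  simp only [realExponent, smul_eq_mul]
  have hb' : b = 1 - a := by linarith
  subst hb'
  nlinarith [mul_nonneg (mul_nonneg ha.le hb.le) (mul_nonneg (sq_nonneg σ) (sq_nonneg (x - y)))]

lemma continuous_realExponent (hν : IsLevyMeasure ν) (hk : SupportedExactly ν k) :
    Continuous (realExponent σ μ ν) := by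
  have h : realExponent σ μ ν = fun x : ℝ => (laplaceExponent σ μ ν x).re := by
    ext x; rw [laplaceExponent_ofReal σ μ hν hk]; simp
  rw [h]
  exact Complex.continuous_re.comp
    ((differentiable_laplaceExponent σ μ hν hk).continuous.comp Complex.continuous_ofReal)

lemma exists_neg_realExponent_pos (hν : IsLevyMeasure ν) (hk : SupportedExactly ν k) :
    ∃ x < 0, 0 < realExponent σ μ ν x := by
  have hm : 0 < ∫ t : ℝ, t ^ 2 ∂ν :=
    integral_pos_of_ae_pos hk (hν.integrable_sq hk) fun t ht => by positivity
  set m := ∫ t : ℝ, t ^ 2 ∂ν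
  have hc : 0 ≤ cutoff ν ∧ cutoff ν ≤ 1 := by rw [cutoff]; split_ifs <;> norm_num
  have hle : ∀ y : ℝ, 0 < y → y ^ 2 / 2 * m - μ * y ≤ realExponent σ μ ν (-y) := by
    intro y hy
    have h : ∫ t : ℝ, y ^ 2 / 2 * t ^ 2 ∂ν ≤
        ∫ t : ℝ, (Real.exp (-y * t) - 1 - -y * t * cutoff ν) ∂ν := by
      refine integral_mono_ae ((hν.integrable_sq hk).const_mul _)
        (integrable_realIntegrand hν hk (-y)) ?_
      filter_upwards [hk.ae_mem] with t ht
      have h0 : 0 ≤ -y * t := by nlinarith [ht.2]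
      have := Real.quadratic_le_exp_of_nonneg h0
      nlinarith [mul_nonneg h0 (sub_nonneg.2 hc.2)]
    rw [integral_const_mul] at h
    rw [realExponent]
    nlinarith [mul_nonneg (sq_nonneg σ) (sq_nonneg y)]
  refine ⟨-(2 * (|μ| + 1) / m), by simp only [Left.neg_neg_iff]; positivity, ?_⟩
  refine lt_of_lt_of_le ?_ (hle _ (by positivity))
  have : (2 * (|μ| + 1) / m) ^ 2 / 2 * m - μ * (2 * (|μ| + 1) / m) =
      (2 * (|μ| + 1) / m) * (|μ| + 1 - μ) := by field_simp
  rw [this]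
  have := le_abs_self μ
  apply mul_pos (by positivity) (by linarith)

lemma exists_pos_realExponent_pos (hσ : 0 ≤ σ) (hν : IsLevyMeasure ν) (hk : SupportedExactly ν k)
    (hmono : 0 < σ ∨ ¬ BoundedVariation ν ∨ 0 < μ) :
    ∃ x, 0 < x ∧ 0 < realExponent σ μ ν x := by
  set f : ℕ → ℝ → ℝ := fun n t =>
    (Real.exp ((n + 1 : ℝ) * t) - 1 - (n + 1) * t * cutoff ν) / (n + 1) with hf
  have hfi : ∀ n, Integrable (f n) ν := fun n => by
    simpa [hf] using (integrable_realIntegrand hν hk (n + 1)).div_const ((n : ℝ) + 1)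
  have hg : ∀ n : ℕ, realExponent σ μ ν (n + 1) =
      (n + 1) * (σ ^ 2 / 2 * (n + 1) + (μ + ∫ t, f n t ∂ν)) := by
    intro n
    rw [realExponent, hf, integral_div]
    generalize ∫ t : ℝ, (Real.exp ((n + 1 : ℝ) * t) - 1 - (n + 1) * t * cutoff ν) ∂ν = I
    field_simp
    ring
  have hlim : ∀ t < 0, Tendsto (fun n => f n t) atTop (𝓝 (-(t * cutoff ν))) := by
    intro t ht
    have h1 : Tendsto (fun n : ℕ => (1 : ℝ) / (n + 1)) atTop (𝓝 0) :=
      tendsto_one_div_add_atTop_nhds_zero_nat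
    have h2 : ∀ n : ℕ, f n t =
        (Real.exp ((n + 1 : ℝ) * t) - 1) * (1 / ((n : ℝ) + 1)) - t * cutoff ν := by
      intro n
      have : (n : ℝ) + 1 ≠ 0 := by positivity
      simp only [hf]; field_simp
    have h3 : Tendsto (fun n : ℕ => (Real.exp ((n + 1 : ℝ) * t) - 1) * (1 / ((n : ℝ) + 1)))
        atTop (𝓝 0) := by
      refine squeeze_zero_norm (a := fun n : ℕ => (1 : ℝ) / (n + 1)) (fun n => ?_) h1
      have h4 : Real.exp ((n + 1 : ℝ) * t) ≤ 1 := by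
        rw [Real.exp_le_one_iff]; nlinarith [(n.cast_nonneg : (0:ℝ) ≤ n)]
      have h5 : |Real.exp ((n + 1 : ℝ) * t) - 1| ≤ 1 :=
        abs_le.2 ⟨by linarith [Real.exp_pos ((n + 1 : ℝ) * t)], by linarith⟩
      have h6 : (0 : ℝ) ≤ 1 / (n + 1) := by positivity
      rw [norm_mul, Real.norm_eq_abs, Real.norm_of_nonneg h6]
      nlinarith
    simp_rw [h2]
    simpa using h3.sub_const (t * cutoff ν)
  by_contra! hcon
  have hle : ∀ n : ℕ, σ ^ 2 / 2 * (n + 1) + (μ + ∫ t, f n t ∂ν) ≤ 0 := by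
    intro n
    have h1 := hcon (n + 1) (by positivity)
    rw [hg] at h1
    by_contra! h2
    have : (0 : ℝ) < n + 1 := by positivity
    nlinarith [mul_pos this h2]
  by_cases hbv : BoundedVariation ν
  · have hI : Tendsto (fun n => ∫ t, f n t ∂ν) atTop (𝓝 (∫ t : ℝ, (0 : ℝ) ∂ν)) := by
      refine tendsto_integral_of_dominated_convergence (fun t => |t|)
        (fun n => (hfi n).aestronglyMeasurable)
        ((boundedVariation_iff_integrable hν hk).1 hbv).abs (fun n => ?_) ?_
      · filter_upwards [hk.ae_mem] with t ht
        have hn : (0 : ℝ) < n + 1 := by positivity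
        simp only [hf, cutoff_of_bv hbv, mul_zero, sub_zero, norm_div, Real.norm_eq_abs]
        rw [abs_of_pos hn, div_le_iff₀ hn, abs_of_neg ht.2, abs_le]
        have h1 := Real.add_one_le_exp ((n + 1 : ℝ) * t)
        have h4 : Real.exp ((n + 1 : ℝ) * t) ≤ 1 := by
          rw [Real.exp_le_one_iff]; nlinarith [ht.2]
        constructor <;> nlinarith [ht.2]
      · filter_upwards [hk.ae_mem] with t ht
        have := hlim t ht.2
        rwa [cutoff_of_bv hbv, mul_zero, neg_zero] at this
    simp only [integral_zero] at hI
    rcases hσ.eq_or_lt with hσ0 | hσ0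
    · have hμ : 0 < μ := by
        rcases hmono with h | h | h
        · exact absurd hσ0 h.ne
        · exact absurd hbv h
        · exact h
      have h1 := le_of_tendsto (hI.const_add μ) (Eventually.of_forall fun n => by
        have := hle n
        rw [← hσ0] at this
        linarith : ∀ᶠ n in atTop, μ + ∫ t, f n t ∂ν ≤ 0)
      linarith
    · have h1 : Tendsto (fun n : ℕ => σ ^ 2 / 2 * ((n : ℝ) + 1)) atTop atTop :=
        Tendsto.const_mul_atTop (by positivity)
          (tendsto_atTop_add_const_right _ _ tendsto_natCast_atTop_atTop)
      have h2 := h1.atTop_add (hI.const_add μ)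
      obtain ⟨n, hn⟩ := (h2.eventually_gt_atTop 0).exists
      exact absurd (hle n) (not_le.2 hn)
  · apply hbv
    rw [boundedVariation_iff_integrable hν hk, ← integrable_neg_iff]
    have hnn : 0 ≤ᵐ[ν] fun t : ℝ => -t := by
      filter_upwards [hk.ae_mem] with t ht
      simpa using ht.2.le
    refine (lintegral_ofReal_ne_top_iff_integrable (by fun_prop) hnn).1 ?_
    have hfn : ∀ n t, 0 ≤ f n t := by
      intro n t
      simp only [hf, cutoff_of_not_bv hbv, mul_one]
      have := Real.add_one_le_exp ((n + 1 : ℝ) * t)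
      exact div_nonneg (by linarith) (by positivity)
    have h1 : ∫⁻ t, ENNReal.ofReal (-t) ∂ν ≤
        liminf (fun n => ∫⁻ t, ENNReal.ofReal (f n t) ∂ν) atTop := by
      refine le_trans (lintegral_mono_ae ?_) (lintegral_liminf_le' fun n =>
        (hfi n).aemeasurable.ennreal_ofReal)
      filter_upwards [hk.ae_mem] with t ht
      have := hlim t ht.2
      rw [cutoff_of_not_bv hbv, mul_one] at this
      exact ((ENNReal.continuous_ofReal.tendsto _).comp this).liminf_eq.ge
    refine (h1.trans_lt (lt_of_le_of_lt ?_ (ENNReal.ofReal_lt_top (r := -μ)))).ne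
    refine liminf_le_of_le (by isBoundedDefault) fun b hb => ?_
    obtain ⟨n, hn⟩ := hb.exists
    refine hn.trans ?_
    rw [← ofReal_integral_eq_lintegral_ofReal (hfi n) (ae_of_all _ (hfn n))]
    apply ENNReal.ofReal_le_ofReal
    have := hle n
    have h2 : 0 ≤ σ ^ 2 / 2 * ((n : ℝ) + 1) := by positivity
    linarith


/-- The real solutions of `ψ = q` and the position of the others. -/
lemma exists_real_roots (hσ : 0 ≤ σ) (hν : IsLevyMeasure ν) (hk : SupportedExactly ν k)
    (hmono : 0 < σ ∨ ¬ BoundedVariation ν ∨ 0 < μ) {q : ℝ}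
    (hq : 0 < q ∨ (q = 0 ∧ 0 < Phi (laplaceExponent σ μ ν) q)) :
    ∃ a ≤ 0, 0 < Phi (laplaceExponent σ μ ν) q ∧ realExponent σ μ ν a = q ∧
      realExponent σ μ ν (Phi (laplaceExponent σ μ ν) q) = q ∧
      (∀ x, realExponent σ μ ν x = q → x = a ∨ x = Phi (laplaceExponent σ μ ν) q) ∧
      ∀ x, q ≤ realExponent σ μ ν x → x ≤ a ∨ Phi (laplaceExponent σ μ ν) q ≤ x := by
  have hsc := strictConvexOn_realExponent σ μ hν hk
  have hcont := continuous_realExponent σ μ hν hk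
  have hset : {x : ℝ | 0 ≤ x ∧ laplaceExponent σ μ ν x = q} =
      {x : ℝ | 0 ≤ x ∧ realExponent σ μ ν x = q} := by
    ext x; simp only [mem_ofPred_eq, laplaceExponent_ofReal_eq_iff σ μ hν hk]
  set g := realExponent σ μ ν with hgdef
  have hg0 : g 0 = 0 := realExponent_zero σ μ
  -- superlinear growth away from the origin
  have hgrow : 0 < q → ∀ x, 0 < g x → ∃ s, 1 ≤ s ∧ q ≤ g (s * x) := by
    intro hq0 x hx
    refine ⟨1 + q / g x, by have := div_pos hq0 hx; linarith, ?_⟩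
    set s := 1 + q / g x with hs
    have hs1 : 1 ≤ s := by have := div_pos hq0 hx; linarith
    have h1 := hsc.convexOn.2 (mem_univ (s * x)) (mem_univ 0)
      (show 0 ≤ 1 / s by positivity)
      (show 0 ≤ 1 - 1 / s by rw [sub_nonneg, div_le_one (by linarith)]; exact hs1) (by ring)
    simp only [smul_eq_mul, mul_zero, add_zero, hg0] at h1
    rw [show 1 / s * (s * x) = x by field_simp, one_div, ← div_eq_inv_mul,
      le_div_iff₀ (by linarith)] at h1
    have h2 : g x * s = g x + q := by rw [hs]; field_simp
    linarith
  have key : ∃ a r, a ≤ 0 ∧ 0 < r ∧ g a = q ∧ g r = q := by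
    rcases hq with hq | ⟨rfl, hq⟩
    · obtain ⟨x1, hx1, hx1'⟩ := exists_pos_realExponent_pos σ μ hσ hν hk hmono
      obtain ⟨x2, hx2, hx2'⟩ := exists_neg_realExponent_pos σ μ hν hk
      obtain ⟨s1, hs1, hs1'⟩ := hgrow hq x1 hx1'
      obtain ⟨s2, hs2, hs2'⟩ := hgrow hq x2 hx2'
      obtain ⟨r, hr, hr'⟩ := intermediate_value_Icc (by positivity : 0 ≤ s1 * x1)
        hcont.continuousOn (show q ∈ Icc (g 0) (g (s1 * x1)) from ⟨by rw [hg0]; exact hq.le, hs1'⟩)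
      obtain ⟨a, ha, ha'⟩ := intermediate_value_Icc' (by nlinarith : s2 * x2 ≤ 0)
        hcont.continuousOn (show q ∈ Icc (g 0) (g (s2 * x2)) from ⟨by rw [hg0]; exact hq.le, hs2'⟩)
      refine ⟨a, r, ha.2, lt_of_le_of_ne hr.1 ?_, ha', hr'⟩
      rintro rfl
      linarith
    · by_contra! hcon
      have : Phi (laplaceExponent σ μ ν) 0 ≤ 0 := by
        rw [Phi, hset]
        refine Real.sSup_le (fun x hx => ?_) le_rfl
        by_contra! hx0
        exact hcon 0 x le_rfl hx0 hg0 hx.2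
      linarith
  obtain ⟨a, r, ha, hr, hga, hgr⟩ := key
  have har : a < r := by linarith
  have h1 : ∀ x, q ≤ g x → x ≤ a ∨ r ≤ x := by
    intro x hx
    by_contra! h
    have hmem : x ∈ openSegment ℝ a r := by
      rw [openSegment_eq_Ioo har]; exact ⟨h.1, h.2⟩
    have := hsc.lt_on_openSegment (mem_univ a) (mem_univ r) har.ne hmem
    rw [hga, hgr, max_self] at this
    linarith
  have h2 : ∀ x, g x = q → x = a ∨ x = r := by
    intro x hx
    by_contra! h
    rcases h1 x hx.ge with h3 | h3
    · have hxa : x < a := lt_of_le_of_ne h3 h.1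
      have hmem : a ∈ openSegment ℝ x r := by
        rw [openSegment_eq_Ioo (by linarith)]; exact ⟨hxa, har⟩
      have := hsc.lt_on_openSegment (mem_univ x) (mem_univ r) (by linarith) hmem
      rw [hx, hgr, max_self] at this
      linarith
    · have hxr : r < x := lt_of_le_of_ne h3 (Ne.symm h.2)
      have hmem : r ∈ openSegment ℝ a x := by
        rw [openSegment_eq_Ioo (by linarith)]; exact ⟨har, hxr⟩
      have := hsc.lt_on_openSegment (mem_univ a) (mem_univ x) (by linarith) hmem
      rw [hx, hga, max_self] at this
      linarith
  have hPhi : Phi (laplaceExponent σ μ ν) q = r := by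
    rw [Phi, hset]
    refine (IsGreatest.csSup_eq ⟨⟨hr.le, hgr⟩, fun x hx => ?_⟩)
    rcases h2 x hx.2 with h | h <;> linarith
  rw [hPhi]
  exact ⟨a, ha, hr, hga, hgr, h2, h1⟩

/-- The solutions of `ψ = q` other than the two real ones lie to the left or to the right of the
strip that those bound. -/
lemma root_cases (hν : IsLevyMeasure ν) (hk : SupportedExactly ν k)
    (hmono : 0 < σ ∨ ¬ BoundedVariation ν ∨ 0 < μ) {q a b : ℝ}
    (ha : realExponent σ μ ν a = q) (hb : realExponent σ μ ν b = q)
    (hab : ∀ x, realExponent σ μ ν x = q → x = a ∨ x = b)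
    (hab' : ∀ x, q ≤ realExponent σ μ ν x → x ≤ a ∨ b ≤ x) {z : ℂ}
    (hz : laplaceExponent σ μ ν z = q) :
    z = a ∨ z = b ∨ (z.im ≠ 0 ∧ (z.re < a ∨ b < z.re)) := by
  have hre : (laplaceExponent σ μ ν z).re = q := by rw [hz]; simp
  by_cases h : realExponent σ μ ν z.re = q
  · have him := im_eq_zero_of_re_eq σ μ hν hk hmono (z := z) (by rw [h, hre]) (by rw [hz]; simp)
    rcases hab _ h with h1 | h1
    · exact Or.inl (Complex.ext (by simpa using h1) (by simpa using him))
    · exact Or.inr (Or.inl (Complex.ext (by simpa using h1) (by simpa using him)))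
  · have hle := re_laplaceExponent_le σ μ hν hk z
    rw [hre] at hle
    refine Or.inr (Or.inr ⟨fun him => h ?_, ?_⟩)
    · have : z = (z.re : ℂ) := Complex.ext (by simp) (by simpa using him)
      rw [this, laplaceExponent_ofReal_eq_iff σ μ hν hk] at hz
      exact hz
    · rcases hab' _ hle with h1 | h1
      · refine Or.inl (lt_of_le_of_ne h1 fun h2 => h ?_)
        rw [h2]; exact ha
      · refine Or.inr (lt_of_le_of_ne h1 fun h2 => h ?_)
        rw [← h2]; exact hb

/-- The part of the complex plane in which the asymptotics hold. -/
def region (c : ℝ) : Set ℂ := {w | -c ≤ w.re ∧ 0 ≤ w.im}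

/-- Approach to infinity inside `region c`. -/
noncomputable def regionFilter (c : ℝ) : Filter ℂ := Bornology.cobounded ℂ ⊓ 𝓟 (region c)

/-- The size of `A w ^ p + B e ^ {k w} / w ^ n`. -/
noncomputable def gauge (p k : ℝ) (n : ℕ) (w : ℂ) : ℝ :=
  ‖w‖ ^ p + Real.exp (k * w.re) / ‖w‖ ^ n

lemma gauge_nonneg (p k : ℝ) (n : ℕ) (w : ℂ) : 0 ≤ gauge p k n w := by
  unfold gauge; positivity

lemma exp_mul_rpow_le_gauge {p k θ : ℝ} (n : ℕ) (h0 : 0 ≤ θ) (h1 : θ ≤ 1) {w : ℂ} (hw : w ≠ 0) :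
    Real.exp (θ * k * w.re) * ‖w‖ ^ (p - θ * (p + n)) ≤ gauge p k n w := by
  have hw' : 0 < ‖w‖ := norm_pos_iff.2 hw
  have hX : 0 < Real.exp (k * w.re) / ‖w‖ ^ n := by positivity
  have hP : 0 < ‖w‖ ^ p := by positivity
  have h := Real.geom_mean_le_arith_mean2_weighted (sub_nonneg.2 h1) h0 hP.le hX.le (by ring)
  have h2 : (‖w‖ ^ p) ^ (1 - θ) * (Real.exp (k * w.re) / ‖w‖ ^ n) ^ θ =
      Real.exp (θ * k * w.re) * ‖w‖ ^ (p - θ * (p + n)) := by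
    rw [Real.div_rpow (by positivity) (by positivity), ← Real.exp_mul, ← Real.rpow_natCast,
      ← Real.rpow_mul hw'.le, ← Real.rpow_mul hw'.le,
      show p - θ * (p + n) = p * (1 - θ) - n * θ by ring, Real.rpow_sub hw']
    rw [show k * w.re * θ = θ * k * w.re by ring]
    ring
  rw [h2] at h
  refine h.trans ?_
  unfold gauge
  nlinarith [mul_nonneg h0 hP.le, mul_nonneg (sub_nonneg.2 h1) hX.le]

lemma exp_mul_rpow_isLittleO_gauge {p k θ a : ℝ} (n : ℕ) (h0 : 0 ≤ θ) (h1 : θ ≤ 1)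
    (ha : a < p - θ * (p + n)) :
    (fun w : ℂ => Real.exp (θ * k * w.re) * ‖w‖ ^ a) =o[Bornology.cobounded ℂ] gauge p k n := by
  rw [Asymptotics.isLittleO_iff]
  intro ε hε
  have ht : Tendsto (fun w : ℂ => ‖w‖ ^ (-(p - θ * (p + n) - a))) (Bornology.cobounded ℂ) (𝓝 0) :=
    (tendsto_rpow_neg_atTop (sub_pos.2 ha)).comp tendsto_norm_cobounded_atTop
  filter_upwards [ht.eventually_lt_const hε,
    tendsto_norm_cobounded_atTop.eventually_gt_atTop 0] with w hw hw0
  rw [Real.norm_of_nonneg (by positivity), Real.norm_of_nonneg (gauge_nonneg _ _ _ _)]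
  have h2 := exp_mul_rpow_le_gauge (p := p) (k := k) n h0 h1 (norm_pos_iff.1 hw0)
  have h3 : ‖w‖ ^ a = ‖w‖ ^ (p - θ * (p + n)) * ‖w‖ ^ (-(p - θ * (p + n) - a)) := by
    rw [← Real.rpow_add hw0]; ring_nf
  rw [h3]
  calc _ = ‖w‖ ^ (-(p - θ * (p + n) - a)) *
        (Real.exp (θ * k * w.re) * ‖w‖ ^ (p - θ * (p + n))) := by ring
    _ ≤ ε * gauge p k n w := by gcongr

/-- `g` has finite one-sided limits at all points of `[a, b]`, from within `[a, b]`. -/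
def Regulated (g : ℝ → ℝ) (a b : ℝ) : Prop :=
  (∀ p ∈ Ico a b, ∃ l, Tendsto g (𝓝[>] p) (𝓝 l)) ∧ ∀ p ∈ Ioc a b, ∃ l, Tendsto g (𝓝[<] p) (𝓝 l)

lemma Regulated.bounded {g : ℝ → ℝ} {a b : ℝ} (h : Regulated g a b) :
    ∃ M, 0 ≤ M ∧ ∀ y ∈ Icc a b, |g y| ≤ M := by
  have key : ∃ M, ∀ y ∈ Icc a b ∩ Icc a b, |g y| ≤ M := by
    refine isCompact_Icc.induction_on (p := fun s => ∃ M, ∀ y ∈ s ∩ Icc a b, |g y| ≤ M)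
      ⟨0, by simp⟩ (fun s t hst ⟨M, hM⟩ => ⟨M, fun y hy => hM y ⟨hst hy.1, hy.2⟩⟩)
      (fun s t ⟨M, hM⟩ ⟨M', hM'⟩ => ⟨max M M', ?_⟩) (fun p hp => ?_)
    · rintro y ⟨hy | hy, hy'⟩
      · exact (hM y ⟨hy, hy'⟩).trans (le_max_left _ _)
      · exact (hM' y ⟨hy, hy'⟩).trans (le_max_right _ _)
    · have hr : ∃ M, ∀ᶠ y in 𝓝[>] p, y ∈ Icc a b → |g y| ≤ M := by
        rcases hp.2.lt_or_eq with hpb | rfl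
        · obtain ⟨l, hl⟩ := h.1 p ⟨hp.1, hpb⟩
          exact ⟨|l| + 1, (hl.abs.eventually_le_const (lt_add_one _)).mono fun y hy _ => hy⟩
        · exact ⟨0, eventually_mem_nhdsWithin.mono fun y hy hy' => absurd hy'.2 (not_le.2 hy)⟩
      have hl : ∃ M, ∀ᶠ y in 𝓝[<] p, y ∈ Icc a b → |g y| ≤ M := by
        rcases hp.1.lt_or_eq with hpa | rfl
        · obtain ⟨l, hl⟩ := h.2 p ⟨hpa, hp.2⟩
          exact ⟨|l| + 1, (hl.abs.eventually_le_const (lt_add_one _)).mono fun y hy _ => hy⟩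
        · exact ⟨0, eventually_mem_nhdsWithin.mono fun y hy hy' => absurd hy'.1 (not_le.2 hy)⟩
      obtain ⟨M, hM⟩ := hr
      obtain ⟨M', hM'⟩ := hl
      set M₀ := max (max M M') |g p|
      have h1 : ∀ᶠ y in 𝓝 p, y ∈ Icc a b → |g y| ≤ M₀ := by
        rw [← nhdsNE_sup_pure, ← nhdsLT_sup_nhdsGT, eventually_sup, eventually_sup, eventually_pure]
        exact ⟨⟨hM'.mono fun y hy hy' => (hy hy').trans ((le_max_right _ _).trans (le_max_left _ _)),
          hM.mono fun y hy hy' => (hy hy').trans ((le_max_left _ _).trans (le_max_left _ _))⟩,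
          fun _ => le_max_right _ _⟩
      exact ⟨_, mem_nhdsWithin_of_mem_nhds h1, M₀, fun y hy => hy.1 hy.2⟩
  obtain ⟨M, hM⟩ := key
  exact ⟨|M|, abs_nonneg _, fun y hy => (hM y ⟨hy, hy⟩).trans (le_abs_self M)⟩

lemma Regulated.intervalIntegrable {g : ℝ → ℝ} {a b : ℝ} (h : Regulated g a b) (hab : a ≤ b)
    (hg : Measurable g) : IntervalIntegrable g volume a b := by
  obtain ⟨M, -, hM⟩ := h.bounded
  rw [intervalIntegrable_iff_integrableOn_Ioc_of_le hab]
  refine Measure.integrableOn_of_bounded (M := M) (by simp) hg.aestronglyMeasurable ?_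
  filter_upwards [ae_restrict_mem measurableSet_Ioc] with y hy
  exact hM y ⟨hy.1.le, hy.2⟩

lemma norm_exp_mul_ofReal (w : ℂ) (y : ℝ) : ‖Complex.exp (w * y)‖ = Real.exp (w.re * y) := by
  simp [Complex.norm_exp]

lemma intervalIntegrable_exp_mul {g : ℝ → ℝ} {a b : ℝ} (hg : IntervalIntegrable g volume a b)
    (w : ℂ) : IntervalIntegrable (fun y : ℝ => Complex.exp (w * y) * g y) volume a b :=
  IntervalIntegrable.continuousOn_mul ⟨hg.1.ofReal, hg.2.ofReal⟩
    (Continuous.continuousOn (by fun_prop))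

lemma hasDerivAt_exp_mul_mul {g : ℝ → ℝ} {g' y : ℝ} (hg : HasDerivAt g g' y) (w : ℂ) :
    HasDerivAt (fun y : ℝ => Complex.exp (w * y) * g y)
      (w * (Complex.exp (w * y) * g y) + Complex.exp (w * y) * g') y :=
  ((hasDerivAt_exp_mul_ofReal w y).mul hg.ofReal_comp).congr_deriv (by ring)

lemma exp_mul_le_of_neg_le {c x y b : ℝ} (hx : -c ≤ x) (hc : 0 ≤ c) (hy0 : 0 ≤ y) (hy : y ≤ b) :
    Real.exp (x * y) ≤ Real.exp (c * b) * Real.exp (x * b) := by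
  rw [← Real.exp_add]
  apply Real.exp_le_exp.2
  nlinarith [mul_nonneg (by linarith : 0 ≤ x + c) (sub_nonneg.2 hy), mul_nonneg hc hy0]

lemma norm_integral_exp_mul_le {g : ℝ → ℝ} {a b c M : ℝ} (hc : 0 ≤ c) (ha : 0 ≤ a) (hab : a ≤ b)
    (hM : ∀ y ∈ Icc a b, |g y| ≤ M) {w : ℂ} (hw : -c ≤ w.re) :
    ‖∫ y in a..b, Complex.exp (w * y) * g y‖ ≤
      Real.exp (c * b) * Real.exp (w.re * b) * M * (b - a) := by
  have h := intervalIntegral.norm_integral_le_of_norm_le_const (a := a) (b := b)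
    (f := fun y : ℝ => Complex.exp (w * y) * g y)
    (C := Real.exp (c * b) * Real.exp (w.re * b) * M) (fun y hy => by
      rw [uIoc_of_le hab] at hy
      rw [norm_mul, norm_exp_mul_ofReal, Complex.norm_real]
      gcongr
      · exact exp_mul_le_of_neg_le hw hc (ha.trans hy.1.le) hy.2
      · exact hM y ⟨hy.1.le, hy.2⟩)
  rwa [abs_of_nonneg (sub_nonneg.2 hab)] at h

/-- Integration by parts on an interval without breakpoints. -/
lemma mul_integral_exp_mul {g g' : ℝ → ℝ} {a b la lb : ℝ} (hab : a < b)
    (hd : ∀ y ∈ Ioo a b, HasDerivAt g (g' y) y) (hi : IntervalIntegrable g volume a b)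
    (hi' : IntervalIntegrable g' volume a b)
    (hla : Tendsto g (𝓝[>] a) (𝓝 la)) (hlb : Tendsto g (𝓝[<] b) (𝓝 lb)) (w : ℂ) :
    w * ∫ y in a..b, Complex.exp (w * y) * g y =
      Complex.exp (w * b) * lb - Complex.exp (w * a) * la -
        ∫ y in a..b, Complex.exp (w * y) * g' y := by
  have hc : Continuous fun y : ℝ => Complex.exp (w * y) := by fun_prop
  have h := intervalIntegral.integral_eq_sub_of_hasDerivAt_of_tendsto hab
    (f := fun y : ℝ => Complex.exp (w * y) * g y)
    (fun y hy => hasDerivAt_exp_mul_mul (hd y hy) w)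
    (((intervalIntegrable_exp_mul hi w).const_mul w).add (intervalIntegrable_exp_mul hi' w))
    (((hc.tendsto a).mono_left nhdsWithin_le_nhds).mul
      ((Complex.continuous_ofReal.tendsto _).comp hla))
    (((hc.tendsto b).mono_left nhdsWithin_le_nhds).mul
      ((Complex.continuous_ofReal.tendsto _).comp hlb))
  rw [intervalIntegral.integral_add ((intervalIntegrable_exp_mul hi w).const_mul w) (intervalIntegrable_exp_mul hi' w),
    intervalIntegral.integral_const_mul] at h
  rw [← h]; ring

lemma Regulated.mono {g : ℝ → ℝ} {a b a' b' : ℝ} (h : Regulated g a b) (ha : a ≤ a')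
    (hb : b' ≤ b) : Regulated g a' b' :=
  ⟨fun p hp => h.1 p ⟨ha.trans hp.1, hp.2.trans_le hb⟩,
    fun p hp => h.2 p ⟨ha.trans_lt hp.1, hp.2.trans hb⟩⟩

/-- Decay of the Laplace transform of a piecewise `C¹` function. -/
lemma exists_norm_mul_integral_exp_le {g g' : ℝ → ℝ} {c : ℝ} (hc : 0 ≤ c) (hg : Measurable g)
    (hg' : Measurable g') (s : Finset ℝ) : ∀ {a b : ℝ}, 0 ≤ a → a < b → Regulated g a b →
    Regulated g' a b → (∀ y ∈ Ioo a b, y ∉ s → HasDerivAt g (g' y) y) →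
    ∃ C, ∀ w : ℂ, -c ≤ w.re →
      ‖w * ∫ y in a..b, Complex.exp (w * y) * g y‖ ≤ C * Real.exp (w.re * b) := by
  induction s using Finset.induction with
  | empty =>
    intro a b ha hab hr hr' hd
    obtain ⟨la, hla⟩ := hr.1 a ⟨le_rfl, hab⟩
    obtain ⟨lb, hlb⟩ := hr.2 b ⟨hab, le_rfl⟩
    obtain ⟨M, hM0, hM⟩ := hr'.bounded
    refine ⟨|lb| + Real.exp (c * b) * |la| + Real.exp (c * b) * M * (b - a), fun w hw => ?_⟩
    rw [mul_integral_exp_mul hab (fun y hy => hd y hy (by simp))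
      (hr.intervalIntegrable hab.le hg) (hr'.intervalIntegrable hab.le hg') hla hlb w]
    have h1 := norm_integral_exp_mul_le hc ha hab.le hM hw
    have h2 : ‖Complex.exp (w * b) * lb‖ = Real.exp (w.re * b) * |lb| := by
      rw [norm_mul, norm_exp_mul_ofReal, Complex.norm_real, Real.norm_eq_abs]
    have h3 : ‖Complex.exp (w * a) * la‖ ≤ Real.exp (c * b) * Real.exp (w.re * b) * |la| := by
      rw [norm_mul, norm_exp_mul_ofReal, Complex.norm_real, Real.norm_eq_abs]
      gcongr
      exact exp_mul_le_of_neg_le hw hc ha hab.le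
    calc _ ≤ ‖Complex.exp (w * b) * lb‖ + ‖Complex.exp (w * a) * la‖ + _ := norm_sub_le_of_le
          (norm_sub_le _ _) h1
      _ ≤ _ := by rw [h2]; nlinarith
  | insert p s _ ih =>
    intro a b ha hab hr hr' hd
    by_cases hp : p ∈ Ioo a b
    · obtain ⟨C₁, h₁⟩ := ih ha hp.1 (hr.mono le_rfl hp.2.le) (hr'.mono le_rfl hp.2.le)
        (fun y hy hys => hd y ⟨hy.1, hy.2.trans hp.2⟩ (by simp [hys, hy.2.ne]))
      obtain ⟨C₂, h₂⟩ := ih (ha.trans hp.1.le) hp.2 (hr.mono hp.1.le le_rfl)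
        (hr'.mono hp.1.le le_rfl)
        (fun y hy hys => hd y ⟨hp.1.trans hy.1, hy.2⟩ (by simp [hys, hy.1.ne']))
      refine ⟨|C₁| * Real.exp (c * b) + C₂, fun w hw => ?_⟩
      rw [← intervalIntegral.integral_add_adjacent_intervals (b := p)
        (intervalIntegrable_exp_mul ((hr.mono le_rfl hp.2.le).intervalIntegrable hp.1.le hg) w)
        (intervalIntegrable_exp_mul ((hr.mono hp.1.le le_rfl).intervalIntegrable hp.2.le hg) w), mul_add]
      refine (norm_add_le_of_le (h₁ w hw) (h₂ w hw)).trans ?_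
      have h3 := exp_mul_le_of_neg_le hw hc (ha.trans hp.1.le) hp.2.le
      have h4 : C₁ * Real.exp (w.re * p) ≤ |C₁| * (Real.exp (c * b) * Real.exp (w.re * b)) := by
        gcongr
        exact le_abs_self _
      linarith
    · exact ih ha hab hr hr' fun y hy hys => hd y hy (by
        simp only [Finset.mem_insert, hys, or_false]
        rintro rfl
        exact hp hy)

lemma regionFilter_le (c : ℝ) : regionFilter c ≤ Bornology.cobounded ℂ := inf_le_left

lemma eventually_mem_region (c : ℝ) : ∀ᶠ w in regionFilter c, w ∈ region c :=
  mem_inf_of_right (mem_principal_self _)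

lemma eventually_norm_ge (c R : ℝ) : ∀ᶠ w in regionFilter c, R ≤ ‖w‖ :=
  (tendsto_norm_cobounded_atTop.eventually_ge_atTop R).filter_mono (regionFilter_le c)

/-- Integration by parts for a function that vanishes at the right endpoint. -/
lemma integral_exp_mul_by_parts {g g' : ℝ → ℝ} {a b : ℝ} (hab : a ≤ b) (s : Finset ℝ)
    (hg : ContinuousOn g (Icc a b)) (hb : g b = 0)
    (hd : ∀ y ∈ Ioo a b, y ∉ s → HasDerivAt g (g' y) y)
    (hi' : IntervalIntegrable g' volume a b) (w : ℂ) :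
    w * ∫ y in a..b, Complex.exp (w * y) * g y =
      - (Complex.exp (w * a) * g a) - ∫ y in a..b, Complex.exp (w * y) * g' y := by
  have hi : IntervalIntegrable g volume a b := (by rwa [uIcc_of_le hab] :
    ContinuousOn g (uIcc a b)).intervalIntegrable
  have h := MeasureTheory.integral_eq_of_hasDerivAt_off_countable_of_le
    (fun y : ℝ => Complex.exp (w * y) * g y) _ hab (s.countable_toSet)
    ((Continuous.continuousOn (by fun_prop)).mul
      (Complex.continuous_ofReal.comp_continuousOn hg))
    (fun y hy => hasDerivAt_exp_mul_mul (hd y hy.1 hy.2) w)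
    (((intervalIntegrable_exp_mul hi w).const_mul w).add (intervalIntegrable_exp_mul hi' w))
  rw [intervalIntegral.integral_add ((intervalIntegrable_exp_mul hi w).const_mul w)
    (intervalIntegrable_exp_mul hi' w), intervalIntegral.integral_const_mul, hb] at h
  simp only [Complex.ofReal_zero, mul_zero] at h
  linear_combination h

lemma exists_repeated_by_parts_bound {g : ℕ → ℝ → ℝ} {n : ℕ} {s : Finset ℝ} {a b : ℝ}
    (hab : a ≤ b) (hcont : ∀ j < n, ContinuousOn (g j) (Icc a b)) (hz : ∀ j < n, g j b = 0)
    (hd : ∀ j < n, ∀ y ∈ Ioo a b, y ∉ s → HasDerivAt (g j) (g (j + 1) y) y)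
    (hi : IntervalIntegrable (g n) volume a b) :
    ∀ j ≤ n, ∃ C, 0 ≤ C ∧ ∀ w : ℂ, 1 ≤ ‖w‖ →
      ‖w * (∫ y in a..b, Complex.exp (w * y) * g 0 y) -
        w * ((-1 / w) ^ j * ∫ y in a..b, Complex.exp (w * y) * g j y)‖ ≤
          C * Real.exp (w.re * a) := by
  intro j
  induction j with
  | zero => exact fun _ => ⟨0, le_rfl, fun w _ => by simp⟩
  | succ j ih =>
    intro hj
    obtain ⟨C, hC0, hC⟩ := ih (by omega)
    refine ⟨C + |g j a|, by positivity, fun w hw => ?_⟩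
    have hw0 : w ≠ 0 := norm_pos_iff.1 (by linarith)
    have hi' : IntervalIntegrable (g (j + 1)) volume a b := by
      rcases Nat.lt_or_eq_of_le hj with h | h
      · exact (by rw [uIcc_of_le hab]; exact hcont _ h :
          ContinuousOn (g (j + 1)) (uIcc a b)).intervalIntegrable
      · exact h ▸ hi
    have h1 := integral_exp_mul_by_parts hab s (hcont j hj) (hz j hj) (hd j hj) hi' w
    set I := ∫ y in a..b, Complex.exp (w * y) * g j y
    set I' := ∫ y in a..b, Complex.exp (w * y) * g (j + 1) y
    have h2 : w * ((-1 / w) ^ j * I) - w * ((-1 / w) ^ (j + 1) * I') =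
        -((-1 / w) ^ j * (Complex.exp (w * a) * g j a)) := by
      have : w * ((-1 / w) ^ (j + 1) * I') = -((-1 / w) ^ j * I') := by
        rw [pow_succ]; field_simp
      rw [this]
      linear_combination (-1 / w) ^ j * h1
    have h3 : ‖(-1 / w) ^ j * (Complex.exp (w * a) * g j a)‖ ≤ Real.exp (w.re * a) * |g j a| := by
      rw [norm_mul, norm_mul, norm_exp_mul_ofReal, Complex.norm_real, Real.norm_eq_abs, norm_pow,
        norm_div, norm_neg, norm_one]
      have : (1 / ‖w‖) ^ j ≤ 1 := pow_le_one₀ (by positivity)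
        (by rw [div_le_one (by linarith)]; exact hw)
      exact mul_le_of_le_one_left (by positivity) this
    calc _ = ‖(w * (∫ y in a..b, Complex.exp (w * y) * g 0 y) - w * ((-1 / w) ^ j * I)) +
          (w * ((-1 / w) ^ j * I) - w * ((-1 / w) ^ (j + 1) * I'))‖ := by congr 1; ring
      _ ≤ C * Real.exp (w.re * a) + Real.exp (w.re * a) * |g j a| := by
        refine norm_add_le_of_le (hC w hw) ?_
        rw [h2, norm_neg]; exact h3
      _ = _ := by ring

/-- The Laplace transform of a function that is piecewise smooth away from the origin is governed
by its first nonzero derivative at the right endpoint. -/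
lemma integral_exp_mul_asymptotic {g : ℕ → ℝ → ℝ} {n : ℕ} {s : Finset ℝ} {δ k c p l : ℝ}
    (hδ : 0 < δ) (hδk : δ < k) (hc : 0 ≤ c) (hp0 : 0 < p) (hm : ∀ j, Measurable (g j))
    (hcont : ∀ j < n, ContinuousOn (g j) (Icc δ k)) (hz : ∀ j < n, g j k = 0)
    (hd : ∀ j ≤ n, ∀ y ∈ Ioo δ k, y ∉ s → HasDerivAt (g j) (g (j + 1) y) y)
    (hr : Regulated (g n) δ k) (hr' : Regulated (g (n + 1)) δ k)
    (hl : Tendsto (g n) (𝓝[<] k) (𝓝 l)) (hp : 0 < p - δ / k * (p + n)) :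
    (fun w : ℂ => w * (∫ y in δ..k, Complex.exp (w * y) * g 0 y) -
      (-1) ^ n * l * (Complex.exp (k * w) / w ^ n)) =o[regionFilter c] gauge p k n := by
  have hk : 0 < k := hδ.trans hδk
  obtain ⟨C₁, hC₁0, hC₁⟩ := exists_repeated_by_parts_bound hδk.le hcont hz
    (fun j hj => hd j hj.le) (hr.intervalIntegrable hδk.le (hm n)) n le_rfl
  obtain ⟨M, hM0, hM⟩ := hr'.bounded
  rw [Asymptotics.isLittleO_iff]
  intro ε hε
  -- choose the last interval
  obtain ⟨a, ha1, ha2, has, haM⟩ : ∃ a, δ < a ∧ a < k ∧ (∀ y ∈ Ioo a k, y ∉ s) ∧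
      Real.exp (c * k) * M * (k - a) ≤ ε / 4 := by
    have h1 : ∀ᶠ a in 𝓝[<] k, δ < a :=
      mem_nhdsWithin_of_mem_nhds (Ioi_mem_nhds hδk)
    have h2 : ∀ᶠ a in 𝓝[<] k, ∀ y ∈ Ioo a k, y ∉ s := by
      have h3 : ((s.erase k : Finset ℝ) : Set ℝ)ᶜ ∈ 𝓝 k :=
        (s.erase k).finite_toSet.isClosed.isOpen_compl.mem_nhds (by simp)
      obtain ⟨l, u, hlu, hsub⟩ := mem_nhds_iff_exists_Ioo_subset.1 h3
      filter_upwards [mem_nhdsWithin_of_mem_nhds (Ioi_mem_nhds hlu.1)] with a ha y hy hys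
      exact hsub ⟨lt_trans ha hy.1, hy.2.trans hlu.2⟩
        (Finset.mem_coe.2 (Finset.mem_erase.2 ⟨hy.2.ne, hys⟩))
    have h3 : Tendsto (fun a => Real.exp (c * k) * M * (k - a)) (𝓝[<] k) (𝓝 0) := by
      have : Tendsto (fun a => Real.exp (c * k) * M * (k - a)) (𝓝 k)
          (𝓝 (Real.exp (c * k) * M * (k - k))) := Continuous.tendsto (by fun_prop) k
      rw [sub_self, mul_zero] at this
      exact this.mono_left nhdsWithin_le_nhds
    obtain ⟨a, h4⟩ := (((h1.and h2).and (h3.eventually_le_const (show 0 < ε / 4 by linarith))).and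
      self_mem_nhdsWithin).exists
    exact ⟨a, h4.1.1.1, h4.2, h4.1.1.2, h4.1.2⟩
  obtain ⟨la, hla⟩ := hr.1 a ⟨ha1.le, ha2⟩
  obtain ⟨C₂, hC₂⟩ := exists_norm_mul_integral_exp_le hc (hm n) (hm (n + 1)) s hδ.le ha1
    (hr.mono le_rfl ha2.le) (hr'.mono le_rfl ha2.le)
    (fun y hy => hd n le_rfl y ⟨hy.1, hy.2.trans ha2⟩)
  have hak : a / k < 1 := (div_lt_one hk).2 ha2
  have ho1 := ((exp_mul_rpow_isLittleO_gauge (k := k) n (by positivity : 0 ≤ δ / k)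
    ((div_le_one hk).2 hδk.le) hp).const_mul_left C₁).mono (regionFilter_le c)
  have ho2 := ((exp_mul_rpow_isLittleO_gauge (p := p) (k := k) (a := -n) n
    (div_nonneg (hδ.trans ha1).le hk.le) hak.le (by
      have : a / k * (p + n) < 1 * (p + n) := by gcongr
      linarith)).const_mul_left (|C₂| + |la|)).mono (regionFilter_le c)
  rw [Asymptotics.isLittleO_iff] at ho1 ho2
  filter_upwards [ho1 (show 0 < ε / 4 by linarith), ho2 (show 0 < ε / 4 by linarith),
    eventually_mem_region c, eventually_norm_ge c 1] with w h1 h2 hwr hw1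
  have hw0 : w ≠ 0 := norm_pos_iff.1 (by linarith)
  have hwp : 0 < ‖w‖ := by linarith
  have hG := gauge_nonneg p k n w
  rw [Real.norm_of_nonneg hG] at h1 h2 ⊢
  rw [show δ / k * k * w.re = w.re * δ by field_simp, Real.rpow_zero, mul_one,
    Real.norm_of_nonneg (by positivity)] at h1
  rw [show a / k * k * w.re = w.re * a by field_simp, Real.rpow_neg hwp.le, Real.rpow_natCast,
    Real.norm_of_nonneg (by positivity)] at h2
  have h3 := hC₁ w hw1
  have hi1 := intervalIntegrable_exp_mul ((hr.mono le_rfl ha2.le).intervalIntegrable ha1.le (hm n)) w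
  have hi2 := intervalIntegrable_exp_mul ((hr.mono ha1.le le_rfl).intervalIntegrable ha2.le (hm n)) w
  have h4 := hC₂ w hwr.1
  have h5 := mul_integral_exp_mul ha2 (fun y hy => hd n le_rfl y ⟨ha1.trans hy.1, hy.2⟩ (has y hy))
    ((hr.mono ha1.le le_rfl).intervalIntegrable ha2.le (hm n))
    ((hr'.mono ha1.le le_rfl).intervalIntegrable ha2.le (hm (n + 1))) hla hl w
  have h6 := norm_integral_exp_mul_le (g := g (n + 1)) hc (hδ.trans ha1).le ha2.le
    (fun y hy => hM y ⟨ha1.le.trans hy.1, hy.2⟩) hwr.1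
  rw [← intervalIntegral.integral_add_adjacent_intervals hi1 hi2] at h3
  set I1 := ∫ y in δ..a, Complex.exp (w * y) * g n y
  set I2 := ∫ y in a..k, Complex.exp (w * y) * g n y
  set I3 := ∫ y in a..k, Complex.exp (w * y) * g (n + 1) y
  set I0 := ∫ y in δ..k, Complex.exp (w * y) * g 0 y
  have h7 : w * I0 - (-1) ^ n * l * (Complex.exp (k * w) / w ^ n) =
      (w * I0 - w * ((-1 / w) ^ n * (I1 + I2))) +
        (-1 / w) ^ n * (w * I1 - Complex.exp (w * a) * la - I3) := by
    have h8 : (-1 / w) ^ n = (-1) ^ n / w ^ n := by rw [div_pow]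
    have h9 : (-1 : ℂ) ^ n * l * (Complex.exp (k * w) / w ^ n) =
        (-1 / w) ^ n * (Complex.exp (w * k) * l) := by
      rw [h8, mul_comm (k : ℂ) w]; ring
    rw [h9]
    linear_combination (-1 / w) ^ n * h5
  have h8 : ‖(-1 / w) ^ n‖ = (‖w‖ ^ n)⁻¹ := by
    rw [norm_pow, norm_div, norm_neg, norm_one, one_div, inv_pow]
  have h9 : ‖w * I1 - Complex.exp (w * a) * la - I3‖ ≤
      (|C₂| + |la|) * Real.exp (w.re * a) + ε / 4 * Real.exp (w.re * k) := by
    have h10 : ‖Complex.exp (w * a) * la‖ = Real.exp (w.re * a) * |la| := by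
      rw [norm_mul, norm_exp_mul_ofReal, Complex.norm_real, Real.norm_eq_abs]
    have h11 : C₂ * Real.exp (w.re * a) ≤ |C₂| * Real.exp (w.re * a) := by
      gcongr; exact le_abs_self _
    have h12 : Real.exp (c * k) * Real.exp (w.re * k) * M * (k - a) ≤
        ε / 4 * Real.exp (w.re * k) := by
      calc _ = Real.exp (c * k) * M * (k - a) * Real.exp (w.re * k) := by ring
        _ ≤ _ := by gcongr
    refine (norm_sub_le_of_le (norm_sub_le _ _) h6).trans ?_
    linarith
  have h10 : Real.exp (w.re * k) * (‖w‖ ^ n)⁻¹ ≤ gauge p k n w := by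
    rw [gauge, mul_comm w.re k, ← div_eq_mul_inv]
    have : 0 ≤ ‖w‖ ^ p := by positivity
    linarith
  rw [h7]
  calc _ ≤ C₁ * Real.exp (w.re * δ) + (‖w‖ ^ n)⁻¹ *
        ((|C₂| + |la|) * Real.exp (w.re * a) + ε / 4 * Real.exp (w.re * k)) := by
        refine norm_add_le_of_le h3 ?_
        rw [norm_mul, h8]
        gcongr
    _ = C₁ * Real.exp (w.re * δ) + (|C₂| + |la|) * (Real.exp (w.re * a) * (‖w‖ ^ n)⁻¹) +
        ε / 4 * (Real.exp (w.re * k) * (‖w‖ ^ n)⁻¹) := by ring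
    _ ≤ ε / 4 * gauge p k n w + ε / 4 * gauge p k n w + ε / 4 * gauge p k n w := by gcongr
    _ ≤ ε * gauge p k n w := by nlinarith

lemma integral_rpow_neg_le {a η δ : ℝ} (ha : 0 < a) (hη : 0 < η) (hηδ : η ≤ δ) :
    ∫ y in η..δ, y ^ (-a - 1) ≤ η ^ (-a) / a := by
  rw [integral_rpow (Or.inr ⟨by linarith, by
    rw [uIcc_of_le hηδ]; exact fun h => absurd h.1 (not_le.2 hη)⟩)]
  have h1 : 0 < δ ^ (-a) := Real.rpow_pos_of_pos (hη.trans_le hηδ) _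
  rw [show -a - 1 + 1 = -a by ring, div_neg, ← neg_div, div_le_div_iff_of_pos_right ha]
  linarith

lemma intervalIntegrable_rpow_of_pos {η δ : ℝ} (hη : 0 < η) (hηδ : η ≤ δ) (a : ℝ) :
    IntervalIntegrable (fun y : ℝ => y ^ a) volume η δ :=
  intervalIntegral.intervalIntegrable_rpow (Or.inr (by
    rw [uIcc_of_le hηδ]; exact fun h => absurd h.1 (not_le.2 hη)))

/-- A function on `(0, δ]` with a singularity at `0` of the order of `y ^ (-a)`, with a derivative
of the order of `y ^ (-a - 1)`. -/
structure SingularBound (g g' : ℝ → ℝ) (δ a C : ℝ) : Prop where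
  hasDerivAt : ∀ y ∈ Ioc 0 δ, HasDerivAt g (g' y) y
  measurable : Measurable g
  measurable' : Measurable g'
  bound : ∀ y ∈ Ioc 0 δ, |g y| ≤ C * y ^ (-a)
  bound' : ∀ y ∈ Ioc 0 δ, |g' y| ≤ C * y ^ (-a - 1)

namespace SingularBound

variable {g g' : ℝ → ℝ} {δ a C : ℝ}

lemma const_nonneg (h : SingularBound g g' δ a C) (hδ : 0 < δ) : 0 ≤ C := by
  have h1 := (abs_nonneg _).trans (h.bound δ ⟨hδ, le_rfl⟩)
  have h2 : 0 < δ ^ (-a) := Real.rpow_pos_of_pos hδ _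
  by_contra! h3
  nlinarith

lemma intervalIntegrable (h : SingularBound g g' δ a C) {η : ℝ} (hη : 0 < η) (hηδ : η ≤ δ) :
    IntervalIntegrable g volume η δ := by
  refine ContinuousOn.intervalIntegrable fun y hy => ?_
  rw [uIcc_of_le hηδ] at hy
  exact (h.hasDerivAt y ⟨hη.trans_le hy.1, hy.2⟩).continuousAt.continuousWithinAt

lemma norm_mul_integral_le (h : SingularBound g g' δ a C) (ha : 0 < a) (hδ : 0 < δ) {w : ℂ}
    (hw : 1 / δ < ‖w‖) :
    ‖w * ∫ y in (1 / ‖w‖)..δ, Complex.exp (w * y) * g y‖ ≤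
      C * (2 + 1 / a) * (‖w‖ ^ a * (1 + Real.exp (w.re * δ))) := by
  have hw0 : 0 < ‖w‖ := lt_trans (by positivity) hw
  set η := 1 / ‖w‖ with hηdef
  have hη : 0 < η := by positivity
  have hηδ : η < δ := by rw [hηdef, div_lt_comm₀ hw0 hδ]; exact hw
  have hC := h.const_nonneg hδ
  have hηa : η ^ (-a) = ‖w‖ ^ a := by
    rw [hηdef, one_div, Real.inv_rpow hw0.le, Real.rpow_neg hw0.le, inv_inv]
  have hexp : ∀ y, 0 ≤ y → y ≤ δ → Real.exp (w.re * y) ≤ 1 + Real.exp (w.re * δ) := by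
    intro y hy hyδ
    rcases le_total 0 w.re with h0 | h0
    · have := Real.exp_le_exp.2 (mul_le_mul_of_nonneg_left hyδ h0)
      linarith
    · have := Real.exp_le_one_iff.2 (mul_nonpos_of_nonpos_of_nonneg h0 hy)
      linarith [Real.exp_pos (w.re * δ)]
  have hi' : IntervalIntegrable g' volume η δ := by
    refine ((intervalIntegrable_rpow_of_pos hη hηδ.le (-a - 1)).const_mul C).mono_fun'
      h.measurable'.aestronglyMeasurable ?_
    rw [uIoc_of_le hηδ.le]
    filter_upwards [ae_restrict_mem measurableSet_Ioc] with y hy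
    exact h.bound' y ⟨hη.trans hy.1, hy.2⟩
  rw [mul_integral_exp_mul hηδ (fun y hy => h.hasDerivAt y ⟨hη.trans hy.1, hy.2.le⟩)
    (h.intervalIntegrable hη hηδ.le) hi'
    ((h.hasDerivAt η ⟨hη, hηδ.le⟩).continuousAt.tendsto.mono_left nhdsWithin_le_nhds)
    ((h.hasDerivAt δ ⟨hδ, le_rfl⟩).continuousAt.tendsto.mono_left nhdsWithin_le_nhds) w]
  set E := 1 + Real.exp (w.re * δ)
  have hE : 0 ≤ E := by positivity
  have h1 : ‖Complex.exp (w * δ) * g δ‖ ≤ E * (C * ‖w‖ ^ a) := by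
    rw [norm_mul, norm_exp_mul_ofReal, Complex.norm_real, ← hηa]
    gcongr
    · exact hexp δ hδ.le le_rfl
    · refine (h.bound δ ⟨hδ, le_rfl⟩).trans ?_
      gcongr C * ?_
      exact Real.rpow_le_rpow_of_nonpos hη hηδ.le (by linarith)
  have h2 : ‖Complex.exp (w * η) * g η‖ ≤ E * (C * ‖w‖ ^ a) := by
    rw [norm_mul, norm_exp_mul_ofReal, Complex.norm_real, ← hηa]
    gcongr
    · exact hexp η hη.le hηδ.le
    · exact h.bound η ⟨hη, hηδ.le⟩
  have h3 : ‖∫ y in η..δ, Complex.exp (w * y) * g' y‖ ≤ E * (C * (‖w‖ ^ a / a)) := by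
    have h4 := intervalIntegral.norm_integral_le_of_norm_le (a := η) (b := δ)
      (f := fun y : ℝ => Complex.exp (w * y) * g' y) (g := fun y => E * (C * y ^ (-a - 1))) hηδ.le
      (ae_of_all _ fun y hy => by
        rw [norm_mul, norm_exp_mul_ofReal, Complex.norm_real]
        gcongr
        · exact hexp y (hη.trans hy.1).le hy.2
        · exact h.bound' y ⟨hη.trans hy.1, hy.2⟩)
      (((intervalIntegrable_rpow_of_pos hη hηδ.le (-a - 1)).const_mul C).const_mul E)
    rw [intervalIntegral.integral_const_mul, intervalIntegral.integral_const_mul] at h4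
    refine h4.trans ?_
    rw [← hηa]
    gcongr
    exact integral_rpow_neg_le ha hη hηδ.le
  calc _ ≤ E * (C * ‖w‖ ^ a) + E * (C * ‖w‖ ^ a) + E * (C * (‖w‖ ^ a / a)) :=
        norm_sub_le_of_le (norm_sub_le_of_le h1 h2) h3
    _ = _ := by ring

lemma norm_exp_le (w : ℂ) {y : ℝ} (hy : 0 ≤ y) (hyw : y ≤ 1 / ‖w‖) (hw : 0 < ‖w‖) :
    ‖Complex.exp (w * y)‖ ≤ Real.exp 1 := by
  refine (norm_exp_mul_ofReal_le w hy hyw).trans (Real.exp_le_exp.2 ?_)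
  rw [mul_one_div_cancel hw.ne']

lemma norm_exp_sub_one_le (w : ℂ) {y : ℝ} (hy : 0 ≤ y) (hyw : y ≤ 1 / ‖w‖) (hw : 0 < ‖w‖) :
    ‖Complex.exp (w * y) - 1‖ ≤ ‖w‖ * Real.exp 1 * y := by
  have := norm_exp_mul_ofReal_sub_one_le w hy hyw
  rwa [mul_one_div_cancel hw.ne'] at this

lemma intervalIntegrable_exp (h : SingularBound g g' δ a C) (hδ : 0 < δ) (ha1 : a < 1) (w : ℂ) :
    IntervalIntegrable (fun y : ℝ => Complex.exp (w * y) * g y) volume 0 δ := by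
  have hgm := h.measurable
  have hC := h.const_nonneg hδ
  refine ((intervalIntegral.intervalIntegrable_rpow' (by linarith : -1 < -a)).const_mul
    (Real.exp (‖w‖ * δ) * C)).mono_fun' (Measurable.aestronglyMeasurable (by fun_prop)) ?_
  rw [uIoc_of_le hδ.le]
  filter_upwards [ae_restrict_mem measurableSet_Ioc] with y hy
  rw [norm_mul, Complex.norm_real, mul_assoc]
  gcongr
  · exact norm_exp_mul_ofReal_le w hy.1.le hy.2
  · exact h.bound y hy

lemma intervalIntegrable_exp_sub_one (h : SingularBound g g' δ a C) (hδ : 0 < δ) (ha2 : a < 2)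
    (w : ℂ) : IntervalIntegrable (fun y : ℝ => (Complex.exp (w * y) - 1) * g y) volume 0 δ := by
  have hgm := h.measurable
  have hC := h.const_nonneg hδ
  refine ((intervalIntegral.intervalIntegrable_rpow' (by linarith : -1 < 1 - a)).const_mul
    (‖w‖ * Real.exp (‖w‖ * δ) * C)).mono_fun' (Measurable.aestronglyMeasurable (by fun_prop)) ?_
  rw [uIoc_of_le hδ.le]
  filter_upwards [ae_restrict_mem measurableSet_Ioc] with y hy
  rw [norm_mul, Complex.norm_real, sub_eq_add_neg 1 a, Real.rpow_add hy.1, Real.rpow_one]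
  calc _ ≤ (‖w‖ * Real.exp (‖w‖ * δ) * y) * (C * y ^ (-a)) := by
        have := hy.1.le
        gcongr
        · exact norm_exp_mul_ofReal_sub_one_le w hy.1.le hy.2
        · exact h.bound y hy
    _ = _ := by ring

lemma exists_norm_integral_exp_le (h : SingularBound g g' δ a C) (ha : 0 < a) (ha1 : a < 1)
    (hδ : 0 < δ) : ∃ C', 0 ≤ C' ∧ ∀ w : ℂ, 1 / δ < ‖w‖ →
      ‖w * ∫ y in 0..δ, Complex.exp (w * y) * g y‖ ≤
        C' * (‖w‖ ^ a * (1 + Real.exp (w.re * δ))) := by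
  have hC := h.const_nonneg hδ
  have h1a : 0 < 1 - a := by linarith
  refine ⟨Real.exp 1 * C / (1 - a) + C * (2 + 1 / a), by positivity, fun w hw => ?_⟩
  have hw0 : 0 < ‖w‖ := lt_trans (by positivity) hw
  have hη : 0 < 1 / ‖w‖ := by positivity
  have hηδ : 1 / ‖w‖ < δ := by rw [div_lt_comm₀ hw0 hδ]; exact hw
  have hi := h.intervalIntegrable_exp hδ ha1 w
  rw [← intervalIntegral.integral_add_adjacent_intervals (b := 1 / ‖w‖)
    (hi.mono_set (by rw [uIcc_of_le hη.le, uIcc_of_le hδ.le]; exact Icc_subset_Icc_right hηδ.le))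
    (hi.mono_set (by rw [uIcc_of_le hηδ.le, uIcc_of_le hδ.le]; exact Icc_subset_Icc_left hη.le)),
    mul_add, add_mul]
  refine norm_add_le_of_le ?_ (h.norm_mul_integral_le ha hδ hw)
  have h4 := intervalIntegral.norm_integral_le_of_norm_le (a := 0) (b := 1 / ‖w‖)
    (f := fun y : ℝ => Complex.exp (w * y) * g y) (g := fun y => Real.exp 1 * C * y ^ (-a)) hη.le
    (ae_of_all _ fun y hy => by
      rw [norm_mul, Complex.norm_real, mul_assoc]
      gcongr
      · exact norm_exp_le w hy.1.le hy.2 hw0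
      · exact h.bound y ⟨hy.1, hy.2.trans hηδ.le⟩)
    ((intervalIntegral.intervalIntegrable_rpow' (by linarith : -1 < -a)).const_mul _)
  rw [intervalIntegral.integral_const_mul, integral_rpow (Or.inl (by linarith)),
    Real.zero_rpow (by linarith), sub_zero, show -a + 1 = 1 - a by ring, one_div,
    Real.inv_rpow hw0.le, ← Real.rpow_neg hw0.le] at h4
  rw [norm_mul, one_div]
  calc _ ≤ ‖w‖ * (Real.exp 1 * C * (‖w‖ ^ (-(1 - a)) / (1 - a))) := by gcongr
    _ = Real.exp 1 * C / (1 - a) * ‖w‖ ^ a := by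
        rw [show a = -(1 - a) + 1 by ring, Real.rpow_add hw0, Real.rpow_one]; ring_nf
    _ ≤ _ := by
        gcongr
        exact le_mul_of_one_le_right (by positivity) (by linarith [Real.exp_pos (w.re * δ)])

lemma exists_norm_integral_exp_sub_one_le (h : SingularBound g g' δ a C) (ha : 1 < a)
    (ha2 : a < 2) (hδ : 0 < δ) : ∃ C', 0 ≤ C' ∧ ∀ w : ℂ, 1 / δ < ‖w‖ →
      ‖w * ∫ y in 0..δ, (Complex.exp (w * y) - 1) * g y‖ ≤
        C' * (‖w‖ ^ a * (1 + Real.exp (w.re * δ))) := by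
  have hC := h.const_nonneg hδ
  have h2a : 0 < 2 - a := by linarith
  have h1a : 0 < a - 1 := by linarith
  refine ⟨Real.exp 1 * C / (2 - a) + (C * (2 + 1 / a) + C / (a - 1)), by positivity, fun w hw => ?_⟩
  have hw0 : 0 < ‖w‖ := lt_trans (by positivity) hw
  have hη : 0 < 1 / ‖w‖ := by positivity
  have hηδ : 1 / ‖w‖ < δ := by rw [div_lt_comm₀ hw0 hδ]; exact hw
  have hi := h.intervalIntegrable_exp_sub_one hδ ha2 w
  have hE : 1 ≤ 1 + Real.exp (w.re * δ) := by linarith [Real.exp_pos (w.re * δ)]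
  rw [← intervalIntegral.integral_add_adjacent_intervals (b := 1 / ‖w‖)
    (hi.mono_set (by rw [uIcc_of_le hη.le, uIcc_of_le hδ.le]; exact Icc_subset_Icc_right hηδ.le))
    (hi.mono_set (by rw [uIcc_of_le hηδ.le, uIcc_of_le hδ.le]; exact Icc_subset_Icc_left hη.le)),
    mul_add, add_mul]
  refine norm_add_le_of_le ?_ ?_
  · have h4 := intervalIntegral.norm_integral_le_of_norm_le (a := 0) (b := 1 / ‖w‖)
      (f := fun y : ℝ => (Complex.exp (w * y) - 1) * g y)
      (g := fun y => ‖w‖ * Real.exp 1 * C * y ^ (1 - a)) hη.le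
      (ae_of_all _ fun y hy => by
        rw [norm_mul, Complex.norm_real, sub_eq_add_neg 1 a, Real.rpow_add hy.1, Real.rpow_one]
        calc _ ≤ (‖w‖ * Real.exp 1 * y) * (C * y ^ (-a)) := by
              have := hy.1.le
              gcongr
              · exact norm_exp_sub_one_le w hy.1.le hy.2 hw0
              · exact h.bound y ⟨hy.1, hy.2.trans hηδ.le⟩
          _ = _ := by ring)
      ((intervalIntegral.intervalIntegrable_rpow' (by linarith : -1 < 1 - a)).const_mul _)
    rw [intervalIntegral.integral_const_mul, integral_rpow (Or.inl (by linarith)),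
      Real.zero_rpow (by linarith), sub_zero, show 1 - a + 1 = 2 - a by ring, one_div,
      Real.inv_rpow hw0.le, ← Real.rpow_neg hw0.le] at h4
    rw [norm_mul, one_div]
    calc _ ≤ ‖w‖ * (‖w‖ * Real.exp 1 * C * (‖w‖ ^ (-(2 - a)) / (2 - a))) := by gcongr
      _ = Real.exp 1 * C / (2 - a) * ‖w‖ ^ a := by
          rw [show a = -(2 - a) + 1 + 1 by ring, Real.rpow_add hw0, Real.rpow_add hw0,
            Real.rpow_one]
          ring_nf
      _ ≤ _ := by
          gcongr
          exact le_mul_of_one_le_right (by positivity) hE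
  · have hg := h.intervalIntegrable hη hηδ.le
    have h5 : ∫ y in (1 / ‖w‖)..δ, (Complex.exp (w * y) - 1) * g y =
        (∫ y in (1 / ‖w‖)..δ, Complex.exp (w * y) * g y) - ∫ y in (1 / ‖w‖)..δ, (g y : ℂ) := by
      have hg' : IntervalIntegrable (fun y => (g y : ℂ)) volume (1 / ‖w‖) δ :=
        ⟨hg.1.ofReal, hg.2.ofReal⟩
      rw [← intervalIntegral.integral_sub (intervalIntegrable_exp_mul hg w) hg']
      simp_rw [sub_mul, one_mul]
    rw [h5, mul_sub, add_mul]
    refine norm_sub_le_of_le (h.norm_mul_integral_le (by linarith) hδ hw) ?_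
    have h6 := intervalIntegral.norm_integral_le_of_norm_le (a := 1 / ‖w‖) (b := δ)
      (f := fun y : ℝ => (g y : ℂ)) (g := fun y => C * y ^ (-a)) hηδ.le
      (ae_of_all _ fun y hy => by
        rw [Complex.norm_real]
        exact h.bound y ⟨hη.trans hy.1, hy.2⟩)
      ((intervalIntegrable_rpow_of_pos hη hηδ.le (-a)).const_mul C)
    have h7 := integral_rpow_neg_le h1a hη hηδ.le
    rw [show -(a - 1) - 1 = -a by ring] at h7
    rw [intervalIntegral.integral_const_mul] at h6
    rw [norm_mul]
    calc _ ≤ ‖w‖ * (C * ((1 / ‖w‖) ^ (-(a - 1)) / (a - 1))) := by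
          gcongr
          exact h6.trans (by gcongr)
      _ = C / (a - 1) * ‖w‖ ^ a := by
          rw [one_div, Real.inv_rpow hw0.le, Real.rpow_neg hw0.le, inv_inv]
          have h8 : ‖w‖ ^ a = ‖w‖ ^ (a - 1) * ‖w‖ := by
            rw [← Real.rpow_add_one hw0.ne']; ring_nf
          rw [h8]
          ring
      _ ≤ _ := by
          gcongr
          exact le_mul_of_one_le_right (by positivity) hE

end SingularBound

lemma isLittleO_gauge_of_bound {k δ p a c C R : ℝ} (n : ℕ) (hk : 0 < k) (hδ : 0 < δ) (hδk : δ ≤ k)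
    (ha : a < p - δ / k * (p + n)) (hap : a < p) {F : ℂ → ℂ}
    (hF : ∀ w ∈ region c, R < ‖w‖ → ‖F w‖ ≤ C * (‖w‖ ^ a * (1 + Real.exp (w.re * δ)))) :
    F =o[regionFilter c] gauge p k n := by
  have h1 := exp_mul_rpow_isLittleO_gauge (k := k) (p := p) (a := a) n le_rfl zero_le_one
    (by simpa using hap)
  have h2 := exp_mul_rpow_isLittleO_gauge (k := k) n (by positivity : 0 ≤ δ / k)
    ((div_le_one hk).2 hδk) ha
  refine (Asymptotics.IsBigO.of_bound 1 ?_).trans_isLittleO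
    (((h1.add h2).const_mul_left C).mono (regionFilter_le c))
  filter_upwards [eventually_norm_ge c (R + 1), eventually_mem_region c] with w hw hwr
  refine (hF w hwr (by linarith)).trans ?_
  rw [one_mul]
  refine le_trans (le_of_eq ?_) (Real.le_norm_self _)
  rw [show δ / k * k * w.re = w.re * δ by field_simp]
  simp only [zero_mul, Real.exp_zero, one_mul]
  ring

lemma singularBound_rpow {a b δ : ℝ} (hba : b ≤ a) :
    SingularBound (fun y => y ^ (-b)) (fun y => -b * y ^ (-b - 1)) δ a
      ((1 + |b|) * δ ^ (a - b)) := by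
  have key : ∀ r : ℝ, ∀ y ∈ Ioc 0 δ, y ^ (r - b) ≤ δ ^ (a - b) * y ^ (r - a) := by
    intro r y hy
    rw [show r - b = (a - b) + (r - a) by ring, Real.rpow_add hy.1]
    have := hy.1.le
    gcongr
    exact hy.2
  refine ⟨fun y hy => ?_, by fun_prop, by fun_prop, fun y hy => ?_, fun y hy => ?_⟩
  · exact Real.hasDerivAt_rpow_const (Or.inl hy.1.ne')
  · have h1 := key 0 y hy
    have h2 : 0 < y ^ (-b) := Real.rpow_pos_of_pos hy.1 _
    rw [zero_sub, zero_sub] at h1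
    rw [abs_of_pos h2]
    have h3 : 0 ≤ |b| * y ^ (-b) := by positivity
    have h4 : |b| * y ^ (-b) ≤ |b| * (δ ^ (a - b) * y ^ (-a)) := by gcongr
    nlinarith
  · have h1 := key (-1) y hy
    have h2 : 0 < y ^ (-b - 1) := Real.rpow_pos_of_pos hy.1 _
    rw [show -1 - b = -b - 1 by ring, show -1 - a = -a - 1 by ring] at h1
    rw [abs_mul, abs_neg, abs_of_pos h2]
    have h4 : |b| * y ^ (-b - 1) ≤ |b| * (δ ^ (a - b) * y ^ (-a - 1)) := by gcongr
    nlinarith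

/-- The integral of `(e ^ {w y} - 1) y ^ (-α)` over `[0, δ]`. -/
noncomputable def powerIntegral (δ α : ℝ) (w : ℂ) : ℂ :=
  ∫ y in 0..δ, (Complex.exp (w * y) - 1) * (y ^ (-α) : ℝ)

section PowerIntegral

variable {δ α : ℝ}

lemma intervalIntegrable_powerIntegral (hδ : 0 < δ) (hα : α < 2) (w : ℂ) :
    IntervalIntegrable (fun y : ℝ => (Complex.exp (w * y) - 1) * (y ^ (-α) : ℝ)) volume 0 δ :=
  (singularBound_rpow le_rfl).intervalIntegrable_exp_sub_one hδ hα w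

lemma hasDerivAt_powerIntegral (hδ : 0 < δ) (hα : α < 2) (w : ℂ) :
    IntervalIntegrable (fun y : ℝ => y * Complex.exp (w * y) * (y ^ (-α) : ℝ)) volume 0 δ ∧
    HasDerivAt (powerIntegral δ α)
      (∫ y in 0..δ, y * Complex.exp (w * y) * (y ^ (-α) : ℝ)) w := by
  refine intervalIntegral.hasDerivAt_integral_of_dominated_loc_of_deriv_le
    (F := fun (w : ℂ) (y : ℝ) => (Complex.exp (w * y) - 1) * (y ^ (-α) : ℝ))
    (F' := fun w y => y * Complex.exp (w * y) * (y ^ (-α) : ℝ))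
    (bound := fun y => Real.exp ((‖w‖ + 1) * δ) * y ^ (1 - α)) (s := Metric.ball w 1)
    (Metric.ball_mem_nhds w one_pos) ?_ (intervalIntegrable_powerIntegral hδ hα w) ?_ ?_ ?_ ?_
  · exact Eventually.of_forall fun w => Measurable.aestronglyMeasurable (by fun_prop)
  · exact Measurable.aestronglyMeasurable (by fun_prop)
  · refine ae_of_all _ fun y hy z hz => ?_
    rw [uIoc_of_le hδ.le] at hy
    have h1 : ‖z‖ ≤ ‖w‖ + 1 := by
      have : ‖z - w‖ < 1 := by simpa [dist_eq_norm] using hz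
      linarith [norm_sub_norm_le z w]
    rw [norm_mul, norm_mul, Complex.norm_real, Complex.norm_real,
      Real.norm_of_nonneg (Real.rpow_nonneg hy.1.le _), Real.norm_of_nonneg hy.1.le,
      sub_eq_add_neg 1 α, Real.rpow_add hy.1, Real.rpow_one, mul_comm y, mul_assoc]
    have := hy.1.le
    gcongr
    refine (norm_exp_mul_ofReal_le z hy.1.le hy.2).trans (Real.exp_le_exp.2 ?_)
    gcongr
  · exact (intervalIntegral.intervalIntegrable_rpow' (by linarith)).const_mul _
  · refine ae_of_all _ fun t _ z _ => ?_
    have h1 : HasDerivAt (fun z : ℂ => z * (t : ℂ)) t z := by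
      simpa using (hasDerivAt_id z).mul_const (t : ℂ)
    exact ((h1.cexp.sub_const 1).mul_const ((t ^ (-α) : ℝ) : ℂ)).congr_deriv (by ring)

lemma powerIntegral_ode (hδ : 0 < δ) (hα : α < 2) (w : ℂ) :
    w * (∫ y in 0..δ, y * Complex.exp (w * y) * (y ^ (-α) : ℝ)) +
      (1 - α) * powerIntegral δ α w = (Complex.exp (w * δ) - 1) * (δ ^ (1 - α) : ℝ) := by
  have hi1 := (hasDerivAt_powerIntegral hδ hα w).1
  have hi2 := intervalIntegrable_powerIntegral hδ hα w
  have hd : ∀ y : ℝ, 0 < y → HasDerivAt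
      (fun y : ℝ => (Complex.exp (w * y) - 1) * (y ^ (1 - α) : ℝ))
      (w * (y * Complex.exp (w * y) * (y ^ (-α) : ℝ)) +
        (1 - α) * ((Complex.exp (w * y) - 1) * (y ^ (-α) : ℝ))) y := by
    intro y hy
    have h1 := (Real.hasDerivAt_rpow_const (p := 1 - α) (Or.inl hy.ne')).ofReal_comp
    refine (((hasDerivAt_exp_mul_ofReal w y).sub_const 1).mul h1).congr_deriv ?_
    rw [show 1 - α - 1 = -α by ring, show y ^ (1 - α) = y * y ^ (-α) by
      rw [sub_eq_add_neg, Real.rpow_add hy, Real.rpow_one]]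
    push_cast
    ring
  have h0 : Tendsto (fun y : ℝ => (Complex.exp (w * y) - 1) * (y ^ (1 - α) : ℝ)) (𝓝[>] 0)
      (𝓝 0) := by
    have h2 : Tendsto (fun y : ℝ => ‖w‖ * Real.exp (‖w‖ * δ) * y ^ (2 - α)) (𝓝[>] 0) (𝓝 0) := by
      have : Tendsto (fun y : ℝ => ‖w‖ * Real.exp (‖w‖ * δ) * y ^ (2 - α)) (𝓝 0)
          (𝓝 (‖w‖ * Real.exp (‖w‖ * δ) * 0 ^ (2 - α))) :=
        ((Real.continuousAt_rpow_const 0 (2 - α) (Or.inr (by linarith))).tendsto).const_mul _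
      rw [Real.zero_rpow (by linarith), mul_zero] at this
      exact this.mono_left nhdsWithin_le_nhds
    refine squeeze_zero_norm' ?_ h2
    filter_upwards [Ioc_mem_nhdsGT hδ] with y hy
    rw [norm_mul, Complex.norm_real, Real.norm_of_nonneg (Real.rpow_nonneg hy.1.le _),
      show 2 - α = 1 + (1 - α) by ring, Real.rpow_add hy.1, Real.rpow_one, ← mul_assoc]
    gcongr
    · exact Real.rpow_nonneg hy.1.le _
    · exact norm_exp_mul_ofReal_sub_one_le w hy.1.le hy.2
  have h := intervalIntegral.integral_eq_sub_of_hasDerivAt_of_tendsto hδ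
    (fun y hy => hd y hy.1) ((hi1.const_mul w).add (hi2.const_mul (1 - α : ℂ))) h0
    ((hd δ hδ).continuousAt.tendsto.mono_left nhdsWithin_le_nhds)
  rw [intervalIntegral.integral_add (hi1.const_mul w) (hi2.const_mul (1 - α : ℂ)),
    intervalIntegral.integral_const_mul, intervalIntegral.integral_const_mul, sub_zero] at h
  exact h

/-- `w ^ (1 - α)` times the integral of `(e ^ {w y} - 1) y ^ (-α)`. -/
noncomputable def scaledPower (δ α : ℝ) (w : ℂ) : ℂ :=
  w ^ ((1 - α : ℝ) : ℂ) * powerIntegral δ α w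

lemma hasDerivAt_scaledPower (hδ : 0 < δ) (hα : α < 2) {w : ℂ} (hw : w ∈ Complex.slitPlane) :
    HasDerivAt (scaledPower δ α)
      (w ^ ((-α : ℝ) : ℂ) * ((Complex.exp (w * δ) - 1) * (δ ^ (1 - α) : ℝ))) w := by
  have hw0 : w ≠ 0 := Complex.slitPlane_ne_zero hw
  have h1 : HasDerivAt (fun w : ℂ => w ^ ((1 - α : ℝ) : ℂ))
      (((1 - α : ℝ) : ℂ) * w ^ (((1 - α : ℝ) : ℂ) - 1) * 1) w :=
    (hasDerivAt_id w).cpow_const hw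
  refine (h1.mul (hasDerivAt_powerIntegral hδ hα w).2).congr_deriv ?_
  rw [← powerIntegral_ode hδ hα w]
  have h2 : w ^ ((1 - α : ℝ) : ℂ) = w ^ ((-α : ℝ) : ℂ) * w := by
    rw [show ((1 - α : ℝ) : ℂ) = ((-α : ℝ) : ℂ) + 1 by push_cast; ring, Complex.cpow_add _ _ hw0,
      Complex.cpow_one]
  have h3 : ((1 - α : ℝ) : ℂ) - 1 = ((-α : ℝ) : ℂ) := by push_cast; ring
  rw [h2, h3]
  push_cast
  ring

lemma norm_deriv_scaledPower_le (hδ : 0 < δ) (w : ℂ) :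
    ‖w ^ ((-α : ℝ) : ℂ) * ((Complex.exp (w * δ) - 1) * (δ ^ (1 - α) : ℝ))‖ ≤
      δ ^ (1 - α) * (1 + Real.exp (w.re * δ)) * ‖w‖ ^ (-α) := by
  rw [norm_mul, norm_mul, Complex.norm_cpow_real, Complex.norm_real,
    Real.norm_of_nonneg (Real.rpow_nonneg hδ.le _)]
  have h1 : ‖Complex.exp (w * δ) - 1‖ ≤ 1 + Real.exp (w.re * δ) := by
    refine (norm_sub_le _ _).trans ?_
    rw [norm_exp_mul_ofReal, norm_one, add_comm]
  have := Real.rpow_nonneg hδ.le (1 - α)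
  calc _ ≤ ‖w‖ ^ (-α) * ((1 + Real.exp (w.re * δ)) * δ ^ (1 - α)) := by gcongr
    _ = _ := by ring

lemma norm_add_mul_I_ge {w : ℂ} (hw : 0 ≤ w.im) {t : ℝ} (ht : 0 ≤ t) :
    (‖w‖ + t) / 2 ≤ ‖w + t * Complex.I‖ := by
  have h1 : ‖w‖ ≤ ‖w + t * Complex.I‖ := by
    rw [Complex.norm_def, Complex.norm_def]
    apply Real.sqrt_le_sqrt
    simp only [Complex.normSq_apply, Complex.add_re, Complex.mul_re, Complex.ofReal_re,
      Complex.I_re, Complex.ofReal_im, Complex.I_im, Complex.add_im, Complex.mul_im]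
    nlinarith
  have h2 : t ≤ ‖w + t * Complex.I‖ := by
    refine le_trans ?_ (Complex.im_le_norm _)
    simp [hw]
  linarith

lemma mem_slitPlane_add_mul_I {w : ℂ} (hw : w ∈ Complex.slitPlane) (him : 0 ≤ w.im) {t : ℝ}
    (ht : 0 ≤ t) : w + t * Complex.I ∈ Complex.slitPlane := by
  rcases hw with h | h
  · left; simpa using h
  · right
    have : 0 < w.im := lt_of_le_of_ne him (Ne.symm h)
    simp; linarith

lemma norm_scaledPower_sub_le (hδ : 0 < δ) (hα1 : 1 < α) (hα : α < 2) {w : ℂ}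
    (hw : w ∈ Complex.slitPlane) (him : 0 ≤ w.im) {t : ℝ} (ht : 0 ≤ t) :
    ‖scaledPower δ α (w + t * Complex.I) - scaledPower δ α w‖ ≤
      2 ^ α * δ ^ (1 - α) / (α - 1) * ((1 + Real.exp (w.re * δ)) * ‖w‖ ^ (1 - α)) := by
  have hα0 : 0 < α - 1 := by linarith
  have hw0 : 0 < ‖w‖ := norm_pos_iff.2 (Complex.slitPlane_ne_zero hw)
  set D := 2 ^ α * δ ^ (1 - α) / (α - 1) * (1 + Real.exp (w.re * δ)) with hD
  have hD0 : 0 ≤ D := by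
    have := Real.rpow_nonneg hδ.le (1 - α)
    positivity
  have hderiv : ∀ s : ℝ, 0 ≤ s → HasDerivAt
      (fun s : ℝ => scaledPower δ α (w + s * Complex.I) - scaledPower δ α w)
      ((w + s * Complex.I) ^ ((-α : ℝ) : ℂ) *
        ((Complex.exp ((w + s * Complex.I) * δ) - 1) * (δ ^ (1 - α) : ℝ)) * Complex.I) s := by
    intro s hs
    have h1 : HasDerivAt (fun s : ℝ => w + s * Complex.I) Complex.I s := by
      simpa using ((Complex.ofRealCLM.hasDerivAt (x := s)).mul_const Complex.I).const_add w
    exact ((hasDerivAt_scaledPower hδ hα (mem_slitPlane_add_mul_I hw him hs)).comp s h1).sub_const _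
  have hB : ∀ s : ℝ, 0 ≤ s → HasDerivAt
      (fun s : ℝ => D * (‖w‖ ^ (1 - α) - (‖w‖ + s) ^ (1 - α)))
      (D * (α - 1) * (‖w‖ + s) ^ (-α)) s := by
    intro s hs
    have h1 : HasDerivAt (fun s : ℝ => (‖w‖ + s) ^ (1 - α))
        (1 * (1 - α) * (‖w‖ + s) ^ (1 - α - 1)) s :=
      ((hasDerivAt_id s).const_add ‖w‖).rpow_const (Or.inl (by simp; positivity))
    refine ((h1.const_sub _).const_mul D).congr_deriv ?_
    rw [show 1 - α - 1 = -α by ring]; ring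
  have h := image_norm_le_of_norm_deriv_right_le_deriv_boundary' (a := 0) (b := t)
    (f := fun s : ℝ => scaledPower δ α (w + s * Complex.I) - scaledPower δ α w)
    (fun s hs => (hderiv s hs.1).continuousAt.continuousWithinAt)
    (fun s hs => (hderiv s hs.1).hasDerivWithinAt) (by simp)
    (fun s hs => (hB s hs.1).continuousAt.continuousWithinAt)
    (fun s hs => (hB s hs.1).hasDerivWithinAt) (fun s hs => by
      rw [norm_mul, Complex.norm_I, mul_one]
      refine (norm_deriv_scaledPower_le hδ _).trans ?_
      have h1 : (w + s * Complex.I).re = w.re := by simp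
      rw [h1]
      have h2 : ‖w + s * Complex.I‖ ^ (-α) ≤ 2 ^ α * (‖w‖ + s) ^ (-α) := by
        have h3 : 0 < ‖w‖ + s := by linarith [hs.1]
        calc _ ≤ ((‖w‖ + s) / 2) ^ (-α) :=
              Real.rpow_le_rpow_of_nonpos (by positivity) (norm_add_mul_I_ge him hs.1)
                (by linarith)
          _ = _ := by
            rw [Real.div_rpow h3.le (by norm_num), Real.rpow_neg (by norm_num : (0 : ℝ) ≤ 2),
              div_inv_eq_mul, mul_comm]
      have h4 := Real.rpow_nonneg hδ.le (1 - α)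
      calc _ ≤ δ ^ (1 - α) * (1 + Real.exp (w.re * δ)) * (2 ^ α * (‖w‖ + s) ^ (-α)) := by gcongr
        _ = _ := by rw [hD]; field_simp)
    ⟨ht, le_rfl⟩
  refine h.trans ?_
  have h5 : 0 ≤ (‖w‖ + t) ^ (1 - α) := by positivity
  rw [← mul_assoc, ← hD]
  gcongr
  linarith

end PowerIntegral

lemma cos_half_lt_one : Real.cos (1 / 2) < 1 := by
  have := Real.cos_lt_cos_of_nonneg_of_le_pi le_rfl (by linarith [Real.pi_gt_three])
    (by norm_num : (0 : ℝ) < 1 / 2)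
  rwa [Real.cos_zero] at this

section PowerIntegral

variable {δ α : ℝ}

lemma norm_scaledPower_mul_I_ge (hδ : 0 < δ) (hα1 : 1 < α) (hα : α < 2) {t : ℝ} (ht : 1 / δ ≤ t) :
    (1 - Real.cos (1 / 2)) / 2 ≤ ‖scaledPower δ α (t * Complex.I)‖ := by
  have ht0 : 0 < t := lt_of_lt_of_le (by positivity) ht
  have hcos : 0 < 1 - Real.cos (1 / 2) := by
    linarith [cos_half_lt_one]
  have hi := intervalIntegrable_powerIntegral hδ hα (t * Complex.I)
  have hre : -(powerIntegral δ α (t * Complex.I)).re =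
      ∫ y in 0..δ, (1 - Real.cos (t * y)) * y ^ (-α) := by
    rw [powerIntegral, ← Complex.reCLM_apply, ← ContinuousLinearMap.intervalIntegral_comp_comm _ hi,
      ← intervalIntegral.integral_neg]
    refine intervalIntegral.integral_congr fun y _ => ?_
    have h1 : Complex.exp (t * Complex.I * y) = Complex.exp (((t * y : ℝ) : ℂ) * Complex.I) := by
      push_cast; ring_nf
    simp only [Complex.reCLM_apply]
    rw [h1, Complex.re_mul_ofReal, Complex.sub_re, Complex.exp_ofReal_mul_I_re, Complex.one_re]
    ring
  have hint : IntervalIntegrable (fun y : ℝ => (1 - Real.cos (t * y)) * y ^ (-α)) volume 0 δ := by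
    have h1 : IntervalIntegrable (fun y : ℝ =>
        -((Complex.exp (t * Complex.I * y) - 1) * (y ^ (-α) : ℝ)).re) volume 0 δ :=
      ⟨hi.1.re.neg, hi.2.re.neg⟩
    refine h1.congr fun y _ => ?_
    have h1 : Complex.exp (t * Complex.I * y) = Complex.exp (((t * y : ℝ) : ℂ) * Complex.I) := by
      push_cast; ring_nf
    rw [h1, Complex.re_mul_ofReal, Complex.sub_re, Complex.exp_ofReal_mul_I_re, Complex.one_re]
    ring
  have hle : (1 - Real.cos (1 / 2)) * t ^ α * (1 / (2 * t)) ≤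
      ∫ y in 0..δ, (1 - Real.cos (t * y)) * y ^ (-α) := by
    have hb : 1 / t ≤ δ := by rw [div_le_comm₀ ht0 hδ]; exact ht
    have ha : 1 / (2 * t) ≤ 1 / t := by
      apply one_div_le_one_div_of_le ht0; linarith
    have ha0 : 0 ≤ 1 / (2 * t) := by positivity
    have h1 : ∫ y in (1 / (2 * t))..(1 / t), (1 - Real.cos (t * y)) * y ^ (-α) ≤
        ∫ y in 0..δ, (1 - Real.cos (t * y)) * y ^ (-α) := by
      refine intervalIntegral.integral_mono_interval ha0 ha hb ?_ hint
      filter_upwards [ae_restrict_mem measurableSet_Ioc] with y hy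
      exact mul_nonneg (by linarith [Real.cos_le_one (t * y)]) (Real.rpow_nonneg hy.1.le _)
    refine le_trans ?_ h1
    have h2 := intervalIntegral.integral_mono_on ha
      (f := fun _ => (1 - Real.cos (1 / 2)) * t ^ α) intervalIntegrable_const
      (hint.mono_set (by
        rw [uIcc_of_le ha, uIcc_of_le hδ.le]; exact Icc_subset_Icc ha0 hb)) (fun y hy => by
        have hy0 : 0 < y := lt_of_lt_of_le (by positivity) hy.1
        have h3 : t ^ α ≤ y ^ (-α) := by
          rw [Real.rpow_neg hy0.le, ← Real.inv_rpow hy0.le]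
          refine Real.rpow_le_rpow ht0.le ?_ (by linarith)
          rw [le_inv_comm₀ ht0 hy0, ← one_div]; exact hy.2
        have h4 : Real.cos (t * y) ≤ Real.cos (1 / 2) := by
          have h5 : 1 / 2 ≤ t * y := by
            have := mul_le_mul_of_nonneg_left hy.1 ht0.le
            rwa [show t * (1 / (2 * t)) = 1 / 2 by field_simp] at this
          have h6 : t * y ≤ 1 := by
            have := mul_le_mul_of_nonneg_left hy.2 ht0.le
            rwa [mul_one_div_cancel ht0.ne'] at this
          exact Real.cos_le_cos_of_nonneg_of_le_pi (by norm_num) (by linarith [Real.pi_gt_three]) h5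
        have h7 : 0 ≤ t ^ α := by positivity
        exact mul_le_mul (by linarith) h3 h7 (by linarith))
    rw [intervalIntegral.integral_const, smul_eq_mul] at h2
    refine le_trans (le_of_eq ?_) h2
    rw [mul_comm (1 / t - 1 / (2 * t))]
    congr 1
    field_simp
    norm_num
  rw [scaledPower, norm_mul, Complex.norm_cpow_real, norm_mul, Complex.norm_I, mul_one,
    Complex.norm_real, Real.norm_of_nonneg ht0.le]
  calc (1 - Real.cos (1 / 2)) / 2 = t ^ (1 - α) * ((1 - Real.cos (1 / 2)) * t ^ α * (1 / (2 * t))) := by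
        have : t ^ (1 - α) * t ^ α = t := by rw [← Real.rpow_add ht0]; simp
        calc _ = (1 - Real.cos (1 / 2)) * (1 / (2 * t)) * t := by field_simp
          _ = (1 - Real.cos (1 / 2)) * (1 / (2 * t)) * (t ^ (1 - α) * t ^ α) := by rw [this]
          _ = _ := by ring
    _ ≤ t ^ (1 - α) * ‖powerIntegral δ α (t * Complex.I)‖ := by
        gcongr
        rw [← hre] at hle
        exact hle.trans ((neg_le_abs _).trans (Complex.abs_re_le_norm _))

lemma exists_scaledPower_limit (hδ : 0 < δ) (hα1 : 1 < α) (hα : α < 2) :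
    ∃ K : ℂ, K ≠ 0 ∧ ∃ C, 0 ≤ C ∧ ∀ w ∈ Complex.slitPlane, 0 ≤ w.im →
      ‖scaledPower δ α w - K‖ ≤ C * ((1 + Real.exp (w.re * δ)) * ‖w‖ ^ (1 - α)) := by
  have hα0 : 0 < α - 1 := by linarith
  have hδα := Real.rpow_nonneg hδ.le (1 - α)
  set C := 2 ^ α * δ ^ (1 - α) / (α - 1) with hC
  have hC0 : 0 ≤ C := by positivity
  have hslit : ∀ t : ℝ, 0 < t → (t : ℂ) * Complex.I ∈ Complex.slitPlane := by
    intro t ht; right; simpa using ht.ne'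
  set q : ℝ → ℂ := fun t => scaledPower δ α (t * Complex.I) with hq
  have hstep : ∀ t s : ℝ, 0 < t → 0 ≤ s → ‖q (t + s) - q t‖ ≤ C * 2 * t ^ (1 - α) := by
    intro t s ht hs
    have h := norm_scaledPower_sub_le hδ hα1 hα (hslit t ht) (by simpa using ht.le) hs
    rw [← add_mul, ← Complex.ofReal_add] at h
    refine h.trans (le_of_eq ?_)
    rw [norm_mul, Complex.norm_I, mul_one, Complex.norm_real, Real.norm_of_nonneg ht.le]
    simp [hC]; ring
  have hpow : ∀ r : ℝ, Tendsto (fun m : ℕ => ((m : ℝ) + r) ^ (1 - α)) atTop (𝓝 0) := by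
    intro r
    have := tendsto_rpow_neg_atTop hα0
    rw [show -(α - 1) = 1 - α by ring] at this
    exact this.comp (tendsto_atTop_add_const_right _ _ tendsto_natCast_atTop_atTop)
  obtain ⟨K, hK⟩ : ∃ K, Tendsto (fun m : ℕ => q (m + 1)) atTop (𝓝 K) := by
    refine cauchySeq_tendsto_of_complete (cauchySeq_of_le_tendsto_0
      (fun m : ℕ => 2 * (C * 2 * ((m : ℝ) + 1) ^ (1 - α))) (fun a b N ha hb => ?_) ?_)
    · have h1 : ∀ a : ℕ, N ≤ a → ‖q (a + 1) - q (N + 1)‖ ≤ C * 2 * ((N : ℝ) + 1) ^ (1 - α) := by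
        intro a ha
        have ha' : (N : ℝ) ≤ a := by exact_mod_cast ha
        have := hstep (N + 1) (a - N) (by positivity) (by linarith)
        rwa [show (N : ℝ) + 1 + (a - N) = a + 1 by ring] at this
      have := norm_sub_le_of_le (h1 a ha) (h1 b hb)
      rw [sub_sub_sub_cancel_right] at this
      rw [dist_eq_norm]
      linarith
    · simpa using ((hpow 1).const_mul (C * 2)).const_mul 2
  have hqK : ∀ t, 0 < t → ‖K - q t‖ ≤ C * 2 * t ^ (1 - α) := by
    intro t ht
    have h1 : Tendsto (fun m : ℕ => q ((m + ⌈t⌉₊ : ℕ) + 1)) atTop (𝓝 K) :=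
      hK.comp (tendsto_add_atTop_nat ⌈t⌉₊)
    refine le_of_tendsto (h1.sub_const (q t)).norm (Eventually.of_forall fun m => ?_)
    have h2 := hstep t (((m + ⌈t⌉₊ : ℕ) : ℝ) + 1 - t) ht (by
      push_cast
      linarith [Nat.le_ceil t, (m.cast_nonneg : (0 : ℝ) ≤ m)])
    rwa [add_sub_cancel] at h2
  refine ⟨K, ?_, C, hC0, fun w hw him => ?_⟩
  · have hcos : 0 < 1 - Real.cos (1 / 2) := by
      linarith [cos_half_lt_one]
    have h1 : (1 - Real.cos (1 / 2)) / 2 ≤ ‖K‖ := by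
      refine ge_of_tendsto hK.norm ?_
      filter_upwards [tendsto_natCast_atTop_atTop.eventually_ge_atTop (1 / δ)] with m hm
      exact norm_scaledPower_mul_I_ge hδ hα1 hα (t := (m : ℝ) + 1) (by linarith)
    exact norm_pos_iff.1 (by linarith)
  · set u := w.re with hu
    set D := δ ^ (1 - α) * (1 + Real.exp (|u| * δ)) with hD
    have hD0 : 0 ≤ D := by positivity
    -- comparison with the imaginary axis
    have hhor : ∀ V : ℝ, 0 < V →
        ‖scaledPower δ α (u + V * Complex.I) - q V‖ ≤ D * V ^ (-α) * |u| := by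
      intro V hV
      set S : Set ℂ := {z | V ≤ z.im} ∩ ({z | z.re ≤ |u|} ∩ {z | -|u| ≤ z.re})
      have hS : Convex ℝ S := (convex_halfSpace_im_ge V).inter
        ((convex_halfSpace_re_le _).inter (convex_halfSpace_re_ge _))
      have h := hS.norm_image_sub_le_of_norm_hasDerivWithin_le (𝕜 := ℂ)
        (f := scaledPower δ α) (C := D * V ^ (-α)) (x := V * Complex.I) (y := u + V * Complex.I)
        (fun z hz => (hasDerivAt_scaledPower hδ hα (Or.inr (hV.trans_le hz.1).ne')).hasDerivWithinAt)
        (fun z hz => by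
          refine (norm_deriv_scaledPower_le hδ z).trans ?_
          have h1 : V ≤ ‖z‖ := hz.1.trans (Complex.im_le_norm z)
          have h2 : ‖z‖ ^ (-α) ≤ V ^ (-α) := Real.rpow_le_rpow_of_nonpos hV h1 (by linarith)
          rw [hD]
          gcongr
          exact hz.2.1)
        ⟨by simp, by simp, by simp⟩ ⟨by simp, by simpa using le_abs_self u,
          by simpa using neg_abs_le u⟩
      rw [add_sub_cancel_right, Complex.norm_real] at h
      exact h
    have hlim : Tendsto (fun m : ℕ => C * ((1 + Real.exp (u * δ)) * ‖w‖ ^ (1 - α)) +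
        D * ((m : ℝ) + (w.im + 1)) ^ (1 - α) * |u| + C * 2 * ((m : ℝ) + (w.im + 1)) ^ (1 - α))
        atTop (𝓝 (C * ((1 + Real.exp (u * δ)) * ‖w‖ ^ (1 - α)) + D * 0 * |u| + C * 2 * 0)) :=
      ((((hpow (w.im + 1)).const_mul D).mul_const |u|).const_add _).add
        ((hpow (w.im + 1)).const_mul (C * 2))
    rw [mul_zero, mul_zero, zero_mul, add_zero, add_zero] at hlim
    refine ge_of_tendsto hlim (Eventually.of_forall fun m => ?_)
    have hV : 0 < (m : ℝ) + (w.im + 1) := by positivity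
    have hV1 : 1 ≤ (m : ℝ) + (w.im + 1) := by linarith [(m.cast_nonneg : (0 : ℝ) ≤ m)]
    have h1 := norm_scaledPower_sub_le hδ hα1 hα hw him (t := m + 1) (by positivity)
    have h2 := hhor _ hV
    have h3 := hqK _ hV
    have h4 : w + ((m + 1 : ℝ) : ℂ) * Complex.I =
        u + (((m : ℝ) + (w.im + 1) : ℝ) : ℂ) * Complex.I := by
      apply Complex.ext <;> simp [hu]
      ring
    rw [h4] at h1
    have h5 : ((m : ℝ) + (w.im + 1)) ^ (-α) ≤ ((m : ℝ) + (w.im + 1)) ^ (1 - α) :=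
      Real.rpow_le_rpow_of_exponent_le hV1 (by linarith)
    have h6 : D * ((m : ℝ) + (w.im + 1)) ^ (-α) * |u| ≤
        D * ((m : ℝ) + (w.im + 1)) ^ (1 - α) * |u| := by gcongr
    rw [norm_sub_rev] at h1 h3
    have h7 := norm_add₃_le (a := scaledPower δ α w -
        scaledPower δ α (u + (((m : ℝ) + (w.im + 1) : ℝ) : ℂ) * Complex.I))
      (b := scaledPower δ α (u + (((m : ℝ) + (w.im + 1) : ℝ) : ℂ) * Complex.I) -
        q ((m : ℝ) + (w.im + 1))) (c := q ((m : ℝ) + (w.im + 1)) - K)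
    rw [sub_add_sub_cancel, sub_add_sub_cancel] at h7
    linarith

/-- Asymptotics of `w` times the integral of `(e ^ {w y} - 1) y ^ (-α)`. -/
lemma exists_mul_powerIntegral_bound (hδ : 0 < δ) (hα1 : 1 < α) (hα : α < 2) :
    ∃ K : ℂ, K ≠ 0 ∧ ∃ C, ∀ w ∈ Complex.slitPlane, 0 ≤ w.im →
      ‖w * powerIntegral δ α w - K * w ^ (α : ℂ)‖ ≤
        C * (‖w‖ ^ (1 : ℝ) * (1 + Real.exp (w.re * δ))) := by
  obtain ⟨K, hK, C, hC, h⟩ := exists_scaledPower_limit hδ hα1 hα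
  refine ⟨K, hK, C, fun w hw him => ?_⟩
  have hw0 : w ≠ 0 := Complex.slitPlane_ne_zero hw
  have hwn : 0 < ‖w‖ := norm_pos_iff.2 hw0
  have h1 : w = w ^ (α : ℂ) * w ^ ((1 - α : ℝ) : ℂ) := by
    rw [← Complex.cpow_add _ _ hw0]; simp
  have h2 : w * powerIntegral δ α w - K * w ^ (α : ℂ) =
      w ^ (α : ℂ) * (scaledPower δ α w - K) := by
    rw [scaledPower]
    nth_rw 1 [h1]
    ring
  rw [h2, norm_mul, Complex.norm_cpow_real]
  calc _ ≤ ‖w‖ ^ α * (C * ((1 + Real.exp (w.re * δ)) * ‖w‖ ^ (1 - α))) := by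
        gcongr; exact h w hw him
    _ = C * (‖w‖ ^ α * ‖w‖ ^ (1 - α) * (1 + Real.exp (w.re * δ))) := by ring
    _ = _ := by rw [← Real.rpow_add hwn, add_sub_cancel]

end PowerIntegral

lemma continuousAt_iteratedDeriv {f : ℝ → ℝ} {n j : ℕ} {x : ℝ} (hf : ContDiffAt ℝ n f x)
    (hj : j ≤ n) : ContinuousAt (iteratedDeriv j f) x := by
  rw [iteratedDeriv_eq_equiv_comp]
  exact (LinearIsometryEquiv.continuous _).continuousAt.comp
    (hf.continuousAt_iteratedFDeriv (by exact_mod_cast hj))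

lemma hasDerivAt_iteratedDeriv {f : ℝ → ℝ} {n j : ℕ} {x : ℝ} (hf : ContDiffAt ℝ n f x)
    (hj : j < n) : HasDerivAt (iteratedDeriv j f) (iteratedDeriv (j + 1) f x) x := by
  rw [iteratedDeriv_succ]
  refine DifferentiableAt.hasDerivAt ?_
  rw [iteratedDeriv_eq_equiv_comp]
  exact (LinearIsometryEquiv.differentiable _).differentiableAt.comp _
    (hf.differentiableAt_iteratedFDeriv (by exact_mod_cast hj))

lemma exists_merged_powers {ι : Type*} [Fintype ι] (c a : ι → ℝ) :
    ∃ (F : Finset ℝ) (e : ℝ → ℝ), (∀ b ∈ F, e b ≠ 0 ∧ ∃ i, a i = b) ∧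
      ∀ y : ℝ, ∑ i, c i * y ^ (-a i) = ∑ b ∈ F, e b * y ^ (-b) := by
  classical
  refine ⟨(Finset.univ.image a).filter fun b => ∑ i with a i = b, c i ≠ 0,
    fun b => ∑ i with a i = b, c i, fun b hb => ?_, fun y => ?_⟩
  · rw [Finset.mem_filter, Finset.mem_image] at hb
    obtain ⟨⟨i, -, hi⟩, h⟩ := hb
    exact ⟨h, i, hi⟩
  · rw [← Finset.sum_fiberwise_of_maps_to (s := Finset.univ) (t := Finset.univ.image a) (g := a)
      (fun i _ => Finset.mem_image_of_mem a (Finset.mem_univ i)), Finset.sum_filter]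
    refine Finset.sum_congr rfl fun b _ => ?_
    have h : ∑ i with a i = b, c i * y ^ (-a i) = (∑ i with a i = b, c i) * y ^ (-b) := by
      rw [Finset.sum_mul]
      refine Finset.sum_congr rfl fun i hi => ?_
      rw [(Finset.mem_filter.1 hi).2]
    rw [h]
    split_ifs with h0
    · rfl
    · rw [not_not.1 h0, zero_mul]

/-- The singular part of the tail at the origin, as a function of the whole line. -/
noncomputable def powerSum (F : Finset ℝ) (e : ℝ → ℝ) (y : ℝ) : ℝ := ∑ b ∈ F, e b * |y| ^ (-b)

lemma contDiffAt_powerSum (F : Finset ℝ) (e : ℝ → ℝ) (n : ℕ) {y : ℝ} (hy : 0 < y) :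
    ContDiffAt ℝ n (powerSum F e) y := by
  unfold powerSum
  refine ContDiffAt.sum fun b _ => contDiffAt_const.mul ?_
  refine (Real.contDiffAt_rpow_const_of_ne (p := -b) hy.ne').congr_of_eventuallyEq ?_
  filter_upwards [Ioi_mem_nhds hy] with z hz
  rw [abs_of_pos hz]

lemma powerSum_of_pos (F : Finset ℝ) (e : ℝ → ℝ) {y : ℝ} (hy : 0 < y) :
    powerSum F e y = ∑ b ∈ F, e b * y ^ (-b) := by rw [powerSum, abs_of_pos hy]

lemma measurable_powerSum (F : Finset ℝ) (e : ℝ → ℝ) : Measurable (powerSum F e) := by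
  unfold powerSum
  fun_prop

/-- Regularity of the tail `T` on `(0, k)`, in the positive variable: up to a sum of powers it is
piecewise `C ^ (n + 1)`, it is `C ^ (n - 1)` on the half-line, and its `n`-th derivative does not
vanish at the right endpoint. -/
structure RegularTail (T : ℝ → ℝ) (k : ℝ) (n : ℕ) (l : ℝ) (s F : Finset ℝ) (e : ℝ → ℝ) :
    Prop where
  exponent : ∀ b ∈ F, e b ≠ 0 ∧ b < 2 ∧ b ≠ 1
  contDiffAt : ∀ y ∈ Ioo 0 k, y ∉ s →
    ContDiffAt ℝ (n + 1 : ℕ) (fun y => T y - powerSum F e y) y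
  regulated : ∀ j ≤ n + 1, Regulated (iteratedDeriv j fun y => T y - powerSum F e y) 0 k
  ne_zero : l ≠ 0
  tendsto : Tendsto (iteratedDeriv n T) (𝓝[<] k) (𝓝 l)
  contDiffOn : ∀ i : ℕ, n = i + 1 → ContDiffOn ℝ i T (Ioi 0)

lemma IsRegular.exists_regularTail {ν : Measure ℝ} {k : ℝ} (h : IsRegular ν k) :
    ∃ n l s F e, RegularTail (tail ν) k n l s F e := by
  classical
  obtain ⟨n, ⟨C, α, m, C', α', hα, hα', s, hs1, hs2, hsub, hcd, hlim⟩, ⟨l, hl0, hl⟩, hc⟩ := h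
  obtain ⟨F, e, hF, hsum⟩ := exists_merged_powers
    (fun i : Option (Fin m) => i.elim C C') (fun i : Option (Fin m) => i.elim α α')
  set r : ℝ → ℝ := fun x => leftTail ν x - C * |x| ^ (-α) - ∑ j, C' j * |x| ^ (-α' j) with hr
  have hrho : (fun y => tail ν y - powerSum F e y) = fun y => r (-y) := by
    ext y
    simp only [hr, abs_neg, powerSum, tail, ← hsum, Fintype.sum_option, Option.elim]
    ring
  have hnot : ∀ x ∈ Icc (-k) 0, x ∉ s → ContDiffAt ℝ (n + 1 : ℕ) r x := by
    intro x hx hxs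
    refine (hcd x ⟨hx, by simpa using hxs⟩).contDiffAt ?_
    have h1 : x ∈ Ioo (-k) 0 := ⟨lt_of_le_of_ne hx.1 (by rintro rfl; exact hxs hs1),
      lt_of_le_of_ne hx.2 (by rintro rfl; exact hxs hs2)⟩
    exact inter_mem (Icc_mem_nhds h1.1 h1.2) (s.finite_toSet.isClosed.isOpen_compl.mem_nhds hxs)
  have hside : ∀ j ≤ n + 1, ∀ x ∈ Icc (-k) 0,
      (-k < x → ∃ l, Tendsto (iteratedDeriv j r) (𝓝[<] x) (𝓝 l)) ∧
      (x < 0 → ∃ l, Tendsto (iteratedDeriv j r) (𝓝[>] x) (𝓝 l)) := by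
    intro j hj x hx
    by_cases hxs : x ∈ s
    · exact hlim j hj x hxs
    · have := continuousAt_iteratedDeriv (hnot x hx hxs) hj
      exact ⟨fun _ => ⟨_, this.tendsto.mono_left nhdsWithin_le_nhds⟩,
        fun _ => ⟨_, this.tendsto.mono_left nhdsWithin_le_nhds⟩⟩
  have hneg : ∀ (f : ℝ → ℝ) (j : ℕ), iteratedDeriv j (fun y => f (-y)) =
      fun y => (-1) ^ j * iteratedDeriv j f (-y) := by
    intro f j; ext y; rw [iteratedDeriv_comp_neg, smul_eq_mul]
  refine ⟨n, (-1) ^ n * l, s.image fun x => -x, F, e, ?_, ?_, ?_, ?_, ?_, ?_⟩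
  · intro b hb
    obtain ⟨h1, i, hi⟩ := hF b hb
    refine ⟨h1, ?_⟩
    rcases i with _ | i
    · simp only [Option.elim] at hi
      rw [← hi]; exact hα
    · simp only [Option.elim] at hi
      rw [← hi]; exact ⟨(hα' i).2.trans hα.1, (hα' i).1⟩
  · intro y hy hys
    rw [hrho]
    have h1 : ContDiffAt ℝ (n + 1 : ℕ) r (-y) := hnot (-y) ⟨by linarith [hy.2], by linarith [hy.1]⟩
      fun h => hys (Finset.mem_image.2 ⟨-y, h, neg_neg y⟩)
    exact h1.comp y contDiff_neg.contDiffAt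
  · intro j hj
    rw [hrho, hneg]
    constructor
    · intro p hp
      obtain ⟨l, hl⟩ := (hside j hj (-p) ⟨by linarith [hp.2], by linarith [hp.1]⟩).1
        (by linarith [hp.2])
      exact ⟨_, (hl.comp tendsto_neg_nhdsGT).const_mul ((-1) ^ j)⟩
    · intro p hp
      obtain ⟨l, hl⟩ := (hside j hj (-p) ⟨by linarith [hp.2], by linarith [hp.1]⟩).2
        (by linarith [hp.1])
      exact ⟨_, (hl.comp tendsto_neg_nhdsLT).const_mul ((-1) ^ j)⟩
  · exact mul_ne_zero (pow_ne_zero _ (by norm_num)) hl0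
  · have : tail ν = fun y => leftTail ν (-y) := rfl
    rw [this, hneg]
    exact (hl.comp tendsto_neg_nhdsLT).const_mul _
  · intro i hi
    exact (hc i hi).comp contDiff_neg.contDiffOn fun y hy => by
      simpa using hy

namespace RegularTail

variable {T : ℝ → ℝ} {k : ℝ} {n : ℕ} {l : ℝ} {s F : Finset ℝ} {e : ℝ → ℝ}

lemma contDiffAt_tail (h : RegularTail T k n l s F e) {y : ℝ} (hy : y ∈ Ioo 0 k) (hys : y ∉ s) :
    ContDiffAt ℝ (n + 1 : ℕ) T y := by
  have h1 := (h.contDiffAt y hy hys).add (contDiffAt_powerSum F e (n + 1) hy.1)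
  simpa using h1

lemma regulated_tail (h : RegularTail T k n l s F e) {j : ℕ} (hj : j ≤ n + 1) {δ : ℝ}
    (hδ : 0 < δ) : Regulated (iteratedDeriv j T) δ k := by
  set ρ : ℝ → ℝ := fun y => T y - powerSum F e y with hρ
  have hadd : ∀ y ∈ Ioo 0 k, y ∉ s →
      iteratedDeriv j T y = iteratedDeriv j ρ y + iteratedDeriv j (powerSum F e) y := by
    intro y hy hys
    have h1 : T = ρ + powerSum F e := by ext; simp [hρ]
    conv_lhs => rw [h1]
    exact iteratedDeriv_add ((h.contDiffAt y hy hys).of_le (by exact_mod_cast hj))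
      (contDiffAt_powerSum F e j hy.1)
  have hcont : ∀ p, 0 < p → ContinuousAt (iteratedDeriv j (powerSum F e)) p := fun p hp =>
    continuousAt_iteratedDeriv (contDiffAt_powerSum F e j hp) le_rfl
  have hs : ∀ p, ∀ᶠ y in 𝓝[≠] p, y ∉ s := by
    intro p
    have h3 : ((s.erase p : Finset ℝ) : Set ℝ)ᶜ ∈ 𝓝 p :=
      (s.erase p).finite_toSet.isClosed.isOpen_compl.mem_nhds (by simp)
    filter_upwards [mem_nhdsWithin_of_mem_nhds h3, self_mem_nhdsWithin] with y hy hyp hys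
    exact hy (Finset.mem_coe.2 (Finset.mem_erase.2 ⟨hyp, hys⟩))
  constructor
  · intro p hp
    have hp0 : 0 < p := hδ.trans_le hp.1
    obtain ⟨l₁, hl₁⟩ := (h.regulated j hj).1 p ⟨hp0.le, hp.2⟩
    refine ⟨_, (hl₁.add ((hcont p hp0).tendsto.mono_left nhdsWithin_le_nhds)).congr' ?_⟩
    filter_upwards [Ioo_mem_nhdsGT hp.2, (hs p).filter_mono
      (nhdsWithin_mono p fun y (hy : p < y) => hy.ne')] with y hy hys
    exact (hadd y ⟨hp0.trans hy.1, hy.2⟩ hys).symm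
  · intro p hp
    have hp0 : 0 < p := hδ.trans hp.1
    obtain ⟨l₁, hl₁⟩ := (h.regulated j hj).2 p ⟨hp0, hp.2⟩
    refine ⟨_, (hl₁.add ((hcont p hp0).tendsto.mono_left nhdsWithin_le_nhds)).congr' ?_⟩
    filter_upwards [Ioo_mem_nhdsLT hp0, (hs p).filter_mono
      (nhdsWithin_mono p fun y (hy : y < p) => hy.ne)] with y hy hys
    exact (hadd y ⟨hy.1, hy.2.trans_le hp.2⟩ hys).symm

lemma contDiffAt_lower (h : RegularTail T k n l s F e) {j : ℕ} (hj : j < n) {y : ℝ} (hy : 0 < y) :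
    ContDiffAt ℝ j T y := by
  obtain ⟨i, rfl⟩ : ∃ i, n = i + 1 := ⟨n - 1, by omega⟩
  exact ((h.contDiffOn i rfl).contDiffAt (Ioi_mem_nhds hy)).of_le
    (by exact_mod_cast (by omega : j ≤ i))

lemma iteratedDeriv_endpoint (h : RegularTail T k n l s F e) (hk : 0 < k)
    (hT : ∀ y, k ≤ y → T y = 0) {j : ℕ} (hj : j < n) : iteratedDeriv j T k = 0 := by
  have hc := continuousAt_iteratedDeriv (h.contDiffAt_lower hj hk) le_rfl
  refine tendsto_nhds_unique (hc.tendsto.mono_left (nhdsWithin_le_nhds (s := Ioi k))) ?_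
  refine tendsto_const_nhds.congr' ?_
  filter_upwards [self_mem_nhdsWithin] with y hy
  have h1 : T =ᶠ[𝓝 y] fun _ => (0 : ℝ) := by
    filter_upwards [Ioi_mem_nhds hy] with z hz using hT z (le_of_lt hz)
  rw [h1.iteratedDeriv_eq, iteratedDeriv_fun_const_zero]

lemma measurable_iteratedDeriv (hT : Measurable T) (j : ℕ) : Measurable (iteratedDeriv j T) := by
  cases j with
  | zero => rwa [iteratedDeriv_zero]
  | succ j => rw [iteratedDeriv_succ]; exact measurable_deriv _

/-- Asymptotics of the part of the integral away from the origin. -/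
lemma integral_asymptotic (h : RegularTail T k n l s F e) (hT : Measurable T)
    (hT0 : ∀ y, k ≤ y → T y = 0) {δ c p : ℝ} (hδ : 0 < δ) (hδk : δ < k) (hc : 0 ≤ c) (hp0 : 0 < p)
    (hp : 0 < p - δ / k * (p + n)) :
    (fun w : ℂ => w * (∫ y in δ..k, Complex.exp (w * y) * T y) -
      (-1) ^ n * l * (Complex.exp (k * w) / w ^ n)) =o[regionFilter c] gauge p k n := by
  have hk := hδ.trans hδk
  have := integral_exp_mul_asymptotic (g := fun j => iteratedDeriv j T) (s := s) hδ hδk hc hp0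
    (measurable_iteratedDeriv hT)
    (fun j hj y hy => (continuousAt_iteratedDeriv (h.contDiffAt_lower hj (hδ.trans_le hy.1))
      le_rfl).continuousWithinAt)
    (fun j hj => h.iteratedDeriv_endpoint hk hT0 hj)
    (fun j hj y hy hys => hasDerivAt_iteratedDeriv
      (h.contDiffAt_tail ⟨hδ.trans hy.1, hy.2⟩ hys) (Nat.lt_succ_of_le hj))
    (h.regulated_tail (Nat.le_succ n) hδ) (h.regulated_tail le_rfl hδ) h.tendsto hp
  simpa only [iteratedDeriv_zero] using this

end RegularTail

namespace SingularBound

variable {g g' h h' : ℝ → ℝ} {δ a C D : ℝ}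

lemma add (hg : SingularBound g g' δ a C) (hh : SingularBound h h' δ a D) :
    SingularBound (fun y => g y + h y) (fun y => g' y + h' y) δ a (C + D) where
  hasDerivAt y hy := (hg.hasDerivAt y hy).add (hh.hasDerivAt y hy)
  measurable := hg.measurable.add hh.measurable
  measurable' := hg.measurable'.add hh.measurable'
  bound y hy := by
    rw [add_mul]; exact (abs_add_le _ _).trans (add_le_add (hg.bound y hy) (hh.bound y hy))
  bound' y hy := by
    rw [add_mul]; exact (abs_add_le _ _).trans (add_le_add (hg.bound' y hy) (hh.bound' y hy))

lemma const_mul (hg : SingularBound g g' δ a C) (r : ℝ) :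
    SingularBound (fun y => r * g y) (fun y => r * g' y) δ a (|r| * C) where
  hasDerivAt y hy := (hg.hasDerivAt y hy).const_mul r
  measurable := hg.measurable.const_mul r
  measurable' := hg.measurable'.const_mul r
  bound y hy := by
    rw [abs_mul, mul_assoc]; exact mul_le_mul_of_nonneg_left (hg.bound y hy) (abs_nonneg r)
  bound' y hy := by
    rw [abs_mul, mul_assoc]; exact mul_le_mul_of_nonneg_left (hg.bound' y hy) (abs_nonneg r)

lemma congr (hg : SingularBound g g' δ a C) (hh : Measurable h) (heq : ∀ y, 0 < y → g y = h y) :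
    SingularBound h g' δ a C where
  hasDerivAt y hy := (hg.hasDerivAt y hy).congr_of_eventuallyEq (by
    filter_upwards [Ioi_mem_nhds hy.1] with z hz using (heq z hz).symm)
  measurable := hh
  measurable' := hg.measurable'
  bound y hy := by rw [← heq y hy.1]; exact hg.bound y hy
  bound' := hg.bound'

end SingularBound

lemma exists_singularBound_sum {F : Finset ℝ} (e : ℝ → ℝ) {a : ℝ} (δ : ℝ) (hF : ∀ b ∈ F, b ≤ a) :
    ∃ g' C, SingularBound (fun y => ∑ b ∈ F, e b * y ^ (-b)) g' δ a C := by
  classical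
  induction F using Finset.induction with
  | empty =>
    exact ⟨fun _ => 0, 0, ⟨fun y _ => by simpa using hasDerivAt_const y (0 : ℝ), by simp,
      by simp, fun y _ => by simp, fun y _ => by simp⟩⟩
  | insert b F hb ih =>
    obtain ⟨g', C, h⟩ := ih fun b hb => hF b (Finset.mem_insert_of_mem hb)
    refine ⟨_, _, (((singularBound_rpow (δ := δ) (hF b (Finset.mem_insert_self _ _))).const_mul
      (e b)).add h).congr ?_ fun y _ => by rw [Finset.sum_insert hb]⟩
    fun_prop

namespace RegularTail

variable {T : ℝ → ℝ} {k : ℝ} {n : ℕ} {l : ℝ} {s F : Finset ℝ} {e : ℝ → ℝ}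

lemma exists_singularBound_remainder (h : RegularTail T k n l s F e) (hT : Measurable T) {a δ : ℝ}
    (hδ : 0 < δ) (ha : 0 < a) (hδk : δ < k) (hδs : ∀ y ∈ Ioc 0 δ, y ∉ s) :
    ∃ g' C, SingularBound (fun y => T y - powerSum F e y) g' δ a C := by
  obtain ⟨M, hM0, hM⟩ := (h.regulated 0 (by omega)).bounded
  obtain ⟨M', hM'0, hM'⟩ := (h.regulated 1 (by omega)).bounded
  rw [iteratedDeriv_zero] at hM
  rw [iteratedDeriv_one] at hM'
  set ρ : ℝ → ℝ := fun y => T y - powerSum F e y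
  have hone : ∀ r : ℝ, 0 < r → ∀ y ∈ Ioc 0 δ, 1 ≤ δ ^ r * y ^ (-r) := by
    intro r hr y hy
    rw [Real.rpow_neg hy.1.le, ← div_eq_mul_inv, one_le_div (Real.rpow_pos_of_pos hy.1 _)]
    exact Real.rpow_le_rpow hy.1.le hy.2 hr.le
  refine ⟨deriv ρ, M * δ ^ a + M' * δ ^ (a + 1), fun y hy => ?_, hT.sub (measurable_powerSum F e),
    measurable_deriv _, fun y hy => ?_, fun y hy => ?_⟩
  · exact ((h.contDiffAt y ⟨hy.1, hy.2.trans_lt hδk⟩ (hδs y hy)).differentiableAt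
      (by simp)).hasDerivAt
  · have h1 := hone a ha y hy
    have h2 := hM y ⟨hy.1.le, hy.2.trans hδk.le⟩
    have h3 : 0 < y ^ (-a) := Real.rpow_pos_of_pos hy.1 _
    have h4 : 0 < δ ^ (a + 1) := Real.rpow_pos_of_pos hδ _
    rw [add_mul]
    have h5 : 0 ≤ M' * δ ^ (a + 1) * y ^ (-a) := by positivity
    nlinarith
  · have h1 := hone (a + 1) (by linarith) y hy
    have h2 := hM' y ⟨hy.1.le, hy.2.trans hδk.le⟩
    rw [neg_add'] at h1
    have h3 : 0 < y ^ (-a - 1) := Real.rpow_pos_of_pos hy.1 _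
    have h4 : 0 < δ ^ a := Real.rpow_pos_of_pos hδ _
    rw [add_mul]
    have h5 : 0 ≤ M * δ ^ a * y ^ (-a - 1) := by positivity
    nlinarith

lemma exists_singularBound (h : RegularTail T k n l s F e) (hT : Measurable T) {a δ : ℝ}
    (hδ : 0 < δ) (ha : 0 < a) (hδk : δ < k) (hδs : ∀ y ∈ Ioc 0 δ, y ∉ s) (hF : ∀ b ∈ F, b ≤ a) :
    ∃ g' C, SingularBound T g' δ a C := by
  obtain ⟨g₁, C₁, h₁⟩ := exists_singularBound_sum e δ hF
  obtain ⟨g₂, C₂, h₂⟩ := h.exists_singularBound_remainder hT hδ ha hδk hδs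
  refine ⟨_, _, (h₁.add h₂).congr hT fun y hy => ?_⟩
  rw [powerSum_of_pos F e hy]; ring

/-- Splitting off the leading power. -/
lemma exists_singularBound_sub (h : RegularTail T k n l s F e) (hT : Measurable T) {a δ α : ℝ}
    (hδ : 0 < δ) (ha : 0 < a) (hδk : δ < k) (hδs : ∀ y ∈ Ioc 0 δ, y ∉ s) (hα : α ∈ F)
    (hF : ∀ b ∈ F, b ≠ α → b ≤ a) :
    ∃ g' C, SingularBound (fun y => T y - e α * y ^ (-α)) g' δ a C := by
  classical
  obtain ⟨g₁, C₁, h₁⟩ := exists_singularBound_sum (F := F.erase α) e δ (a := a)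
    (fun b hb => hF b (Finset.mem_of_mem_erase hb) (Finset.ne_of_mem_erase hb))
  obtain ⟨g₂, C₂, h₂⟩ := h.exists_singularBound_remainder hT hδ ha hδk hδs
  refine ⟨_, _, (h₁.add h₂).congr (by fun_prop) fun y hy => ?_⟩
  rw [powerSum_of_pos F e hy, ← Finset.add_sum_erase F _ hα]; ring

end RegularTail

lemma eventually_notMem_Ioc (s : Finset ℝ) : ∀ᶠ δ in 𝓝[>] (0 : ℝ), ∀ y ∈ Ioc 0 δ, y ∉ s := by
  have h3 : ((s.erase 0 : Finset ℝ) : Set ℝ)ᶜ ∈ 𝓝 (0 : ℝ) :=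
    (s.erase 0).finite_toSet.isClosed.isOpen_compl.mem_nhds (by simp)
  obtain ⟨ε, hε, hsub⟩ := Metric.mem_nhds_iff.1 h3
  filter_upwards [Ioo_mem_nhdsGT hε] with δ hδ y hy hys
  have hball : y ∈ Metric.ball (0 : ℝ) ε := by
    rw [Metric.mem_ball, dist_zero_right, Real.norm_of_nonneg hy.1.le]
    exact hy.2.trans_lt hδ.2
  exact hsub hball (Finset.mem_coe.2 (Finset.mem_erase.2 ⟨hy.1.ne', hys⟩))

lemma eventually_lt_sub_div_mul {a p : ℝ} (k : ℝ) (n : ℕ) (ha : a < p) :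
    ∀ᶠ δ in 𝓝[>] (0 : ℝ), a < p - δ / k * (p + n) := by
  have h : Tendsto (fun δ : ℝ => p - δ / k * (p + n)) (𝓝[>] 0) (𝓝 (p - 0 / k * (p + n))) :=
    Tendsto.mono_left (Continuous.tendsto (by fun_prop) _) nhdsWithin_le_nhds
  simp only [zero_div, zero_mul, sub_zero] at h
  exact h.eventually_const_lt ha

lemma isLittleO_gauge_mul (b : ℂ) {p : ℝ} (hp : 1 < p) (k : ℝ) (n : ℕ) (c : ℝ) :
    (fun w : ℂ => b * w) =o[regionFilter c] gauge p k n := by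
  have h1 := (exp_mul_rpow_isLittleO_gauge (k := k) (p := p) (a := 1) n le_rfl zero_le_one
    (by simpa using hp)).mono (regionFilter_le c)
  refine Asymptotics.IsBigO.trans_isLittleO (Asymptotics.IsBigO.of_bound ‖b‖ ?_) h1
  exact Eventually.of_forall fun w => by simp

lemma isLittleO_gauge_const (b : ℂ) {p : ℝ} (hp : 0 < p) (k : ℝ) (n : ℕ) (c : ℝ) :
    (fun _ : ℂ => b) =o[regionFilter c] gauge p k n := by
  have h1 := (exp_mul_rpow_isLittleO_gauge (k := k) (p := p) (a := 0) n le_rfl zero_le_one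
    (by simpa using hp)).mono (regionFilter_le c)
  refine Asymptotics.IsBigO.trans_isLittleO (Asymptotics.IsBigO.of_bound ‖b‖ ?_) h1
  exact Eventually.of_forall fun w => by simp

section Levy

variable {ν : Measure ℝ} {k : ℝ} {n : ℕ} {l : ℝ} {s F : Finset ℝ} {e : ℝ → ℝ}

lemma intervalIntegrable_tail (hν : IsLevyMeasure ν) {δ : ℝ} (hδ : 0 < δ) (hδk : δ ≤ k) :
    IntervalIntegrable (tail ν) volume δ k :=
  ((tail_antitoneOn hν).mono (by
    rw [uIcc_of_le hδk]; exact fun y hy => hδ.trans_le hy.1)).intervalIntegrable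

lemma boundedVariation_of_exponents (hν : IsLevyMeasure ν) (hk : SupportedExactly ν k)
    (h : RegularTail (tail ν) k n l s F e) {a : ℝ} (ha : 0 < a) (ha1 : a < 1)
    (hFa : ∀ b ∈ F, b ≤ a) : BoundedVariation ν := by
  obtain ⟨δ, ⟨h1, h2⟩, hδ⟩ := ((eventually_notMem_Ioc s).and
    (mem_nhdsWithin_of_mem_nhds (Iio_mem_nhds hk.pos))).and self_mem_nhdsWithin |>.exists
  obtain ⟨g', C, hb⟩ := h.exists_singularBound measurable_tail hδ ha h2 h1 hFa
  rw [boundedVariation_iff hν hk, ← intervalIntegrable_iff_integrableOn_Ioc_of_le hk.pos.le]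
  refine IntervalIntegrable.trans (b := δ) ?_ (intervalIntegrable_tail hν hδ (le_of_lt h2))
  have := hb.intervalIntegrable_exp hδ ha1 0
  simp only [zero_mul, Complex.exp_zero, one_mul] at this
  exact ⟨by simpa [IntegrableOn] using this.1.re, by simpa [IntegrableOn] using this.2.re⟩

lemma not_boundedVariation_of_exponent (hν : IsLevyMeasure ν) (hk : SupportedExactly ν k)
    (h : RegularTail (tail ν) k n l s F e) {α a : ℝ} (hα : α ∈ F) (ha : 1 < a) (haα : a < α)
    (hF : ∀ b ∈ F, b ≠ α → b ≤ a) : ¬ BoundedVariation ν := by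
  intro hbv
  rw [boundedVariation_iff hν hk] at hbv
  obtain ⟨δ, ⟨h1, h2⟩, hδ⟩ := ((eventually_notMem_Ioc s).and
    (mem_nhdsWithin_of_mem_nhds (Iio_mem_nhds hk.pos))).and self_mem_nhdsWithin |>.exists
  replace hδ : 0 < δ := hδ
  replace h2 : δ < k := h2
  obtain ⟨g', C, hb⟩ := h.exists_singularBound_sub measurable_tail hδ (by linarith) h2 h1 hα hF
  set M := ∫ y in Ioc 0 k, tail ν y
  have hM : ∀ y ∈ Ioc 0 δ, y * tail ν y ≤ M := by
    intro y hy
    have hyk : Ioc 0 y ⊆ Ioc 0 k := Ioc_subset_Ioc_right (hy.2.trans h2.le)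
    calc y * tail ν y = ∫ _ in Ioc 0 y, tail ν y := by
          rw [setIntegral_const, smul_eq_mul, measureReal_def, Real.volume_Ioc, sub_zero,
            ENNReal.toReal_ofReal hy.1.le]
      _ ≤ ∫ t in Ioc 0 y, tail ν t := by
          refine setIntegral_mono_on (integrableOn_const (by simp)) (hbv.mono_set hyk)
            measurableSet_Ioc fun t ht => ?_
          exact tail_antitoneOn hν ht.1 hy.1 ht.2
      _ ≤ M := setIntegral_mono_set hbv (ae_of_all _ fun y => tail_nonneg y)
          hyk.eventuallyLE
  have hlim : ∀ r : ℝ, 0 < r → Tendsto (fun y : ℝ => y ^ r) (𝓝[>] 0) (𝓝 0) := by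
    intro r hr
    have := (Real.continuousAt_rpow_const 0 r (Or.inr hr.le)).tendsto
    rw [Real.zero_rpow hr.ne'] at this
    exact this.mono_left nhdsWithin_le_nhds
  have hle : ∀ y ∈ Ioc 0 δ, |e α| ≤ M * y ^ (α - 1) + C * y ^ (α - a) := by
    intro y hy
    have h3 := hb.bound y hy
    have h4 := hM y hy
    have hyα : 0 < y ^ α := Real.rpow_pos_of_pos hy.1 _
    have h5 : y ^ α * y ^ (-α) = 1 := by rw [← Real.rpow_add hy.1]; simp
    have h6 : y ^ (α - a) = y ^ α * y ^ (-a) := by rw [← Real.rpow_add hy.1]; ring_nf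
    have h7 : y ^ (α - 1) * y = y ^ α := by rw [← Real.rpow_add_one hy.1.ne']; ring_nf
    have h8 : |e α| = |y ^ α * tail ν y - y ^ α * (tail ν y - e α * y ^ (-α))| := by
      congr 1
      linear_combination (-e α) * h5
    rw [h8]
    refine (abs_sub _ _).trans (add_le_add ?_ ?_)
    · rw [abs_of_nonneg (mul_nonneg hyα.le (tail_nonneg _)), ← h7]
      have : 0 ≤ y ^ (α - 1) := Real.rpow_nonneg hy.1.le _
      nlinarith
    · rw [abs_mul, abs_of_pos hyα, h6]
      nlinarith
  have h9 : Tendsto (fun y : ℝ => M * y ^ (α - 1) + C * y ^ (α - a)) (𝓝[>] 0)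
      (𝓝 (M * 0 + C * 0)) :=
    ((hlim _ (by linarith)).const_mul M).add ((hlim _ (by linarith)).const_mul C)
  rw [mul_zero, mul_zero, add_zero] at h9
  have h10 : |e α| ≤ 0 := by
    refine ge_of_tendsto h9 ?_
    filter_upwards [Ioc_mem_nhdsGT hδ] with y hy using hle y hy
  exact (h.exponent α hα).1 (abs_nonpos_iff.1 h10)

lemma laplaceExponent_split (σ μ : ℝ) (hν : IsLevyMeasure ν) (hk : SupportedExactly ν k) {δ : ℝ}
    (hδ : 0 < δ) (hδk : δ < k) (w : ℂ) :
    laplaceExponent σ μ ν (-w) = (σ : ℂ) ^ 2 / 2 * w ^ 2 - μ * w +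
      (w * (∫ t in 0..δ, (Complex.exp (w * t) - cutoff ν) * tail ν t) +
        (w * (∫ t in δ..k, Complex.exp (w * t) * tail ν t) -
          cutoff ν * (∫ t in δ..k, tail ν t : ℝ) * w)) := by
  have hi : IntervalIntegrable (fun t : ℝ => (Complex.exp (w * t) - cutoff ν) * tail ν t)
      volume 0 k := by
    rw [intervalIntegrable_iff_integrableOn_Ioc_of_le hk.pos.le]
    have hT := measurable_tail (ν := ν)
    refine (integrableOn_exp_sub_cutoff_mul_tail hν hk w).mono' (by fun_prop) (ae_of_all _ ?_)
    intro t
    rw [norm_mul, Complex.norm_real, Real.norm_of_nonneg (tail_nonneg _)]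
  have h0 : δ ∈ uIcc 0 k := by rw [uIcc_of_le hk.pos.le]; exact ⟨hδ.le, hδk.le⟩
  have hT := intervalIntegrable_tail hν hδ hδk.le
  have hT' : IntervalIntegrable (fun t => (tail ν t : ℂ)) volume δ k :=
    ⟨hT.1.ofReal, hT.2.ofReal⟩
  have h2 : ∫ t in δ..k, (Complex.exp (w * t) - cutoff ν) * (tail ν t : ℂ) =
      (∫ t in δ..k, Complex.exp (w * t) * tail ν t) - cutoff ν * (∫ t in δ..k, tail ν t : ℝ) := by
    rw [← intervalIntegral.integral_ofReal, ← intervalIntegral.integral_const_mul,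
      ← intervalIntegral.integral_sub (intervalIntegrable_exp_mul hT w) (hT'.const_mul _)]
    simp_rw [sub_mul]
  rw [laplaceExponent_neg σ μ hν hk, ← intervalIntegral.integral_add_adjacent_intervals
    (hi.mono_set (uIcc_subset_uIcc_left h0)) (hi.mono_set (uIcc_subset_uIcc_right h0)), h2]
  ring

lemma mem_slitPlane_of_region {c : ℝ} {w : ℂ} (hw : w ∈ region c) (hwn : |c| + 1 ≤ ‖w‖) :
    w ∈ Complex.slitPlane := by
  by_cases him : w.im = 0
  · left
    have h1 : ‖w‖ = |w.re| := by
      conv_lhs => rw [← Complex.re_add_im w, him]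
      simp
    rw [h1] at hwn
    by_contra! h0
    rw [abs_of_nonpos h0] at hwn
    linarith [hw.1, le_abs_self c]
  · exact Or.inr him

/-- Asymptotics of the Laplace exponent at infinity, in the left half-plane. -/
theorem exists_laplaceExponent_asymptotic {σ μ : ℝ} (hσ : 0 ≤ σ) (hν : IsLevyMeasure ν)
    (hk : SupportedExactly ν k) (hmono : 0 < σ ∨ ¬ BoundedVariation ν ∨ 0 < μ)
    (hreg : IsRegular ν k) {c : ℝ} (hc : 0 ≤ c) (q : ℝ) :
    ∃ (A B : ℂ) (p : ℝ) (n : ℕ), A ≠ 0 ∧ B ≠ 0 ∧ 1 ≤ p ∧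
      (fun w : ℂ => (laplaceExponent σ μ ν (-w) - q) -
        (A * w ^ (p : ℂ) + B * (Complex.exp (k * w) / w ^ n))) =o[regionFilter c] gauge p k n := by
  obtain ⟨n, l, s, F, e, h⟩ := hreg.exists_regularTail
  have hTm := measurable_tail (ν := ν)
  have hT0 : ∀ y, k ≤ y → tail ν y = 0 := fun y hy => tail_eq_zero hk hy
  have hB : (-1 : ℂ) ^ n * l ≠ 0 :=
    mul_ne_zero (pow_ne_zero _ (by norm_num)) (Complex.ofReal_ne_zero.2 h.ne_zero)
  -- it is enough to treat the part of the integral near the origin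
  have key : ∀ p : ℝ, 1 ≤ p → (∀ᶠ δ in 𝓝[>] (0 : ℝ), ∃ A : ℂ, A ≠ 0 ∧
      (fun w : ℂ => (σ : ℂ) ^ 2 / 2 * w ^ 2 - μ * w +
        (w * (∫ t in 0..δ, (Complex.exp (w * t) - cutoff ν) * tail ν t) -
          cutoff ν * (∫ t in δ..k, tail ν t : ℝ) * w) - A * w ^ (p : ℂ))
        =o[regionFilter c] gauge p k n) →
      ∃ (A B : ℂ) (p : ℝ) (n : ℕ), A ≠ 0 ∧ B ≠ 0 ∧ 1 ≤ p ∧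
        (fun w : ℂ => (laplaceExponent σ μ ν (-w) - q) -
          (A * w ^ (p : ℂ) + B * (Complex.exp (k * w) / w ^ n)))
          =o[regionFilter c] gauge p k n := by
    intro p hp hev
    obtain ⟨δ, ⟨⟨⟨A, hA, h1⟩, h2⟩, h3⟩, hδ⟩ := (((hev.and (mem_nhdsWithin_of_mem_nhds
      (Iio_mem_nhds hk.pos))).and (eventually_lt_sub_div_mul k n (by linarith : 0 < p))).and
      self_mem_nhdsWithin).exists
    have h4 := h.integral_asymptotic hTm hT0 hδ h2 hc (by linarith) h3
    refine ⟨A, (-1) ^ n * l, p, n, hA, hB, hp, ?_⟩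
    refine ((h1.add h4).sub (isLittleO_gauge_const (q : ℂ) (by linarith) k n c)).congr_left
      fun w => ?_
    rw [laplaceExponent_split σ μ hν hk hδ h2]
    ring
  have hbound : ∀ a p δ : ℝ, 0 < δ → δ < k → a < p → a < p - δ / k * (p + n) →
      ∀ (C : ℝ) (G : ℂ → ℂ), (∀ w : ℂ, 1 / δ < ‖w‖ →
        ‖G w‖ ≤ C * (‖w‖ ^ a * (1 + Real.exp (w.re * δ)))) →
      G =o[regionFilter c] gauge p k n := fun a p δ hδ hδk hap hapδ C G hG =>
    isLittleO_gauge_of_bound n hk.pos hδ hδk.le hapδ hap fun w _ hw => hG w hw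
  have hcpow2 : ∀ w : ℂ, w ^ ((2 : ℝ) : ℂ) = w ^ 2 := fun w => by
    rw [Complex.ofReal_ofNat, Complex.cpow_ofNat]
  have hlt : ∀ᶠ δ in 𝓝[>] (0 : ℝ), δ < k :=
    mem_nhdsWithin_of_mem_nhds (Iio_mem_nhds hk.pos)
  by_cases hF : ∀ b ∈ F, b < 1
  · obtain ⟨a, ha0, ha1, hFa⟩ : ∃ a : ℝ, 0 < a ∧ a < 1 ∧ ∀ b ∈ F, b ≤ a := by
      have hne : (insert (1 / 2 : ℝ) F).Nonempty := Finset.insert_nonempty _ _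
      refine ⟨(insert (1 / 2 : ℝ) F).max' hne, ?_, ?_, fun b hb =>
        Finset.le_max' _ _ (Finset.mem_insert_of_mem hb)⟩
      · exact lt_of_lt_of_le (by norm_num) (Finset.le_max' _ _ (Finset.mem_insert_self _ _))
      · rw [Finset.max'_lt_iff]
        intro b hb
        rcases Finset.mem_insert.1 hb with rfl | hb
        · norm_num
        · exact hF b hb
    have hbv := boundedVariation_of_exponents hν hk h ha0 ha1 hFa
    have hsmall : ∀ p : ℝ, 1 ≤ p → ∀ᶠ δ in 𝓝[>] (0 : ℝ),
        (fun w : ℂ => w * (∫ t in 0..δ, Complex.exp (w * t) * tail ν t))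
          =o[regionFilter c] gauge p k n := by
      intro p hp
      filter_upwards [eventually_notMem_Ioc s, hlt, self_mem_nhdsWithin,
        eventually_lt_sub_div_mul k n (by linarith : a < p)] with δ h1 h2 hδ h3
      obtain ⟨g', C, hb⟩ := h.exists_singularBound hTm hδ ha0 h2 h1 hFa
      obtain ⟨C', -, hC'⟩ := hb.exists_norm_integral_exp_le ha0 ha1 hδ
      exact hbound a p δ hδ h2 (by linarith) h3 C' _ hC'
    rcases hσ.eq_or_lt with hσ0 | hσ0
    · have hμ : 0 < μ := by
        rcases hmono with h | h | h
        · exact absurd hσ0 h.ne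
        · exact absurd hbv h
        · exact h
      refine key 1 le_rfl ?_
      filter_upwards [hsmall 1 le_rfl] with δ h1
      refine ⟨-μ, by simpa using hμ.ne', ?_⟩
      refine h1.congr_left fun w => ?_
      simp [cutoff_of_bv hbv, ← hσ0]
    · refine key 2 one_le_two ?_
      filter_upwards [hsmall 2 one_le_two] with δ h1
      refine ⟨(σ : ℂ) ^ 2 / 2, by simpa using hσ0.ne', ?_⟩
      refine (h1.add (isLittleO_gauge_mul (-μ : ℂ) one_lt_two k n c)).congr_left fun w => ?_
      rw [hcpow2]
      simp [cutoff_of_bv hbv]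
      ring
  · push Not at hF
    obtain ⟨b₀, hb₀, hb₀1⟩ := hF
    have hne : F.Nonempty := ⟨b₀, hb₀⟩
    set α := F.max' hne with hα
    have hαF : α ∈ F := F.max'_mem hne
    have hα1 : 1 < α := lt_of_le_of_ne (hb₀1.trans (F.le_max' b₀ hb₀))
      (Ne.symm (h.exponent α hαF).2.2)
    have hα2 : α < 2 := (h.exponent α hαF).2.1
    obtain ⟨a, ha1, haα, hFa⟩ : ∃ a : ℝ, 1 < a ∧ a < α ∧ ∀ b ∈ F, b ≠ α → b ≤ a := by
      classical
      have hne : (insert ((1 + α) / 2) (F.erase α)).Nonempty := Finset.insert_nonempty _ _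
      refine ⟨(insert ((1 + α) / 2) (F.erase α)).max' hne, ?_, ?_, fun b hb hbα =>
        Finset.le_max' _ _ (Finset.mem_insert_of_mem (Finset.mem_erase.2 ⟨hbα, hb⟩))⟩
      · exact lt_of_lt_of_le (by linarith) (Finset.le_max' _ _ (Finset.mem_insert_self _ _))
      · rw [Finset.max'_lt_iff]
        intro b hb
        rcases Finset.mem_insert.1 hb with rfl | hb
        · linarith
        · exact lt_of_le_of_ne (F.le_max' b (Finset.mem_of_mem_erase hb))
            (Finset.ne_of_mem_erase hb)
    have hbv := not_boundedVariation_of_exponent hν hk h hαF ha1 haα hFa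
    rcases hσ.eq_or_lt with hσ0 | hσ0
    · -- the leading power dominates
      refine key α hα1.le ?_
      filter_upwards [eventually_notMem_Ioc s, hlt, self_mem_nhdsWithin,
        eventually_lt_sub_div_mul k n haα, eventually_lt_sub_div_mul k n hα1]
        with δ h1 h2 hδ h3 h3'
      replace hδ : 0 < δ := hδ
      obtain ⟨g', C, hb⟩ := h.exists_singularBound_sub hTm hδ (by linarith : 0 < a) h2 h1 hαF hFa
      obtain ⟨C', -, hC'⟩ := hb.exists_norm_integral_exp_sub_one_le ha1 (haα.trans hα2) hδ
      have h4 := hbound a α δ hδ h2 haα h3 C' _ hC'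
      obtain ⟨K, hK, C₂, hC₂⟩ := exists_mul_powerIntegral_bound hδ hα1 hα2
      obtain ⟨R, hR⟩ : ∃ R : ℝ, ∀ w : ℂ, w ∈ region c → R < ‖w‖ → w ∈ Complex.slitPlane := by
        refine ⟨|c| + 1, fun w hw hwn => mem_slitPlane_of_region hw hwn.le⟩
      have h5 : (fun w : ℂ => w * powerIntegral δ α w - K * w ^ (α : ℂ))
          =o[regionFilter c] gauge α k n :=
        isLittleO_gauge_of_bound n hk.pos hδ h2.le h3' hα1 fun w hw hwn =>
          hC₂ w (hR w hw hwn) hw.2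
      refine ⟨e α * K, mul_ne_zero (Complex.ofReal_ne_zero.2 (h.exponent α hαF).1) hK, ?_⟩
      have h6 : ∀ w : ℂ, ∫ t in 0..δ, (Complex.exp (w * t) - cutoff ν) * tail ν t =
          (∫ t in 0..δ, (Complex.exp (w * t) - 1) * (tail ν t - e α * t ^ (-α) : ℝ)) +
            e α * powerIntegral δ α w := by
        intro w
        rw [powerIntegral, ← intervalIntegral.integral_const_mul,
          ← intervalIntegral.integral_add (hb.intervalIntegrable_exp_sub_one hδ (haα.trans hα2) w)
          ((intervalIntegrable_powerIntegral hδ hα2 w).const_mul _)]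
        congr 1
        ext t
        rw [cutoff_of_not_bv hbv]
        push_cast
        ring
      have h7 := (h4.add (h5.const_mul_left (e α : ℂ)))
      refine (h7.add (isLittleO_gauge_mul
        (-(μ + cutoff ν * (∫ t in δ..k, tail ν t : ℝ)) : ℂ) hα1 k n c)).congr_left fun w => ?_
      simp only [← hσ0, Complex.ofReal_zero, h6]
      ring
    · refine key 2 one_le_two ?_
      filter_upwards [eventually_notMem_Ioc s, hlt, self_mem_nhdsWithin,
        eventually_lt_sub_div_mul k n hα2] with δ h1 h2 hδ h3
      obtain ⟨g', C, hb⟩ := h.exists_singularBound hTm hδ (by linarith : 0 < α) h2 h1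
        (fun b hb => F.le_max' b hb)
      obtain ⟨C', -, hC'⟩ := hb.exists_norm_integral_exp_sub_one_le hα1 hα2 hδ
      have h4 := hbound α 2 δ hδ h2 hα2 h3 C' _ hC'
      refine ⟨(σ : ℂ) ^ 2 / 2, by simpa using hσ0.ne', ?_⟩
      refine (h4.add (isLittleO_gauge_mul
        (-(μ + cutoff ν * (∫ t in δ..k, tail ν t : ℝ)) : ℂ) one_lt_two k n c)).congr_left
        fun w => ?_
      rw [hcpow2, cutoff_of_not_bv hbv, Complex.ofReal_one]
      ring

end Levy

/-- The exponent of the ratio of the two leading terms. -/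
noncomputable def phase (k m : ℝ) (β w : ℂ) : ℂ := k * w - m * Complex.log w + β

lemma phase_re (k m : ℝ) (β w : ℂ) :
    (phase k m β w).re = k * w.re - m * Real.log ‖w‖ + β.re := by
  simp [phase, Complex.log_re]

lemma phase_im (k m : ℝ) (β w : ℂ) :
    (phase k m β w).im = k * w.im - m * w.arg + β.im := by
  simp [phase, Complex.log_im]

/-- `f w ~ A w ^ p (1 + e ^ phase)` at infinity. -/
structure ExpPowerAsymptotic (f : ℂ → ℂ) (A β : ℂ) (p m k c : ℝ) : Prop where
  differentiable : Differentiable ℂ f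
  ne_zero : A ≠ 0
  one_le : 1 ≤ p
  pos_m : 0 < m
  pos_k : 0 < k
  nonneg : 0 ≤ c
  bound : ∀ ε > 0, ∃ R, ∀ w ∈ region c, R ≤ ‖w‖ →
    ‖f w / (A * w ^ (p : ℂ)) - (1 + Complex.exp (phase k m β w))‖ ≤
      ε * (1 + ‖Complex.exp (phase k m β w)‖)

lemma exists_expPowerAsymptotic {f : ℂ → ℂ} (hf : Differentiable ℂ f) {A B : ℂ} {p k c : ℝ} {n : ℕ}
    (hA : A ≠ 0) (hB : B ≠ 0) (hp : 1 ≤ p) (hk : 0 < k) (hc : 0 ≤ c)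
    (h : (fun w => f w - (A * w ^ (p : ℂ) + B * (Complex.exp (k * w) / w ^ n)))
      =o[regionFilter c] gauge p k n) :
    ∃ β, ExpPowerAsymptotic f A β p (p + n) k c := by
  refine ⟨Complex.log (B / A), hf, hA, hp, by positivity, hk, hc, fun ε hε => ?_⟩
  set D := min 1 (‖B‖ / ‖A‖) with hD
  have hA' : 0 < ‖A‖ := norm_pos_iff.2 hA
  have hB' : 0 < ‖B‖ := norm_pos_iff.2 hB
  have hD0 : 0 < D := lt_min one_pos (by positivity)
  have h1 := (h.def (show 0 < ε * ‖A‖ * D by positivity)).and (eventually_norm_ge c 1)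
  rw [regionFilter, eventually_inf_principal, ← comap_norm_atTop, eventually_comap] at h1
  obtain ⟨R, hR⟩ := eventually_atTop.1 h1
  refine ⟨R, fun w hw hwR => ?_⟩
  obtain ⟨h2, h3⟩ := hR ‖w‖ hwR w rfl hw
  have hw0 : w ≠ 0 := norm_pos_iff.1 (by linarith)
  have hwp : A * w ^ (p : ℂ) ≠ 0 := mul_ne_zero hA (by simp [Complex.cpow_eq_zero_iff, hw0])
  have hphase : A * w ^ (p : ℂ) * Complex.exp (phase k (p + n) (Complex.log (B / A)) w) =
      B * (Complex.exp (k * w) / w ^ n) := by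
    have e1 : w ^ (p : ℂ) = Complex.exp (Complex.log w * p) := Complex.cpow_def_of_ne_zero hw0 _
    have e2 : w ^ n = Complex.exp (n * Complex.log w) := by
      rw [Complex.exp_nat_mul, Complex.exp_log hw0]
    have e3 : Complex.exp (phase k (p + n) (Complex.log (B / A)) w) =
        Complex.exp (k * w) / (Complex.exp (Complex.log w * p) * Complex.exp (n * Complex.log w)) *
          (B / A) := by
      rw [phase, Complex.exp_add, Complex.exp_sub, Complex.exp_log (div_ne_zero hB hA),
        ← Complex.exp_add]
      congr 3
      push_cast; ring_nf
    rw [e3, e1, e2]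
    have := Complex.exp_ne_zero (Complex.log w * p)
    have := Complex.exp_ne_zero (n * Complex.log w)
    field_simp
  have hnw : ‖A * w ^ (p : ℂ)‖ = ‖A‖ * ‖w‖ ^ p := by
    rw [norm_mul, Complex.norm_cpow_real]
  have hr : 0 < ‖w‖ ^ p := Real.rpow_pos_of_pos (by linarith) _
  set Q := Complex.exp (phase k (p + n) (Complex.log (B / A)) w) with hQ
  have hQn : ‖A‖ * ‖w‖ ^ p * ‖Q‖ = ‖B‖ * (Real.exp (k * w.re) / ‖w‖ ^ n) := by
    have := congrArg norm hphase
    rw [norm_mul, hnw, norm_mul, norm_div, norm_pow, Complex.norm_exp (k * w)] at this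
    simpa using this
  have h4 : D * gauge p k n w ≤ ‖w‖ ^ p * (1 + ‖Q‖) := by
    have e1 : D * ‖w‖ ^ p ≤ ‖w‖ ^ p := mul_le_of_le_one_left hr.le (min_le_left _ _)
    have e2 : D * (Real.exp (k * w.re) / ‖w‖ ^ n) ≤ ‖w‖ ^ p * ‖Q‖ := by
      calc _ ≤ ‖B‖ / ‖A‖ * (Real.exp (k * w.re) / ‖w‖ ^ n) := by
            gcongr; exact min_le_right _ _
        _ = ‖w‖ ^ p * ‖Q‖ := by
            rw [div_mul_eq_mul_div, ← hQn]; field_simp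
    rw [gauge, mul_add, mul_add, mul_one]; linarith
  have h5 : f w / (A * w ^ (p : ℂ)) - (1 + Q) =
      (f w - (A * w ^ (p : ℂ) + B * (Complex.exp (k * w) / w ^ n))) / (A * w ^ (p : ℂ)) := by
    rw [← hphase, eq_div_iff hwp, sub_mul, div_mul_cancel₀ _ hwp]; ring
  rw [h5, norm_div, hnw, div_le_iff₀ (by positivity)]
  rw [Real.norm_of_nonneg (gauge_nonneg p k n w)] at h2
  calc _ ≤ ε * ‖A‖ * D * gauge p k n w := h2
    _ = ε * ‖A‖ * (D * gauge p k n w) := by ring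
    _ ≤ ε * ‖A‖ * (‖w‖ ^ p * (1 + ‖Q‖)) := by gcongr
    _ = _ := by ring

lemma exists_arg_near_pi_div_two {τ : ℝ} (hτ : 0 < τ) : ∃ τ' > 0, ∀ w : ℂ, 0 ≤ w.im → w ≠ 0 →
    |w.re| ≤ τ' * ‖w‖ → |w.arg - Real.pi / 2| ≤ τ := by
  have h := Metric.continuousAt_iff.1 (Real.continuous_arccos.continuousAt (x := 0)) τ hτ
  obtain ⟨d, hd, hd'⟩ := h
  refine ⟨d / 2, by positivity, fun w him hw hre => ?_⟩
  have hwn : 0 < ‖w‖ := norm_pos_iff.2 hw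
  rw [Complex.arg_of_im_nonneg_of_ne_zero him hw]
  have := hd' (x := w.re / ‖w‖) (by
    rw [dist_zero_right, norm_div, Real.norm_eq_abs, norm_norm, div_lt_iff₀ hwn]
    nlinarith)
  rw [Real.dist_eq, Real.arccos_zero] at this
  exact this.le

lemma eventually_log_le {m τ : ℝ} (C : ℝ) (hτ : 0 < τ) :
    ∀ᶠ r : ℝ in atTop, m * Real.log r + C ≤ τ * r := by
  have h1 : (fun r : ℝ => m * Real.log r + C) =o[atTop] (fun r : ℝ => r) :=
    (Real.isLittleO_log_id_atTop.const_mul_left m).add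
      (Asymptotics.isLittleO_const_left.2 (Or.inr (tendsto_abs_atTop_atTop)))
  filter_upwards [h1.def hτ, eventually_ge_atTop 0] with r hr hr0
  rw [Real.norm_of_nonneg hr0] at hr
  exact (le_abs_self _).trans hr

lemma norm_one_add_exp_of_cos_nonneg {E : ℂ} (h : 0 ≤ Real.cos E.im) :
    (1 + ‖Complex.exp E‖) / 3 ≤ ‖1 + Complex.exp E‖ := by
  have h1 : 1 ≤ ‖1 + Complex.exp E‖ := by
    refine le_trans ?_ (Complex.re_le_norm _)
    rw [Complex.add_re, Complex.one_re, Complex.exp_re]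
    have := mul_nonneg (Real.exp_pos E.re).le h
    linarith
  have h2 : ‖Complex.exp E‖ ≤ ‖1 + Complex.exp E‖ + 1 := by
    calc _ = ‖(1 + Complex.exp E) - 1‖ := by congr 1; ring
      _ ≤ _ := by simpa using norm_sub_le (1 + Complex.exp E) 1
  linarith

lemma norm_one_add_exp_of_abs_re {E : ℂ} (h : Real.log 2 ≤ |E.re|) :
    (1 + ‖Complex.exp E‖) / 3 ≤ ‖1 + Complex.exp E‖ := by
  have h1 : |1 - ‖Complex.exp E‖| ≤ ‖1 + Complex.exp E‖ := by
    simpa using abs_norm_sub_norm_le (1 : ℂ) (-Complex.exp E)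
  refine le_trans ?_ h1
  rw [Complex.norm_exp]
  rcases le_abs'.1 h with h | h
  · have : Real.exp E.re ≤ 2⁻¹ := by
      rw [← Real.exp_log (by norm_num : (0 : ℝ) < 2⁻¹), Real.log_inv]; exact Real.exp_le_exp.2 h
    rw [abs_of_nonneg (by linarith)]; linarith
  · have : 2 ≤ Real.exp E.re := by
      rw [← Real.log_le_iff_le_exp (by norm_num)]; exact h
    rw [abs_of_nonpos (by linarith)]; linarith

namespace ExpPowerAsymptotic

variable {f : ℂ → ℂ} {A β : ℂ} {p m k c : ℝ}

/-- Where the two leading terms are comparable, the real part is of logarithmic size. -/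
lemma comparable (h : ExpPowerAsymptotic f A β p m k c) (M M' : ℝ) {τ : ℝ} (hτ : 0 < τ) :
    ∃ R, ∀ w ∈ region c, R ≤ ‖w‖ → |(phase k m β w).re| ≤ M →
      M' ≤ w.re ∧ |w.re| ≤ τ * ‖w‖ ∧ |w.arg - Real.pi / 2| ≤ τ := by
  have hk := h.pos_k
  have hm := h.pos_m
  obtain ⟨τ', hτ', harg⟩ := exists_arg_near_pi_div_two hτ
  have h1 := eventually_log_le (m := m) (|β.re| + M) (mul_pos hk (lt_min hτ hτ'))
  have h2 : ∀ᶠ r : ℝ in atTop, (k * max M' 0 + |β.re| + M) / m ≤ Real.log r :=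
    Real.tendsto_log_atTop.eventually_ge_atTop _
  obtain ⟨R, hR⟩ := eventually_atTop.1 ((h1.and h2).and (eventually_gt_atTop 0))
  refine ⟨R, fun w hw hwR hM => ?_⟩
  obtain ⟨⟨h3, h4⟩, h5⟩ := hR _ hwR
  rw [div_le_iff₀ hm] at h4
  rw [phase_re, abs_le] at hM
  have h6 := neg_abs_le β.re
  have h7 := le_abs_self β.re
  have h8 : max M' 0 ≤ w.re := by
    refine le_of_mul_le_mul_left ?_ hk
    linarith
  have h9 : |w.re| ≤ min τ τ' * ‖w‖ := by
    rw [abs_of_nonneg ((le_max_right _ _).trans h8)]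
    refine le_of_mul_le_mul_left ?_ hk
    linarith
  exact ⟨(le_max_left _ _).trans h8, h9.trans (by gcongr; exact min_le_left _ _),
    harg w hw.2 (norm_pos_iff.1 h5) (h9.trans (by gcongr; exact min_le_right _ _))⟩

/-- A lower bound away from the zeros. -/
lemma exists_norm_ge (h : ExpPowerAsymptotic f A β p m k c) : ∃ R c₀, 0 < c₀ ∧ ∀ w ∈ region c,
    R ≤ ‖w‖ → (1 + ‖Complex.exp (phase k m β w)‖) / 3 ≤ ‖1 + Complex.exp (phase k m β w)‖ →
      c₀ * ‖w‖ ≤ ‖f w‖ := by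
  obtain ⟨R, hR⟩ := h.bound (1 / 6) (by norm_num)
  have hA : 0 < ‖A‖ := norm_pos_iff.2 h.ne_zero
  refine ⟨max R 1, ‖A‖ / 6, by positivity, fun w hw hwR hE => ?_⟩
  have h1 := hR w hw ((le_max_left _ _).trans hwR)
  have hw1 : 1 ≤ ‖w‖ := (le_max_right _ _).trans hwR
  set Q := Complex.exp (phase k m β w)
  have h2 : ‖1 + Q‖ ≤ ‖f w / (A * w ^ (p : ℂ))‖ + ‖f w / (A * w ^ (p : ℂ)) - (1 + Q)‖ := by
    have := norm_sub_le (f w / (A * w ^ (p : ℂ))) (f w / (A * w ^ (p : ℂ)) - (1 + Q))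
    rwa [sub_sub_cancel] at this
  have h3 : 1 / 6 ≤ ‖f w / (A * w ^ (p : ℂ))‖ := by linarith [norm_nonneg Q]
  have h4 : ‖w‖ ≤ ‖w‖ ^ p := by
    simpa using Real.rpow_le_rpow_of_exponent_le hw1 h.one_le
  have h5 : 0 < ‖w‖ ^ p := by linarith
  rw [norm_div, norm_mul, Complex.norm_cpow_real, le_div_iff₀ (by positivity)] at h3
  nlinarith

/-- Horizontal lines on which `f` is large. -/
lemma exists_horizontal (h : ExpPowerAsymptotic f A β p m k c) : ∃ (R : ℕ → ℝ) (c₀ : ℝ), 0 < c₀ ∧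
    Tendsto R atTop atTop ∧ (∀ j, 0 < R j) ∧
      ∀ j, ∀ w : ℂ, -c ≤ w.re → w.im = R j → c₀ * ‖w‖ ≤ ‖f w‖ := by
  obtain ⟨R₀, c₀, hc₀, h₀⟩ := h.exists_norm_ge
  have hk := h.pos_k
  have hm := h.pos_m
  obtain ⟨R₁, h₁⟩ := h.comparable (Real.log 2) 0 (τ := Real.pi / 2 / m) (by positivity)
  set ρ : ℕ → ℝ := fun j => (2 * Real.pi / k) * j + (m * (Real.pi / 2) - β.im) / k with hρ
  have hρt : Tendsto ρ atTop atTop :=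
    tendsto_atTop_add_const_right _ _ ((tendsto_natCast_atTop_atTop).const_mul_atTop
      (by positivity))
  obtain ⟨N, hN⟩ := eventually_atTop.1 ((hρt.eventually_ge_atTop (max R₀ R₁)).and
    (hρt.eventually_gt_atTop 0))
  refine ⟨fun j => ρ (j + N), c₀, hc₀, hρt.comp (tendsto_add_atTop_nat N),
    fun j => (hN _ (by omega)).2, fun j w hre him => ?_⟩
  replace him : w.im = ρ (j + N) := him
  obtain ⟨hj, hj0⟩ := hN (j + N) (by omega)
  have hw : w ∈ region c := ⟨hre, by rw [him]; exact hj0.le⟩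
  have hwn : max R₀ R₁ ≤ ‖w‖ := by
    rw [← him] at hj
    exact hj.trans ((le_abs_self _).trans (Complex.abs_im_le_norm w))
  refine h₀ w hw ((le_max_left _ _).trans hwn) ?_
  rcases le_total (Real.log 2) |(phase k m β w).re| with h2 | h2
  · exact norm_one_add_exp_of_abs_re h2
  · refine norm_one_add_exp_of_cos_nonneg ?_
    obtain ⟨-, -, h3⟩ := h₁ w hw ((le_max_right _ _).trans hwn) h2
    rw [phase_im, him]
    have h4 : k * ρ (j + N) - m * w.arg + β.im =
        -(m * (w.arg - Real.pi / 2)) + (j + N : ℕ) * (2 * Real.pi) := by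
      rw [hρ]; field_simp; ring
    rw [h4, Real.cos_add_nat_mul_two_pi, Real.cos_neg]
    have h5 : |m * (w.arg - Real.pi / 2)| ≤ Real.pi / 2 := by
      rw [abs_mul, abs_of_pos hm]
      calc _ ≤ m * (Real.pi / 2 / m) := by gcongr
        _ = _ := by field_simp
    exact Real.cos_nonneg_of_mem_Icc (abs_le.1 h5)

lemma exists_strip (h : ExpPowerAsymptotic f A β p m k c) (r : ℝ) : ∃ u₀, ∀ w : ℂ, u₀ ≤ w.re →
    0 ≤ w.im → w.im ≤ r → 1 ≤ ‖f w‖ := by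
  obtain ⟨R₀, c₀, hc₀, h₀⟩ := h.exists_norm_ge
  have hk := h.pos_k
  have hm := h.pos_m
  have h1 := eventually_log_le (m := m) (Real.log 2 + |β.re| + k * |r|) hk
  obtain ⟨R, hR⟩ := eventually_atTop.1 h1
  refine ⟨max (max R₀ R) (max (1 / c₀) 0), fun w hu hv0 hv => ?_⟩
  have hu1 : max R₀ R ≤ w.re := (le_max_left _ _).trans hu
  have hu2 : max (1 / c₀) 0 ≤ w.re := (le_max_right _ _).trans hu
  have hu0 : 0 ≤ w.re := (le_max_right _ _).trans hu2
  have hwn : w.re ≤ ‖w‖ := Complex.re_le_norm w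
  have hw : w ∈ region c := ⟨by linarith [h.nonneg], hv0⟩
  have h2 : ‖w‖ ≤ w.re + |r| := by
    refine (Complex.norm_le_abs_re_add_abs_im w).trans ?_
    rw [abs_of_nonneg hu0, abs_of_nonneg hv0]
    linarith [le_abs_self r]
  have h3 := hR ‖w‖ (((le_max_right _ _).trans hu1).trans hwn)
  have h4 := h₀ w hw (((le_max_left _ _).trans hu1).trans hwn) (norm_one_add_exp_of_abs_re ?_)
  · refine le_trans ?_ h4
    have h5 : 1 / c₀ ≤ ‖w‖ := ((le_max_left _ _).trans hu2).trans hwn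
    rwa [div_le_iff₀' hc₀] at h5
  · refine le_trans ?_ (le_abs_self _)
    rw [phase_re]
    have := neg_abs_le β.re
    nlinarith

lemma exists_vertical (h : ExpPowerAsymptotic f A β p m k c) : ∃ R c₀, 0 < c₀ ∧ ∀ w : ℂ,
    w.re = -c → R ≤ w.im → c₀ * ‖w‖ ≤ ‖f w‖ := by
  obtain ⟨R₀, c₀, hc₀, h₀⟩ := h.exists_norm_ge
  have hk := h.pos_k
  have hm := h.pos_m
  have h2 : ∀ᶠ r : ℝ in atTop, (Real.log 2 + |β.re|) / m ≤ Real.log r :=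
    Real.tendsto_log_atTop.eventually_ge_atTop _
  obtain ⟨R, hR⟩ := eventually_atTop.1 h2
  refine ⟨max (max R₀ R) 0, c₀, hc₀, fun w hre him => ?_⟩
  have hwn : w.im ≤ ‖w‖ := (le_abs_self _).trans (Complex.abs_im_le_norm w)
  have h3 := hR ‖w‖ ((((le_max_right _ _).trans (le_max_left _ _)).trans him).trans hwn)
  refine h₀ w ⟨hre.ge, (le_max_right _ _).trans him⟩
    ((((le_max_left _ _).trans (le_max_left _ _)).trans him).trans hwn)
    (norm_one_add_exp_of_abs_re ?_)
  refine le_trans ?_ (neg_le_abs _)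
  rw [phase_re, hre]
  rw [div_le_iff₀ hm] at h3
  have := le_abs_self β.re
  have := mul_nonneg hk.le h.nonneg
  nlinarith

end ExpPowerAsymptotic

lemma hasDerivAt_phase (k m : ℝ) (β : ℂ) {w : ℂ} (hw : w ∈ Complex.slitPlane) :
    HasDerivAt (phase k m β) (k - m / w) w := by
  have h := (((hasDerivAt_id w).const_mul (k : ℂ)).sub
    ((Complex.hasDerivAt_log hw).const_mul (m : ℂ))).add_const β
  exact h.congr_deriv (by simp [div_eq_mul_inv])

lemma abs_re_le_of_norm_one_add_exp {E : ℂ} (h : ‖1 + Complex.exp E‖ ≤ 1 / 2) :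
    |E.re| ≤ Real.log 2 := by
  have h1 : |1 - ‖Complex.exp E‖| ≤ ‖1 + Complex.exp E‖ := by
    simpa using abs_norm_sub_norm_le (1 : ℂ) (-Complex.exp E)
  rw [Complex.norm_exp] at h1
  obtain ⟨h2, h3⟩ := abs_le.1 (h1.trans h)
  rw [abs_le]
  constructor
  · rw [← Real.log_inv, Real.log_le_iff_le_exp (by norm_num)]; linarith
  · rw [Real.le_log_iff_exp_le (by norm_num)]; linarith

lemma mul_norm_sub_le_of_deriv_near {F : ℂ → ℂ} {w₀ : ℂ} {k δ : ℝ} (hk : 0 < k)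
    (hd : ∀ z ∈ Metric.closedBall w₀ δ, DifferentiableAt ℂ F z)
    (hb : ∀ z ∈ Metric.closedBall w₀ δ, ‖deriv F z + k‖ ≤ k / 2) {z z' : ℂ}
    (hz : z ∈ Metric.closedBall w₀ δ) (hz' : z' ∈ Metric.closedBall w₀ δ) :
    k / 2 * ‖z - z'‖ ≤ ‖F z - F z'‖ := by
  have e1 := (convex_closedBall w₀ δ).norm_image_sub_le_of_norm_hasDerivWithin_le
    (f := fun w => F w + k * w) (f' := fun w => deriv F w + k) (C := k / 2)
    (fun z hz => by
      have := ((hd z hz).hasDerivAt.add ((hasDerivAt_id z).const_mul (k : ℂ)))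
      simp only [mul_one] at this
      exact this.hasDerivWithinAt) hb hz' hz
  have e2 : (k : ℂ) * (z - z') = (F z + k * z - (F z' + k * z')) - (F z - F z') := by ring
  have e3 := norm_sub_le (F z + k * z - (F z' + k * z')) (F z - F z')
  rw [← e2, norm_mul, Complex.norm_real, Real.norm_of_nonneg hk.le] at e3
  linarith

namespace ExpPowerAsymptotic

variable {f : ℂ → ℂ} {A β : ℂ} {p m k c : ℝ}

/-- The quotient of `f` by the leading power is close to `1 + e ^ phase`, also infinitesimally,
where the latter is small. -/
lemma exists_local (h : ExpPowerAsymptotic f A β p m k c) : ∃ δ η R : ℝ, 0 < δ ∧ δ ≤ 1 / 4 ∧ 0 < η ∧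
    ∀ w₀ ∈ region c, R ≤ ‖w₀‖ → ‖1 + Complex.exp (phase k m β w₀)‖ ≤ η →
      1 ≤ w₀.re ∧ 1 ≤ w₀.im ∧ |(phase k m β w₀).re| ≤ Real.log 2 ∧
      (∀ w ∈ Metric.ball w₀ (2 * δ),
        DifferentiableAt ℂ (fun w => f w / (A * w ^ (p : ℂ))) w) ∧
      (∀ w ∈ Metric.closedBall w₀ δ,
        ‖deriv (fun w => f w / (A * w ^ (p : ℂ))) w + k‖ ≤ k / 2) ∧
      ‖f w₀ / (A * w₀ ^ (p : ℂ))‖ ≤ k * δ / 8 := by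
  have hk := h.pos_k
  have hm := h.pos_m
  set δ : ℝ := 1 / (64 * (k + 1)) with hδ
  have hδ0 : 0 < δ := by positivity
  have hδk : (k + 1) * δ = 1 / 64 := by rw [hδ]; field_simp
  have hδ4 : δ ≤ 1 / 64 := by rw [← hδk]; nlinarith
  obtain ⟨R₁, h₁⟩ := h.bound (k * δ / 48) (by positivity)
  obtain ⟨R₂, h₂⟩ := h.comparable (Real.log 2) 1 (τ := 1 / 2) (by norm_num)
  refine ⟨δ, min (1 / 32) (k * δ / 16), max (max R₁ R₂) (m * (8 / k + 1) * 2) + 2, hδ0,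
    by linarith, by positivity, fun w₀ hw₀ hR hη => ?_⟩
  set F : ℂ → ℂ := fun w => f w / (A * w ^ (p : ℂ)) with hF
  set E : ℂ → ℂ := phase k m β with hE
  have hη1 : ‖1 + Complex.exp (E w₀)‖ ≤ 1 / 32 := hη.trans (min_le_left _ _)
  have hη2 : ‖1 + Complex.exp (E w₀)‖ ≤ k * δ / 16 := hη.trans (min_le_right _ _)
  have hR₁ : R₁ + 2 ≤ ‖w₀‖ := by
    linarith [le_max_left (max R₁ R₂) (m * (8 / k + 1) * 2), le_max_left R₁ R₂]
  have hR₂ : R₂ ≤ ‖w₀‖ := by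
    linarith [le_max_left (max R₁ R₂) (m * (8 / k + 1) * 2), le_max_right R₁ R₂]
  have hR₃ : m * (8 / k + 1) * 2 + 2 ≤ ‖w₀‖ := by
    linarith [le_max_right (max R₁ R₂) (m * (8 / k + 1) * 2)]
  have hpos : 0 < m * (8 / k + 1) * 2 := by positivity
  have hre := abs_re_le_of_norm_one_add_exp (hη1.trans (by norm_num))
  obtain ⟨h3, h4, -⟩ := h₂ w₀ hw₀ hR₂ hre
  have him : 1 ≤ w₀.im := by
    have := Complex.norm_le_abs_re_add_abs_im w₀
    rw [abs_of_nonneg hw₀.2] at this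
    linarith
  have hball : ∀ w ∈ Metric.ball w₀ (2 * δ), w ∈ region c ∧ 0 < w.re ∧ R₁ ≤ ‖w‖ ∧
      m * (8 / k + 1) ≤ ‖w‖ := by
    intro w hw
    rw [Metric.mem_ball, dist_eq_norm] at hw
    have e1 := (Complex.abs_re_le_norm (w - w₀)).trans hw.le
    have e2 := (Complex.abs_im_le_norm (w - w₀)).trans hw.le
    rw [Complex.sub_re, abs_le] at e1
    rw [Complex.sub_im, abs_le] at e2
    have e3 : ‖w₀‖ ≤ ‖w‖ + ‖w - w₀‖ := by
      have := norm_sub_le w (w - w₀)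
      rwa [sub_sub_cancel] at this
    have hc := h.nonneg
    refine ⟨⟨?_, ?_⟩, ?_, ?_, ?_⟩ <;> linarith
  have hslit : ∀ w ∈ Metric.ball w₀ (2 * δ), w ∈ Complex.slitPlane := fun w hw =>
    Or.inl (hball w hw).2.1
  have hmw : ∀ w ∈ Metric.ball w₀ (2 * δ), ‖(m : ℂ) / w‖ ≤ 1 ∧ ‖(m : ℂ) / w‖ ≤ k / 8 := by
    intro w hw
    obtain ⟨-, -, -, h5⟩ := hball w hw
    have hw0 : 0 < ‖w‖ := lt_of_lt_of_le (by positivity) h5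
    rw [norm_div, Complex.norm_real, Real.norm_of_nonneg hm.le]
    constructor
    · rw [div_le_one hw0]
      have : 0 ≤ m * (8 / k) := by positivity
      linarith
    · rw [div_le_iff₀ hw0]
      have : k / 8 * (m * (8 / k)) = m := by field_simp
      nlinarith
  have hEd : ∀ w ∈ Metric.ball w₀ (2 * δ), HasDerivAt E (k - m / w) w := fun w hw =>
    hasDerivAt_phase k m β (hslit w hw)
  have hw₀b : w₀ ∈ Metric.ball w₀ (2 * δ) := Metric.mem_ball_self (by positivity)
  have hQ : ∀ w ∈ Metric.ball w₀ (2 * δ), ‖1 + Complex.exp (E w)‖ ≤ 1 / 8 := by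
    intro w hw
    have e1 : ‖E w - E w₀‖ ≤ (k + 1) * ‖w - w₀‖ := by
      refine (convex_ball w₀ (2 * δ)).norm_image_sub_le_of_norm_hasDerivWithin_le
        (fun z hz => (hEd z hz).hasDerivWithinAt) (fun z hz => ?_) hw₀b hw
      refine (norm_sub_le _ _).trans (add_le_add ?_ (hmw z hz).1)
      rw [Complex.norm_real, Real.norm_of_nonneg hk.le]
    have e2 : ‖E w - E w₀‖ ≤ 1 / 32 := by
      rw [Metric.mem_ball, dist_eq_norm] at hw
      nlinarith
    have e3 := Complex.norm_exp_sub_one_le (e2.trans (by norm_num))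
    have e4 : 1 + Complex.exp (E w) = (1 + Complex.exp (E w₀)) +
        ((1 + Complex.exp (E w₀)) - 1) * (Complex.exp (E w - E w₀) - 1) := by
      rw [Complex.exp_sub]; field_simp [Complex.exp_ne_zero]; ring
    rw [e4]
    refine (norm_add_le _ _).trans ?_
    rw [norm_mul]
    have e5 := norm_sub_le (1 + Complex.exp (E w₀)) 1
    rw [norm_one] at e5
    have : ‖1 + Complex.exp (E w₀) - 1‖ * ‖Complex.exp (E w - E w₀) - 1‖ ≤
        (1 + 1 / 32) * (1 / 16) := by gcongr <;> linarith
    linarith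
  have hQ' : ∀ w ∈ Metric.ball w₀ (2 * δ), ‖Complex.exp (E w)‖ ≤ 9 / 8 := by
    intro w hw
    have := norm_sub_le (1 + Complex.exp (E w)) 1
    rw [add_sub_cancel_left, norm_one] at this
    linarith [hQ w hw]
  have hρ : ∀ w ∈ Metric.ball w₀ (2 * δ),
      ‖F w - (1 + Complex.exp (E w))‖ ≤ k * δ / 16 := by
    intro w hw
    refine (h₁ w (hball w hw).1 (hball w hw).2.2.1).trans ?_
    have := hQ' w hw
    have : 0 < k * δ := by positivity
    nlinarith
  have hFd : ∀ w ∈ Metric.ball w₀ (2 * δ), DifferentiableAt ℂ F w := by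
    intro w hw
    have hw0 : w ≠ 0 := Complex.slitPlane_ne_zero (hslit w hw)
    refine (h.differentiable w).div ((differentiableAt_id.cpow_const (hslit w hw)).const_mul A)
      (mul_ne_zero h.ne_zero (by simp [Complex.cpow_eq_zero_iff, hw0]))
  refine ⟨h3, him, hre, hFd, fun w hw => ?_, ?_⟩
  · have hwb : w ∈ Metric.ball w₀ (2 * δ) :=
      Metric.closedBall_subset_ball (by linarith) hw
    have hsub : Metric.closedBall w (δ / 2) ⊆ Metric.ball w₀ (2 * δ) := by
      intro z hz
      rw [Metric.mem_closedBall] at hz hw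
      exact (dist_triangle z w w₀).trans_lt (by linarith)
    set ρ : ℂ → ℂ := fun w => F w - (1 + Complex.exp (E w)) with hρdef
    have hρd : ∀ z ∈ Metric.ball w₀ (2 * δ),
        HasDerivAt ρ (deriv F z - Complex.exp (E z) * (k - m / z)) z := fun z hz => by
      exact (hFd z hz).hasDerivAt.sub ((hEd z hz).cexp.const_add 1)
    have e1 : ‖deriv ρ w‖ ≤ k * δ / 16 / (δ / 2) := by
      refine Complex.norm_deriv_le_of_forall_mem_sphere_norm_le (by positivity) ?_ fun z hz =>
        hρ z (hsub (Metric.sphere_subset_closedBall hz))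
      refine DifferentiableOn.diffContOnCl fun z hz => ?_
      rw [closure_ball _ (by positivity)] at hz
      exact (hρd z (hsub hz)).differentiableAt.differentiableWithinAt
    have e1' : k * δ / 16 / (δ / 2) = k / 8 := by field_simp; norm_num
    rw [(hρd w hwb).deriv, e1'] at e1
    have e2 : deriv F w + k = (deriv F w - Complex.exp (E w) * (k - m / w)) +
        (k * (1 + Complex.exp (E w)) - Complex.exp (E w) * (m / w)) := by ring
    rw [e2]
    refine (norm_add_le _ _).trans ?_
    have e3 := norm_sub_le (k * (1 + Complex.exp (E w))) (Complex.exp (E w) * (m / w))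
    rw [norm_mul, norm_mul, Complex.norm_real, Real.norm_of_nonneg hk.le] at e3
    have e4 := mul_le_mul_of_nonneg_left (hQ w hwb) hk.le
    have e5 : ‖Complex.exp (E w)‖ * ‖(m : ℂ) / w‖ ≤ 9 / 8 * (k / 8) := by
      gcongr
      · exact hQ' w hwb
      · exact (hmw w hwb).2
    linarith
  · have e1 := hρ w₀ hw₀b
    have e2 := norm_add_le (F w₀ - (1 + Complex.exp (E w₀))) (1 + Complex.exp (E w₀))
    rw [sub_add_cancel] at e2
    linarith

lemma exists_norm_one_add_exp_le_of_eq_zero (h : ExpPowerAsymptotic f A β p m k c) {η : ℝ}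
    (hη : 0 < η) : ∃ R, ∀ w ∈ region c, R ≤ ‖w‖ → f w = 0 →
      ‖1 + Complex.exp (phase k m β w)‖ ≤ η := by
  obtain ⟨R, hR⟩ := h.bound (min (1 / 2) (η / 4)) (by positivity)
  refine ⟨R, fun w hw hwR hfw => ?_⟩
  have h1 := hR w hw hwR
  rw [hfw, zero_div, zero_sub, norm_neg] at h1
  set Q := Complex.exp (phase k m β w)
  have h2 := norm_sub_le (1 + Q) 1
  rw [add_sub_cancel_left, norm_one] at h2
  have h3 : 0 < min (1 / 2) (η / 4) := by positivity
  have h4 := min_le_left (1 / 2) (η / 4)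
  have h5 := min_le_right (1 / 2) (η / 4)
  nlinarith [norm_nonneg (1 + Q)]

lemma exists_abs_im_ge (h : ExpPowerAsymptotic f A β p m k c) (v : ℝ) :
    ∃ z : ℂ, v ≤ z.im ∧ 0 < z.re ∧ f z = 0 := by
  have hk := h.pos_k
  have hm := h.pos_m
  obtain ⟨δ, η, R, hδ, hδ4, hη, hloc⟩ := h.exists_local
  -- approximate zeros
  set V : ℕ → ℝ := fun j => (2 * Real.pi / k) * j + (m * (Real.pi / 2) - β.im + Real.pi) / k with hV
  have hVt : Tendsto V atTop atTop :=
    tendsto_atTop_add_const_right _ _ ((tendsto_natCast_atTop_atTop).const_mul_atTop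
      (by positivity))
  set w : ℝ → ℂ := fun v => ((m * Real.log v - β.re) / k : ℝ) + v * Complex.I with hw
  have hwre : ∀ v, (w v).re = (m * Real.log v - β.re) / k := fun v => by simp [hw]
  have hwim : ∀ v, (w v).im = v := fun v => by simp [hw]
  have hratio : Tendsto (fun v : ℝ => (m * Real.log v - β.re) / k / v) atTop (𝓝 0) := by
    have h0 : (fun _ : ℝ => β.re) =o[atTop] (id : ℝ → ℝ) :=
      Asymptotics.isLittleO_const_left.2 (Or.inr tendsto_abs_atTop_atTop)
    have h1 : (fun r : ℝ => (m * Real.log r - β.re) / k) =o[atTop] (fun r : ℝ => r) := by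
      refine (((Real.isLittleO_log_id_atTop.const_mul_left m).sub h0).const_mul_left
        k⁻¹).congr_left fun r => ?_
      rw [div_eq_inv_mul]
    exact h1.tendsto_div_nhds_zero
  have hlim : Tendsto (fun v : ℝ => -(m * Complex.log (1 - ((m * Real.log v - β.re) / k / v : ℝ) *
      Complex.I))) atTop (𝓝 0) := by
    have h1 : Tendsto (fun t : ℝ => -(m * Complex.log (1 - t * Complex.I))) (𝓝 0)
        (𝓝 (-(m * Complex.log (1 - (0 : ℝ) * Complex.I)))) := by
      refine ContinuousAt.tendsto (f := fun t : ℝ => -(m * Complex.log (1 - t * Complex.I))) ?_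
      refine ((ContinuousAt.clog (by fun_prop) ?_).const_mul _).neg
      simp
    simp only [Complex.ofReal_zero, zero_mul, sub_zero, Complex.log_one, mul_zero, neg_zero] at h1
    exact h1.comp hratio
  have hphase : ∀ j, 0 < V j → phase k m β (w (V j)) =
      -(m * Complex.log (1 - ((m * Real.log (V j) - β.re) / k / V j : ℝ) * Complex.I)) +
        ((2 * Real.pi * Complex.I) * j + Real.pi * Complex.I) := by
    intro j hj
    have e1 : w (V j) = (V j : ℂ) * (Complex.I *
        (1 - ((m * Real.log (V j) - β.re) / k / V j : ℝ) * Complex.I)) := by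
      have : (V j : ℂ) ≠ 0 := Complex.ofReal_ne_zero.2 hj.ne'
      rw [hw]
      push_cast
      field_simp
      linear_combination (m * (Real.log (V j) : ℂ) - β.re) / k * Complex.I_sq
    have hne : 1 - ((m * Real.log (V j) - β.re) / k / V j : ℝ) * Complex.I ≠ 0 := by
      intro h0
      have := congrArg Complex.re h0
      simp at this
    have e2 : Complex.log (w (V j)) = Real.log (V j) + (Real.pi / 2 * Complex.I +
        Complex.log (1 - ((m * Real.log (V j) - β.re) / k / V j : ℝ) * Complex.I)) := by
      rw [e1, Complex.log_ofReal_mul hj (mul_ne_zero Complex.I_ne_zero hne),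
        Complex.log_mul Complex.I_ne_zero hne ?_, Complex.log_I]
      have h1 : |Complex.arg (1 - ((m * Real.log (V j) - β.re) / k / V j : ℝ) * Complex.I)| ≤
          Real.pi / 2 := by
        rw [Complex.abs_arg_le_pi_div_two_iff]; simp
      have h2 := Real.pi_pos
      rw [abs_le] at h1
      rw [Complex.arg_I]
      constructor <;> linarith
    rw [phase, e2, hw, hV]
    push_cast
    have hk' : (k : ℂ) ≠ 0 := Complex.ofReal_ne_zero.2 hk.ne'
    have hβ := Complex.re_add_im β
    field_simp
    linear_combination (-2 : ℂ) * hβ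
  have hexp : Tendsto (fun j => 1 + Complex.exp (phase k m β (w (V j)))) atTop (𝓝 0) := by
    have h1 := (Complex.continuous_exp.tendsto 0).comp (hlim.comp hVt)
    rw [Complex.exp_zero] at h1
    have h2 := h1.const_sub 1
    rw [sub_self] at h2
    refine h2.congr' ?_
    filter_upwards [hVt.eventually_gt_atTop 0] with j hj
    rw [hphase j hj, Complex.exp_add, Complex.exp_add, Complex.exp_pi_mul_I,
      mul_comm (2 * Real.pi * Complex.I) (j : ℂ), Complex.exp_nat_mul_two_pi_mul_I]
    simp only [Function.comp]
    ring
  have hlogV := Real.tendsto_log_atTop.comp hVt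
  obtain ⟨j, ⟨⟨hj1, hj2⟩, hj3⟩⟩ := ((hVt.eventually_ge_atTop (max (max R (v + 1)) 0)).and
    (hlogV.eventually_ge_atTop (β.re / m))).and
    ((tendsto_zero_iff_norm_tendsto_zero.1 hexp).eventually_le_const hη) |>.exists
  have hV0 : 0 ≤ V j := (le_max_right _ _).trans hj1
  have hVR : R ≤ V j := ((le_max_left _ _).trans (le_max_left _ _)).trans hj1
  have hVv : v + 1 ≤ V j := ((le_max_right _ _).trans (le_max_left _ _)).trans hj1
  have hreg : w (V j) ∈ region c := by
    refine ⟨?_, by rw [hwim]; exact hV0⟩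
    rw [hwre]
    rw [div_le_iff₀ hm] at hj2
    have : 0 ≤ (m * Real.log (V j) - β.re) / k := by
      refine div_nonneg ?_ hk.le
      simp only [Function.comp] at hj2
      linarith
    linarith [h.nonneg]
  have hnorm : V j ≤ ‖w (V j)‖ := by
    have := Complex.abs_im_le_norm (w (V j))
    rw [hwim] at this
    exact (le_abs_self _).trans this
  obtain ⟨h1, h2, -, h3, h4, h5⟩ := hloc _ hreg (hVR.trans hnorm) hj3
  set w₀ := w (V j)
  set F : ℂ → ℂ := fun w => f w / (A * w ^ (p : ℂ)) with hF
  have hsub : Metric.closedBall w₀ δ ⊆ Metric.ball w₀ (2 * δ) :=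
    Metric.closedBall_subset_ball (by linarith)
  have hw₀b : w₀ ∈ Metric.closedBall w₀ δ := Metric.mem_closedBall_self hδ.le
  have hlow : ∀ z ∈ Metric.closedBall w₀ δ, k / 2 * ‖z - w₀‖ ≤ ‖F z - F w₀‖ := fun z hz =>
    mul_norm_sub_le_of_deriv_near hk (fun z hz => h3 z (hsub hz)) h4 hz hw₀b
  have hdc : DiffContOnCl ℂ F (Metric.ball w₀ δ) := by
    refine DifferentiableOn.diffContOnCl fun z hz => ?_
    rw [closure_ball _ hδ.ne'] at hz
    exact (h3 z (hsub hz)).differentiableWithinAt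
  have hfreq : ∃ᶠ z in 𝓝 w₀, F z ≠ F w₀ := by
    have e1 : ∀ᶠ z in 𝓝[≠] w₀, F z ≠ F w₀ := by
      filter_upwards [self_mem_nhdsWithin,
        nhdsWithin_le_nhds (Metric.closedBall_mem_nhds w₀ hδ)] with z hz hzb h0
      have := hlow z hzb
      rw [h0, sub_self, norm_zero] at this
      have h6 : 0 < ‖z - w₀‖ := norm_pos_iff.2 (sub_ne_zero.2 hz)
      nlinarith
    exact e1.frequently.filter_mono nhdsWithin_le_nhds
  have himg := hdc.ball_subset_image_closedBall (ε := k / 2 * δ) hδ (fun z hz => by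
    have := hlow z (Metric.sphere_subset_closedBall hz)
    rwa [mem_sphere_iff_norm.1 hz] at this) hfreq
  obtain ⟨z, hz, hz0⟩ := himg (show (0 : ℂ) ∈ Metric.ball (F w₀) (k / 2 * δ / 2) by
    rw [Metric.mem_ball, dist_zero_left]
    have : 0 < k * δ := by positivity
    linarith)
  rw [Metric.mem_closedBall, dist_eq_norm] at hz
  have e1 := (Complex.abs_re_le_norm (z - w₀)).trans hz
  have e2 := (Complex.abs_im_le_norm (z - w₀)).trans hz
  rw [Complex.sub_re, abs_le] at e1
  rw [Complex.sub_im, abs_le, hwim] at e2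
  have hzre : 0 < z.re := by linarith
  refine ⟨z, by linarith, hzre, ?_⟩
  have hz' : z ≠ 0 := by rintro rfl; simp at hzre
  have hne : A * z ^ (p : ℂ) ≠ 0 :=
    mul_ne_zero h.ne_zero (by simp [Complex.cpow_eq_zero_iff, hz'])
  exact (div_eq_zero_iff.1 hz0).resolve_right hne

end ExpPowerAsymptotic

lemma finite_zeros_inter {f : ℂ → ℂ} (hf : Differentiable ℂ f) (hne : ∃ w, f w ≠ 0) (r : ℝ) :
    ({w | f w = 0} ∩ Metric.closedBall 0 r).Finite := by
  obtain ⟨w, hw⟩ := hne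
  have h1 : AnalyticOnNhd ℂ f univ := fun z _ => hf.analyticAt z
  have h2 := h1.preimage_zero_mem_codiscrete hw
  refine ((isCompact_closedBall (0 : ℂ) r).finite_sdiff_of_mem_codiscreteWithin
    (codiscreteWithin_mono (subset_univ _) h2)).subset ?_
  rintro z ⟨hz, hzr⟩
  exact ⟨hzr, fun h => h hz⟩

lemma abs_re_le_two_mul_norm_one_add_exp {E : ℂ} (h : ‖1 + Complex.exp E‖ ≤ 1 / 2) :
    |E.re| ≤ 2 * ‖1 + Complex.exp E‖ := by
  have h1 : |1 - ‖Complex.exp E‖| ≤ ‖1 + Complex.exp E‖ := by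
    simpa using abs_norm_sub_norm_le (1 : ℂ) (-Complex.exp E)
  rw [Complex.norm_exp] at h1
  obtain ⟨h2, h3⟩ := abs_le.1 h1
  have h4 := Real.add_one_le_exp E.re
  have h5 := Real.add_one_le_exp (-E.re)
  have h6 : Real.exp E.re * Real.exp (-E.re) = 1 := by rw [← Real.exp_add]; simp
  have h7 := norm_nonneg (1 + Complex.exp E)
  have h8 : 1 / 2 ≤ Real.exp E.re := by linarith
  have h9 : Real.exp (-E.re) ≤ 2 := by
    have := Real.exp_pos (-E.re)
    nlinarith
  rw [abs_le]
  constructor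
  · have : Real.exp (-E.re) - 1 = Real.exp (-E.re) * (1 - Real.exp E.re) := by linarith
    have := Real.exp_pos (-E.re)
    nlinarith
  · linarith

lemma log_norm_sub_log_norm_le {w w' : ℂ} {R : ℝ} (hR : 0 < R) (hw : R ≤ ‖w‖) (hw' : R ≤ ‖w'‖) :
    |Real.log ‖w‖ - Real.log ‖w'‖| ≤ ‖w - w'‖ / R := by
  have key : ∀ a b : ℝ, R ≤ a → R ≤ b → Real.log a - Real.log b ≤ |a - b| / R := by
    intro a b ha hb
    have hb0 : 0 < b := hR.trans_le hb
    rw [← Real.log_div (hR.trans_le ha).ne' hb0.ne']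
    refine (Real.log_le_sub_one_of_pos (div_pos (hR.trans_le ha) hb0)).trans ?_
    have : a / b - 1 = (a - b) / b := by field_simp
    rw [this]
    calc (a - b) / b ≤ |a - b| / b := by gcongr; exact le_abs_self _
      _ ≤ |a - b| / R := by gcongr
  have h1 := abs_norm_sub_norm_le w w'
  have h2 : |‖w‖ - ‖w'‖| / R ≤ ‖w - w'‖ / R := by gcongr
  rw [abs_le]
  constructor
  · have := key _ _ hw' hw
    rw [abs_sub_comm] at this
    linarith
  · exact (key _ _ hw hw').trans h2

namespace ExpPowerAsymptotic

variable {f : ℂ → ℂ} {A β : ℂ} {p m k c : ℝ}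

/-- Large zeros with close imaginary parts coincide, and the derivative is large there. -/
lemma exists_zeros_large (h : ExpPowerAsymptotic f A β p m k c) : ∃ (M : ℕ) (R c₀ : ℝ), 0 < M ∧
    0 < c₀ ∧ (∀ w ∈ region c, R ≤ ‖w‖ → f w = 0 →
      1 ≤ w.im ∧ |(phase k m β w).re| ≤ Real.log 2 ∧ c₀ * ‖w‖ ^ p ≤ ‖deriv f w‖) ∧
    ∀ w ∈ region c, ∀ w' ∈ region c, R ≤ ‖w‖ → R ≤ ‖w'‖ → f w = 0 → f w' = 0 →
      |w.im - w'.im| ≤ 1 / M → w = w' := by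
  have hk := h.pos_k
  have hm := h.pos_m
  obtain ⟨δ, η, R₁, hδ, hδ4, hη, hloc⟩ := h.exists_local
  obtain ⟨R₂, h₂⟩ := h.exists_norm_one_add_exp_le_of_eq_zero
    (η := min (min η (k * δ / 32)) (1 / 2)) (by positivity)
  obtain ⟨M, hM⟩ := exists_nat_gt (4 / δ)
  have hM0 : (0 : ℝ) < M := lt_trans (by positivity) hM
  refine ⟨M, max (max R₁ R₂) (4 * m / k), ‖A‖ * (k / 2), Nat.cast_pos.1 hM0,
    mul_pos (norm_pos_iff.2 h.ne_zero) (by positivity), fun w hw hwR hfw => ?_,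
    fun w hw w' hw' hwR hwR' hfw hfw' him => ?_⟩
  · have e1 := h₂ w hw (((le_max_right _ _).trans (le_max_left _ _)).trans hwR) hfw
    obtain ⟨h3, h4, h5, h6, h7, -⟩ := hloc w hw
      (((le_max_left _ _).trans (le_max_left _ _)).trans hwR)
      (e1.trans ((min_le_left _ _).trans (min_le_left _ _)))
    refine ⟨h4, h5, ?_⟩
    have hw0 : w ≠ 0 := by rintro rfl; simp at h4; linarith
    have hne : ∀ z : ℂ, z ≠ 0 → A * z ^ (p : ℂ) ≠ 0 := fun z hz =>
      mul_ne_zero h.ne_zero (by simp [Complex.cpow_eq_zero_iff, hz])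
    have hs : w ∈ Complex.slitPlane := Or.inl (by linarith)
    have hd1 := (h6 w (Metric.mem_ball_self (by positivity))).hasDerivAt
    have hd2 : HasDerivAt (fun z : ℂ => A * z ^ (p : ℂ)) (deriv (fun z : ℂ => A * z ^ (p : ℂ)) w) w :=
      ((differentiableAt_id.cpow_const hs).const_mul A).hasDerivAt
    have hd3 := hd2.mul hd1
    have hd4 : HasDerivAt f _ w := hd3.congr_of_eventuallyEq (by
      filter_upwards [eventually_ne_nhds hw0] with z hz
      simp only [Pi.mul_apply]
      rw [mul_div_cancel₀ _ (hne z hz)])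
    rw [hd4.deriv, hfw, zero_div, mul_zero, zero_add, norm_mul, norm_mul, Complex.norm_cpow_real]
    have e2 := h7 w (Metric.mem_closedBall_self hδ.le)
    have e3 := norm_sub_le (deriv (fun w => f w / (A * w ^ (p : ℂ))) w + k)
      (deriv (fun w => f w / (A * w ^ (p : ℂ))) w)
    rw [add_sub_cancel_left, Complex.norm_real, Real.norm_of_nonneg hk.le] at e3
    have e4 : 0 ≤ ‖A‖ * ‖w‖ ^ p := by positivity
    nlinarith
  · have e1 := h₂ w hw (((le_max_right _ _).trans (le_max_left _ _)).trans hwR) hfw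
    have e1' := h₂ w' hw' (((le_max_right _ _).trans (le_max_left _ _)).trans hwR') hfw'
    obtain ⟨-, -, -, h6, h7, -⟩ := hloc w hw
      (((le_max_left _ _).trans (le_max_left _ _)).trans hwR)
      (e1.trans ((min_le_left _ _).trans (min_le_left _ _)))
    have e2 := (abs_re_le_two_mul_norm_one_add_exp (e1.trans (min_le_right _ _))).trans
      (mul_le_mul_of_nonneg_left (e1.trans ((min_le_left _ _).trans (min_le_right _ _)))
        zero_le_two)
    have e2' := (abs_re_le_two_mul_norm_one_add_exp (e1'.trans (min_le_right _ _))).trans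
      (mul_le_mul_of_nonneg_left (e1'.trans ((min_le_left _ _).trans (min_le_right _ _)))
        zero_le_two)
    rw [phase_re, abs_le] at e2 e2'
    have e3 := log_norm_sub_log_norm_le (R := 4 * m / k) (by positivity)
      ((le_max_right _ _).trans hwR) ((le_max_right _ _).trans hwR')
    have e4 := Complex.norm_le_abs_re_add_abs_im (w - w')
    rw [Complex.sub_re, Complex.sub_im] at e4
    have e5 : |w.im - w'.im| ≤ δ / 4 := him.trans (by
      rw [div_le_iff₀ hM0]; rw [div_lt_iff₀ hδ] at hM; linarith)
    have e6 : m * (‖w - w'‖ / (4 * m / k)) = k / 4 * ‖w - w'‖ := by field_simp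
    have e7 := mul_le_mul_of_nonneg_left e3 hm.le
    rw [e6] at e7
    have e8 : |m * (Real.log ‖w‖ - Real.log ‖w'‖)| ≤ k / 4 * ‖w - w'‖ := by
      rwa [abs_mul, abs_of_pos hm]
    rw [abs_le] at e8
    have e9 : |k * (w.re - w'.re)| ≤ k / 4 * ‖w - w'‖ + k * δ / 8 := by
      rw [abs_le]
      constructor <;> linarith
    rw [abs_mul, abs_of_pos hk] at e9
    have e10 : |w.re - w'.re| ≤ δ / 2 := by nlinarith
    have e11 : ‖w - w'‖ ≤ δ := by linarith
    have e12 := mul_norm_sub_le_of_deriv_near hk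
      (fun z hz => h6 z (Metric.closedBall_subset_ball (by linarith) hz)) h7
      (Metric.mem_closedBall_self hδ.le) (z' := w')
      (by rw [Metric.mem_closedBall, dist_eq_norm, norm_sub_rev]; exact e11)
    simp only [hfw, hfw', zero_div, sub_self, norm_zero] at e12
    have e13 : ‖w - w'‖ ≤ 0 := by nlinarith [norm_nonneg (w - w')]
    exact sub_eq_zero.1 (norm_le_zero_iff.1 e13)

lemma exists_ne_zero (h : ExpPowerAsymptotic f A β p m k c) : ∃ w, f w ≠ 0 := by
  obtain ⟨u, hu⟩ := h.exists_strip 0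
  refine ⟨u, fun h0 => ?_⟩
  have := hu u (by simp) (by simp) (by simp)
  rw [h0, norm_zero] at this
  linarith

lemma summable_zeros (h : ExpPowerAsymptotic f A β p m k c) {s : ℝ} (hs : 0 < s) :
    Summable fun w : {w : ℂ | w ∈ region c ∧ f w = 0} =>
      Real.exp (-s * (w : ℂ).re) / ‖deriv f w‖ := by
  have hk := h.pos_k
  have hm := h.pos_m
  have hp := h.one_le
  obtain ⟨M, R, c₀, hM, hc₀, h₁, h₂⟩ := h.exists_zeros_large
  have hM1 : (1 : ℝ) ≤ M := by exact_mod_cast hM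
  have hM0 : (0 : ℝ) < M := by linarith
  set S : Set {w : ℂ | w ∈ region c ∧ f w = 0} := {w | ‖(w : ℂ)‖ < R} with hS
  have hfin : S.Finite := by
    refine Set.Finite.of_finite_image (f := Subtype.val) ?_ Subtype.val_injective.injOn
    refine (finite_zeros_inter h.differentiable h.exists_ne_zero R).subset ?_
    rintro _ ⟨w, hw, rfl⟩
    exact ⟨w.2.2, by simpa using le_of_lt hw⟩
  rw [← hfin.summable_compl_iff]
  set a : ℝ := p + s * m / k with ha
  have ha1 : 1 < a := by
    have : 0 < s * m / k := by positivity
    linarith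
  have hsum : Summable fun n : ℕ => ((n : ℝ) + 1) ^ (-a) := by
    have := (summable_nat_add_iff 1).2 (Real.summable_nat_rpow.2 (by linarith : -a < -1))
    simpa using this
  set C : ℝ := Real.exp (s * (|β.re| + Real.log 2) / k) / c₀ * (2 * M) ^ a with hC
  set φ : ↥Sᶜ → ℕ := fun w => ⌊M * (w : ℂ).im⌋₊ with hφ
  have hlarge : ∀ w : ↥Sᶜ, R ≤ ‖(w : ℂ)‖ := fun w => not_lt.1 w.2
  have hinj : Function.Injective φ := by
    intro w w' hww
    refine Subtype.ext (Subtype.ext (h₂ _ w.1.2.1 _ w'.1.2.1 (hlarge w) (hlarge w') w.1.2.2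
      w'.1.2.2 ?_))
    have e1 := (h₁ _ w.1.2.1 (hlarge w) w.1.2.2).1
    have e1' := (h₁ _ w'.1.2.1 (hlarge w') w'.1.2.2).1
    have e2 := Nat.floor_le (by positivity : 0 ≤ M * (w : ℂ).im)
    have e2' := Nat.floor_le (by positivity : 0 ≤ M * (w' : ℂ).im)
    have e3 := Nat.lt_floor_add_one (M * (w : ℂ).im)
    have e3' := Nat.lt_floor_add_one (M * (w' : ℂ).im)
    have e4 : ((⌊M * (w : ℂ).im⌋₊ : ℕ) : ℝ) = ⌊M * (w' : ℂ).im⌋₊ := by exact_mod_cast hww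
    rw [e4] at e2 e3
    have e5 : |(w : ℂ).im - (w' : ℂ).im| * M = |((w : ℂ).im - (w' : ℂ).im) * M| := by
      rw [abs_mul, abs_of_pos hM0]
    rw [le_div_iff₀ hM0, e5, abs_le]
    constructor <;> linarith
  refine Summable.of_nonneg_of_le (fun w => div_nonneg (Real.exp_pos _).le (norm_nonneg _)) (fun w => ?_)
    ((hsum.comp_injective hinj).mul_left C)
  obtain ⟨e1, e2, e3⟩ := h₁ _ w.1.2.1 (hlarge w) w.1.2.2
  have hw1 : 1 ≤ ‖(w : ℂ)‖ := e1.trans ((le_abs_self _).trans (Complex.abs_im_le_norm _))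
  have hw0 : 0 < ‖(w : ℂ)‖ := by linarith
  have e4 : Real.exp (-s * (w : ℂ).re) ≤
      Real.exp (s * (|β.re| + Real.log 2) / k) * ‖(w : ℂ)‖ ^ (-(s * m / k)) := by
    rw [Real.rpow_def_of_pos hw0, ← Real.exp_add, Real.exp_le_exp]
    rw [phase_re, abs_le] at e2
    have e5 := le_abs_self β.re
    have e6 : m * Real.log ‖(w : ℂ)‖ - |β.re| - Real.log 2 ≤ k * (w : ℂ).re := by linarith
    have e7 : s * (|β.re| + Real.log 2) / k + Real.log ‖(w : ℂ)‖ * -(s * m / k) =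
        -(s / k * (m * Real.log ‖(w : ℂ)‖ - |β.re| - Real.log 2)) := by ring
    have e8 : -s * (w : ℂ).re = -(s / k * (k * (w : ℂ).re)) := by field_simp
    rw [e7, e8]
    exact neg_le_neg (mul_le_mul_of_nonneg_left e6 (by positivity))
  have e5 : ((φ w : ℝ) + 1) / (2 * M) ≤ ‖(w : ℂ)‖ := by
    rw [div_le_iff₀ (by positivity)]
    have e6 := Nat.floor_le (by positivity : 0 ≤ M * (w : ℂ).im)
    have e7 := (le_abs_self _).trans (Complex.abs_im_le_norm (w : ℂ))
    have e8 : M * (w : ℂ).im ≤ M * ‖(w : ℂ)‖ := by gcongr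
    have e9 : 1 ≤ M * ‖(w : ℂ)‖ := by nlinarith
    simp only [hφ]
    linarith
  calc Real.exp (-s * (w : ℂ).re) / ‖deriv f w‖
      ≤ Real.exp (s * (|β.re| + Real.log 2) / k) * ‖(w : ℂ)‖ ^ (-(s * m / k)) /
          (c₀ * ‖(w : ℂ)‖ ^ p) := by gcongr
    _ = Real.exp (s * (|β.re| + Real.log 2) / k) / c₀ * ‖(w : ℂ)‖ ^ (-a) := by
        rw [ha, neg_add', sub_eq_add_neg, Real.rpow_add hw0, Real.rpow_neg hw0.le p]
        field_simp
    _ ≤ Real.exp (s * (|β.re| + Real.log 2) / k) / c₀ * (((φ w : ℝ) + 1) / (2 * M)) ^ (-a) := by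
        gcongr ?_ * ?_
        exact Real.rpow_le_rpow_of_nonpos (by positivity) e5 (by linarith)
    _ = C * ((φ w : ℝ) + 1) ^ (-a) := by
        rw [Real.div_rpow (by positivity) (by positivity), Real.rpow_neg (by positivity : 0 ≤ 2 * (M : ℝ)), hC]
        field_simp

end ExpPowerAsymptotic

/-- The integral of `g` over the boundary of the rectangle `[a, b] × [c, d]`, counterclockwise. -/
noncomputable def rectIntegral (g : ℂ → ℂ) (a b c d : ℝ) : ℂ :=
  (∫ x in a..b, g (x + c * Complex.I)) - (∫ x in a..b, g (x + d * Complex.I)) +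
    Complex.I * (∫ y in c..d, g (b + y * Complex.I)) -
    Complex.I * ∫ y in c..d, g (a + y * Complex.I)

variable {a b c d : ℝ}

lemma rectIntegral_eq_zero {g : ℂ → ℂ} {O : Set ℂ} (hab : a ≤ b) (hcd : c ≤ d)
    (hO : Icc a b ×ℂ Icc c d ⊆ O) (hg : DifferentiableOn ℂ g O) : rectIntegral g a b c d = 0 := by
  have h := Complex.integral_boundary_rect_eq_zero_of_differentiableOn g (a + c * Complex.I)
    (b + d * Complex.I) (hg.mono (by
      simpa [uIcc_of_le hab, uIcc_of_le hcd] using hO))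
  simpa [rectIntegral] using h

lemma log_sub_log_neg_of_im_pos {w : ℂ} (hw : 0 < w.im) :
    Complex.log w - Complex.log (-w) = Real.pi * Complex.I := by
  rw [Complex.log, Complex.log, norm_neg, Complex.arg_neg_eq_arg_sub_pi_of_im_pos hw]
  push_cast; ring

lemma log_sub_log_neg_of_im_neg {w : ℂ} (hw : w.im < 0) :
    Complex.log w - Complex.log (-w) = -(Real.pi * Complex.I) := by
  rw [Complex.log, Complex.log, norm_neg, Complex.arg_neg_eq_arg_add_pi_of_im_neg hw]
  push_cast; ring

/-- Integration of `1 / z` along a segment that avoids the negative real axis. -/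
lemma integral_mul_inv_eq_log {u e : ℂ} {s t : ℝ} (hst : s ≤ t)
    (h : ∀ x ∈ Icc s t, u + x * e ∈ Complex.slitPlane) :
    e * ∫ x in s..t, (u + x * e)⁻¹ = Complex.log (u + t * e) - Complex.log (u + s * e) := by
  rw [← intervalIntegral.integral_const_mul]
  have hd : ∀ x ∈ uIcc s t, HasDerivAt (fun x : ℝ => Complex.log (u + x * e))
      (e * (u + x * e)⁻¹) x := by
    intro x hx
    rw [uIcc_of_le hst] at hx
    have h1 : HasDerivAt (fun x : ℝ => u + x * e) e x := by
      simpa using ((Complex.ofRealCLM.hasDerivAt (x := x)).mul_const e).const_add u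
    have h2 := h1.clog_real (h x hx)
    rwa [div_eq_mul_inv] at h2
  refine intervalIntegral.integral_eq_sub_of_hasDerivAt hd (ContinuousOn.intervalIntegrable ?_)
  rw [uIcc_of_le hst]
  refine ContinuousOn.mul continuousOn_const (ContinuousOn.inv₀ (by fun_prop) fun x hx => ?_)
  exact Complex.slitPlane_ne_zero (h x hx)

lemma rectIntegral_inv {p : ℂ} (hp : p ∈ Ioo a b ×ℂ Ioo c d) :
    rectIntegral (fun z => (z - p)⁻¹) a b c d = 2 * Real.pi * Complex.I := by
  obtain ⟨⟨h1, h2⟩, ⟨h3, h4⟩⟩ := hp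
  have hab : a ≤ b := by linarith
  have hcd : c ≤ d := by linarith
  have e1 := integral_mul_inv_eq_log (u := c * Complex.I - p) (e := 1) hab fun x _ =>
    Or.inr (by simp; linarith)
  have e2 := integral_mul_inv_eq_log (u := d * Complex.I - p) (e := 1) hab fun x _ =>
    Or.inr (by simp; linarith)
  have e3 := integral_mul_inv_eq_log (u := b - p) (e := Complex.I) hcd fun x _ =>
    Or.inl (by simp; linarith)
  have e4 := integral_mul_inv_eq_log (u := -(a - p)) (e := -Complex.I) hcd fun x _ =>
    Or.inl (by simp; linarith)
  have f1 := log_sub_log_neg_of_im_pos (w := a + d * Complex.I - p) (by simp; linarith)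
  have f2 := log_sub_log_neg_of_im_neg (w := a + c * Complex.I - p) (by simp; linarith)
  have g1 : ∫ x in a..b, ((x : ℂ) + c * Complex.I - p)⁻¹ =
      1 * ∫ x in a..b, (c * Complex.I - p + x * 1)⁻¹ := by
    rw [one_mul]; congr 1; ext x; ring_nf
  have g2 : ∫ x in a..b, ((x : ℂ) + d * Complex.I - p)⁻¹ =
      1 * ∫ x in a..b, (d * Complex.I - p + x * 1)⁻¹ := by
    rw [one_mul]; congr 1; ext x; ring_nf
  have g3 : Complex.I * ∫ y in c..d, ((b : ℂ) + y * Complex.I - p)⁻¹ =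
      Complex.I * ∫ y in c..d, (b - p + y * Complex.I)⁻¹ := by
    congr 2; ext x; ring_nf
  have g4 : Complex.I * ∫ y in c..d, ((a : ℂ) + y * Complex.I - p)⁻¹ =
      -Complex.I * ∫ y in c..d, (-(a - p) + y * -Complex.I)⁻¹ := by
    rw [neg_mul, ← mul_neg, ← intervalIntegral.integral_neg]
    congr 2; ext x; rw [← inv_neg]; ring_nf
  rw [rectIntegral, g1, g2, g3, g4, e1, e2, e3, e4]
  have k1 : -((a : ℂ) - p) + d * -Complex.I = -(a + d * Complex.I - p) := by ring
  have k2 : -((a : ℂ) - p) + c * -Complex.I = -(a + c * Complex.I - p) := by ring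
  have k3 : (d : ℂ) * Complex.I - p + b * 1 = b - p + d * Complex.I := by ring
  have k4 : (c : ℂ) * Complex.I - p + b * 1 = b - p + c * Complex.I := by ring
  have k5 : (d : ℂ) * Complex.I - p + a * 1 = a + d * Complex.I - p := by ring
  have k6 : (c : ℂ) * Complex.I - p + a * 1 = a + c * Complex.I - p := by ring
  rw [k1, k2, k3, k4, k5, k6]
  linear_combination f1 - f2

lemma mem_rect_ne {p z : ℂ} (hp : p ∈ Ioo a b ×ℂ Ioo c d)
    (hz : z.re = a ∨ z.re = b ∨ z.im = c ∨ z.im = d) : z ≠ p := by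
  obtain ⟨⟨h1, h2⟩, ⟨h3, h4⟩⟩ := hp
  rintro rfl
  rcases hz with h | h | h | h <;> linarith

lemma rectIntegral_congr {g h : ℂ → ℂ}
    (heq : ∀ z : ℂ, (z.re = a ∨ z.re = b ∨ z.im = c ∨ z.im = d) → g z = h z) :
    rectIntegral g a b c d = rectIntegral h a b c d := by
  unfold rectIntegral
  congr 1
  · congr 1
    · congr 1
      · congr 1; ext x; exact heq _ (by simp)
      · congr 1; ext x; exact heq _ (by simp)
    · congr 2; ext x; exact heq _ (by simp)
  · congr 2; ext x; exact heq _ (by simp)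

lemma rectIntegral_add {g h : ℂ → ℂ} (hab : a ≤ b) (hcd : c ≤ d) {O : Set ℂ}
    (hO : ∀ z : ℂ, z ∈ Icc a b ×ℂ Icc c d → (z.re = a ∨ z.re = b ∨ z.im = c ∨ z.im = d) → z ∈ O)
    (hg : ContinuousOn g O) (hh : ContinuousOn h O) :
    rectIntegral (fun z => g z + h z) a b c d =
      rectIntegral g a b c d + rectIntegral h a b c d := by
  have hx : ∀ y : ℝ, (y = c ∨ y = d) → ∀ g : ℂ → ℂ, ContinuousOn g O →
      IntervalIntegrable (fun x : ℝ => g (x + y * Complex.I)) volume a b := by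
    intro y hy g hg
    refine ContinuousOn.intervalIntegrable (hg.comp (by fun_prop) fun x hx => ?_)
    rw [uIcc_of_le hab] at hx
    refine hO _ ⟨by simpa using hx, ?_⟩ (by simpa using Or.inr (Or.inr hy))
    rcases hy with rfl | rfl
    · simpa using hcd
    · simpa using hcd
  have hy : ∀ x : ℝ, (x = a ∨ x = b) → ∀ g : ℂ → ℂ, ContinuousOn g O →
      IntervalIntegrable (fun y : ℝ => g (x + y * Complex.I)) volume c d := by
    intro x hx g hg
    refine ContinuousOn.intervalIntegrable (hg.comp (by fun_prop) fun y hy => ?_)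
    rw [uIcc_of_le hcd] at hy
    refine hO _ ⟨?_, by simpa using hy⟩ (by rcases hx with h | h <;> simp [h])
    rcases hx with rfl | rfl
    · simpa using hab
    · simpa using hab
  unfold rectIntegral
  rw [intervalIntegral.integral_add (hx c (Or.inl rfl) g hg) (hx c (Or.inl rfl) h hh),
    intervalIntegral.integral_add (hx d (Or.inr rfl) g hg) (hx d (Or.inr rfl) h hh),
    intervalIntegral.integral_add (hy b (Or.inr rfl) g hg) (hy b (Or.inr rfl) h hh),
    intervalIntegral.integral_add (hy a (Or.inl rfl) g hg) (hy a (Or.inl rfl) h hh)]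
  ring

lemma rectIntegral_const_mul (r : ℂ) (g : ℂ → ℂ) :
    rectIntegral (fun z => r * g z) a b c d = r * rectIntegral g a b c d := by
  simp only [rectIntegral, intervalIntegral.integral_const_mul]
  ring

/-- The residue theorem for simple poles in a rectangle. -/
theorem rectIntegral_eq_sum_residues (hab : a ≤ b) (hcd : c ≤ d) {O : Set ℂ} (hOo : IsOpen O)
    (hO : Icc a b ×ℂ Icc c d ⊆ O) (S : Finset ℂ) (hS : ∀ p ∈ S, p ∈ Ioo a b ×ℂ Ioo c d)
    (r : ℂ → ℂ) (g : ℂ → ℂ) (hg : DifferentiableOn ℂ g (O \ S))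
    (hr : ∀ p ∈ S, Tendsto (fun z => (z - p) * g z) (𝓝[≠] p) (𝓝 (r p))) :
    rectIntegral g a b c d = 2 * Real.pi * Complex.I * ∑ p ∈ S, r p := by
  classical
  induction S using Finset.induction generalizing g with
  | empty =>
    simpa using rectIntegral_eq_zero hab hcd hO (by simpa using hg)
  | insert p S hpS ih =>
    have hp := hS p (Finset.mem_insert_self p S)
    have hpO : p ∈ O := hO ⟨Ioo_subset_Icc_self hp.1, Ioo_subset_Icc_self hp.2⟩
    set g₁ : ℂ → ℂ := fun z => g z - r p * (z - p)⁻¹ with hg₁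
    set g₂ : ℂ → ℂ := Function.update g₁ p (limUnder (𝓝[≠] p) g₁) with hg₂
    have hopen : IsOpen (O \ (S : Set ℂ)) := hOo.sdiff S.finite_toSet.isClosed
    have hdiff : (O \ (S : Set ℂ)) \ {p} = O \ (insert p S : Finset ℂ) := by
      ext z; simp [and_assoc, and_comm]
    have hne : ∀ z ∈ (O \ (S : Set ℂ)) \ {p}, z - p ≠ 0 := fun z hz => sub_ne_zero.2 hz.2
    have hg₁d : DifferentiableOn ℂ g₁ ((O \ (S : Set ℂ)) \ {p}) := by
      refine DifferentiableOn.sub (by rwa [hdiff]) ?_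
      exact ((differentiableOn_id.sub_const p).inv hne).const_mul _
    have hlo : (fun z => g₁ z - g₁ p) =o[𝓝[≠] p] fun z => (z - p)⁻¹ := by
      have h1 : Tendsto (fun z => (z - p) * g₁ z - (z - p) * g₁ p) (𝓝[≠] p) (𝓝 0) := by
        have h2 : Tendsto (fun z => (z - p) * g z - r p - (z - p) * g₁ p) (𝓝[≠] p)
            (𝓝 (r p - r p - (p - p) * g₁ p)) :=
          ((hr p (Finset.mem_insert_self p S)).sub_const _).sub
            ((Continuous.tendsto (by fun_prop) p).mono_left nhdsWithin_le_nhds)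
        simp only [sub_self, zero_mul] at h2
        refine h2.congr' ?_
        filter_upwards [self_mem_nhdsWithin] with z hz
        have : z - p ≠ 0 := sub_ne_zero.2 hz
        simp only [hg₁]
        field_simp
      rw [Asymptotics.isLittleO_iff_tendsto']
      · refine h1.congr fun z => ?_
        rw [div_inv_eq_mul]; ring
      · filter_upwards [self_mem_nhdsWithin] with z hz h0
        exact absurd (inv_eq_zero.1 h0) (sub_ne_zero.2 hz)
    have hg₂d : DifferentiableOn ℂ g₂ (O \ (S : Set ℂ)) :=
      Complex.differentiableOn_update_limUnder_of_isLittleO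
        (hopen.mem_nhds ⟨hpO, by simpa using hpS⟩) hg₁d hlo
    have h3 := ih (fun p' hp' => hS p' (Finset.mem_insert_of_mem hp')) g₂ hg₂d (by
      intro p' hp'
      have hpp' : p' ≠ p := fun h => hpS (h ▸ hp')
      have h4 : Tendsto (fun z => (z - p') * g z - (z - p') * (r p * (z - p)⁻¹)) (𝓝[≠] p')
          (𝓝 (r p' - (p' - p') * (r p * (p' - p)⁻¹))) := by
        refine (hr p' (Finset.mem_insert_of_mem hp')).sub (Tendsto.mono_left ?_ nhdsWithin_le_nhds)
        refine ContinuousAt.tendsto (f := fun z => (z - p') * (r p * (z - p)⁻¹)) ?_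
        refine ContinuousAt.mul (by fun_prop) (ContinuousAt.mul (by fun_prop)
          (ContinuousAt.inv₀ (by fun_prop) (sub_ne_zero.2 hpp')))
      rw [sub_self, zero_mul, sub_zero] at h4
      refine h4.congr' ?_
      filter_upwards [nhdsWithin_le_nhds (eventually_ne_nhds hpp')] with z hz
      rw [hg₂, Function.update_of_ne hz]
      ring)
    set B : Set ℂ := (O \ (S : Set ℂ)) \ {p}
    have hcont : ContinuousOn (fun z => r p * (z - p)⁻¹) B :=
      continuousOn_const.mul (ContinuousOn.inv₀ (by fun_prop) hne)
    have h4 : rectIntegral g a b c d = rectIntegral (fun z => g₂ z + r p * (z - p)⁻¹) a b c d := by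
      refine rectIntegral_congr fun z hz => ?_
      rw [hg₂, Function.update_of_ne (mem_rect_ne hp hz)]
      simp [hg₁]
    rw [h4, rectIntegral_add hab hcd (O := B) ?_ (hg₂d.continuousOn.mono sdiff_subset) hcont, h3,
      rectIntegral_const_mul, rectIntegral_inv hp, Finset.sum_insert hpS]
    · ring
    · intro z hz hzb
      refine ⟨⟨hO hz, fun hzS => ?_⟩, mem_rect_ne hp hzb⟩
      exact mem_rect_ne (hS z (Finset.mem_insert_of_mem hzS)) hzb rfl

section Reflection

variable {D : ℂ → ℂ}

lemma exists_reflection (hconj : ∀ z, D (starRingEnd ℂ z) = starRingEnd ℂ (D z)) (z : ℂ) :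
    ∃ w : ℂ, w.re = -z.re ∧ w.im = |z.im| ∧ ‖w‖ = ‖z‖ ∧ ‖D (-w)‖ = ‖D z‖ := by
  rcases le_total z.im 0 with h | h
  · exact ⟨-z, by simp, by simp [abs_of_nonpos h], by simp, by simp⟩
  · refine ⟨-starRingEnd ℂ z, by simp, by simp [abs_of_nonneg h], by simp, ?_⟩
    rw [neg_neg, hconj, Complex.norm_conj]

lemma deriv_conj_of_conj (hconj : ∀ z, D (starRingEnd ℂ z) = starRingEnd ℂ (D z)) (z : ℂ) :
    deriv D (starRingEnd ℂ z) = starRingEnd ℂ (deriv D z) := by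
  have h := congrFun (deriv_conj_conj (f := D)) (starRingEnd ℂ z)
  have h1 : (starRingEnd ℂ ∘ D ∘ starRingEnd ℂ) = D := by
    ext w; simp [hconj]
  rw [h1, Function.comp, Function.comp, Complex.conj_conj] at h
  exact h

end Reflection

lemma summable_subtype_of_injective {S T : Set ℂ} {F G : ℂ → ℝ} (hF : Summable fun w : T => F w)
    {φ : ℂ → ℂ} (hφ : Function.Injective φ) (hmaps : MapsTo φ S T) (hG : ∀ z ∈ S, G z = F (φ z)) :
    Summable fun z : S => G z :=
  (hF.comp_injective (i := hmaps.restrict) fun _ _ h =>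
    Subtype.ext (hφ (congrArg Subtype.val h))).congr fun z => (hG z z.2).symm

namespace ExpPowerAsymptotic

variable {D : ℂ → ℂ} {A β : ℂ} {p m k c : ℝ}

lemma differentiable_symbol (h : ExpPowerAsymptotic (fun w => D (-w)) A β p m k c) :
    Differentiable ℂ D := by
  have := h.differentiable.comp differentiable_neg
  simpa [Function.comp_def] using this

lemma summable_symbol_zeros (h : ExpPowerAsymptotic (fun w => D (-w)) A β p m k c)
    (hconj : ∀ z, D (starRingEnd ℂ z) = starRingEnd ℂ (D z)) (hre : ∀ z, D z = 0 → z.re ≤ c)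
    {s : ℝ} (hs : 0 < s) :
    Summable fun z : {z : ℂ | D z = 0} => Real.exp (s * (z : ℂ).re) / ‖deriv D z‖ := by
  have hd : ∀ w, deriv (fun w => D (-w)) w = -deriv D (-w) := fun w => deriv_comp_neg D w
  obtain ⟨F, hF⟩ : ∃ F : ℂ → ℝ, ∀ w, F w = Real.exp (-s * w.re) / ‖deriv D (-w)‖ :=
    ⟨_, fun _ => rfl⟩
  obtain ⟨G, hG⟩ : ∃ G : ℂ → ℝ, ∀ z, G z = Real.exp (s * z.re) / ‖deriv D z‖ := ⟨_, fun _ => rfl⟩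
  have h0 : Summable fun w : {w : ℂ | w ∈ region c ∧ D (-w) = 0} => F w :=
    (h.summable_zeros hs).congr fun w => by rw [hd, norm_neg, hF]
  simp only [← hG]
  have hG0 : ∀ z, 0 ≤ G z := fun z => by rw [hG]; positivity
  have h1 : Summable fun z : {z : ℂ | D z = 0 ∧ z.im ≤ 0} => G z := by
    refine summable_subtype_of_injective (G := G) h0 neg_injective (fun z hz => ?_) fun z _ => ?_
    · exact ⟨⟨by simpa using hre z hz.1, by simpa using hz.2⟩, by simpa using hz.1⟩
    · simp [hG, hF]
  have h2 : Summable fun z : {z : ℂ | D z = 0 ∧ 0 ≤ z.im} => G z := by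
    refine summable_subtype_of_injective (G := G) h0 (φ := fun z => -starRingEnd ℂ z)
      (neg_injective.comp (starRingEnd ℂ).injective) (fun z hz => ?_) fun z _ => ?_
    · exact ⟨⟨by simpa using hre z hz.1, by simpa using hz.2⟩, by simp [hconj, hz.1]⟩
    · simp [hG, hF, deriv_conj_of_conj hconj]
  have h1' := summable_subtype_iff_indicator.1 h1
  have h2' := summable_subtype_iff_indicator.1 h2
  refine summable_subtype_iff_indicator.2 (Summable.of_nonneg_of_le (fun z => ?_) (fun z => ?_)
    (h1'.add h2'))
  · exact indicator_nonneg (fun z _ => hG0 z) z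
  · by_cases hz : D z = 0
    · rcases le_total z.im 0 with hi | hi
      · rw [indicator_of_mem (show z ∈ {z : ℂ | D z = 0} from hz),
          indicator_of_mem (show z ∈ {z : ℂ | D z = 0 ∧ z.im ≤ 0} from ⟨hz, hi⟩)]
        exact le_add_of_nonneg_right (indicator_nonneg (fun z _ => hG0 z) z)
      · rw [indicator_of_mem (show z ∈ {z : ℂ | D z = 0} from hz),
          indicator_of_mem (show z ∈ {z : ℂ | D z = 0 ∧ 0 ≤ z.im} from ⟨hz, hi⟩)]
        exact le_add_of_nonneg_left (indicator_nonneg (fun z _ => hG0 z) z)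
    · rw [indicator_of_notMem (show z ∉ {z : ℂ | D z = 0} from hz)]
      exact add_nonneg (indicator_nonneg (fun z _ => hG0 z) z)
        (indicator_nonneg (fun z _ => hG0 z) z)

lemma exists_symbol_horizontal (h : ExpPowerAsymptotic (fun w => D (-w)) A β p m k c)
    (hconj : ∀ z, D (starRingEnd ℂ z) = starRingEnd ℂ (D z)) : ∃ (R : ℕ → ℝ) (c₀ : ℝ), 0 < c₀ ∧
    Tendsto R atTop atTop ∧ (∀ j, 0 < R j) ∧
      ∀ j, ∀ z : ℂ, z.re ≤ c → |z.im| = R j → c₀ * ‖z‖ ≤ ‖D z‖ := by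
  obtain ⟨R, c₀, hc₀, hR, hR0, h1⟩ := h.exists_horizontal
  refine ⟨R, c₀, hc₀, hR, hR0, fun j z hz hj => ?_⟩
  obtain ⟨w, e1, e2, e3, e4⟩ := exists_reflection hconj z
  rw [← e3, ← e4]
  exact h1 j w (by linarith) (e2.trans hj)

lemma exists_symbol_strip (h : ExpPowerAsymptotic (fun w => D (-w)) A β p m k c)
    (hconj : ∀ z, D (starRingEnd ℂ z) = starRingEnd ℂ (D z)) (r : ℝ) :
    ∃ u₀, ∀ z : ℂ, z.re ≤ u₀ → |z.im| ≤ r → 1 ≤ ‖D z‖ := by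
  obtain ⟨u₀, h1⟩ := h.exists_strip r
  refine ⟨-u₀, fun z hz hj => ?_⟩
  obtain ⟨w, e1, e2, e3, e4⟩ := exists_reflection hconj z
  rw [← e4]
  exact h1 w (by linarith) (by rw [e2]; exact abs_nonneg _) (by rwa [e2])

lemma exists_symbol_vertical (h : ExpPowerAsymptotic (fun w => D (-w)) A β p m k c)
    (hconj : ∀ z, D (starRingEnd ℂ z) = starRingEnd ℂ (D z)) :
    ∃ R c₀, 0 < c₀ ∧ ∀ z : ℂ, z.re = c → R ≤ |z.im| → c₀ * ‖z‖ ≤ ‖D z‖ := by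
  obtain ⟨R, c₀, hc₀, h1⟩ := h.exists_vertical
  refine ⟨R, c₀, hc₀, fun z hz hj => ?_⟩
  obtain ⟨w, e1, e2, e3, e4⟩ := exists_reflection hconj z
  rw [← e3, ← e4]
  exact h1 w (by linarith) (by rwa [e2])

end ExpPowerAsymptotic

/-- The integrand of the Bromwich integral. -/
noncomputable def bromwich (D : ℂ → ℂ) (b x : ℝ) (z : ℂ) : ℂ :=
  Complex.exp ((z - b) * x) / ((z - b) * D z)

lemma norm_bromwich (D : ℂ → ℂ) (b x : ℝ) (z : ℂ) :
    ‖bromwich D b x z‖ = Real.exp ((z.re - b) * x) / (‖z - b‖ * ‖D z‖) := by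
  rw [bromwich, norm_div, norm_mul, Complex.norm_exp]
  simp

lemma tendsto_mul_bromwich_base {D : ℂ → ℂ} (hD : Differentiable ℂ D) {b : ℝ} (x : ℝ)
    (hb : D b ≠ 0) :
    Tendsto (fun z => (z - b) * bromwich D b x z) (𝓝[≠] (b : ℂ)) (𝓝 (1 / D b)) := by
  have h1 : Tendsto (fun z : ℂ => Complex.exp ((z - b) * x) / D z) (𝓝[≠] (b : ℂ))
      (𝓝 (Complex.exp ((b - b) * x) / D b)) := by
    refine Tendsto.mono_left (ContinuousAt.tendsto
      (f := fun z : ℂ => Complex.exp ((z - b) * x) / D z) ?_) nhdsWithin_le_nhds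
    exact ContinuousAt.div (by fun_prop) hD.continuous.continuousAt hb
  rw [sub_self, zero_mul, Complex.exp_zero] at h1
  refine h1.congr' ?_
  filter_upwards [self_mem_nhdsWithin] with z hz
  have : z - b ≠ 0 := sub_ne_zero.2 hz
  rw [bromwich, mul_div_assoc', mul_div_mul_left _ _ this]

lemma tendsto_mul_bromwich_zero {D : ℂ → ℂ} (hD : Differentiable ℂ D) {b x : ℝ} {p : ℂ}
    (hp : D p = 0) (hpb : p ≠ b) (hp' : deriv D p ≠ 0) :
    Tendsto (fun z => (z - p) * bromwich D b x z) (𝓝[≠] p)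
      (𝓝 (Complex.exp ((p - b) * x) / ((p - b) * deriv D p))) := by
  have h0 : Tendsto (fun z => (z - p) / D z) (𝓝[≠] p) (𝓝 (deriv D p)⁻¹) := by
    have h1 := hasDerivAt_iff_tendsto_slope.1 (hD p).hasDerivAt
    refine (h1.inv₀ hp').congr fun z => ?_
    rw [slope_def_field, hp, sub_zero, inv_div]
  have h2 : Tendsto (fun z : ℂ => Complex.exp ((z - b) * x) / (z - b)) (𝓝[≠] p)
      (𝓝 (Complex.exp ((p - b) * x) / (p - b))) := by
    refine Tendsto.mono_left (ContinuousAt.tendsto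
      (f := fun z : ℂ => Complex.exp ((z - b) * x) / (z - b)) ?_) nhdsWithin_le_nhds
    exact ContinuousAt.div (by fun_prop) (by fun_prop) (sub_ne_zero.2 hpb)
  have h3 := h2.mul h0
  rw [← div_eq_mul_inv, div_div] at h3
  refine h3.congr fun z => ?_
  rw [bromwich, div_mul_div_comm, mul_div_assoc', mul_comm (z - p)]

lemma integral_exp_mul_le {b x : ℝ} (hx : 0 < x) (M c : ℝ) :
    ∫ t in M..c, Real.exp ((t - b) * x) ≤ Real.exp ((c - b) * x) / x := by
  have hd : ∀ t ∈ uIcc M c, HasDerivAt (fun t : ℝ => Real.exp ((t - b) * x) / x)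
      (Real.exp ((t - b) * x)) t := by
    intro t _
    have h1 := ((((hasDerivAt_id t).sub_const b).mul_const x).exp).div_const x
    refine h1.congr_deriv ?_
    simp only [id]; field_simp
  rw [intervalIntegral.integral_eq_sub_of_hasDerivAt hd
    (Continuous.intervalIntegrable (by fun_prop) _ _)]
  have := Real.exp_pos ((M - b) * x)
  have : 0 < Real.exp ((M - b) * x) / x := by positivity
  linarith

lemma norm_horizontal_integral_bromwich_le {D : ℂ → ℂ} {b c c₀ R x M y : ℝ} (hx : 0 < x)
    (hR : 0 < R) (hc₀ : 0 < c₀) (hMc : M ≤ c) (hy : |y| = R)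
    (hh : ∀ z : ℂ, z.re ≤ c → |z.im| = R → c₀ * ‖z‖ ≤ ‖D z‖) :
    ‖∫ t in M..c, bromwich D b x (t + y * Complex.I)‖ ≤
      Real.exp ((c - b) * x) / (x * c₀ * R ^ 2) := by
  have h1 : ∀ t ∈ Ioc M c, ‖bromwich D b x (t + y * Complex.I)‖ ≤
      (c₀ * R ^ 2)⁻¹ * Real.exp ((t - b) * x) := by
    intro t ht
    rw [norm_bromwich]
    have e1 : R ≤ ‖(t + y * Complex.I : ℂ) - b‖ := by
      refine le_trans ?_ (Complex.abs_im_le_norm _)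
      simp [hy]
    have e2 : R ≤ ‖(t + y * Complex.I : ℂ)‖ := by
      refine le_trans ?_ (Complex.abs_im_le_norm _)
      simp [hy]
    have e3 := hh (t + y * Complex.I) (by simpa using ht.2) (by simpa using hy)
    have e4 : c₀ * R ^ 2 ≤ ‖(t + y * Complex.I : ℂ) - b‖ * ‖D (t + y * Complex.I)‖ := by
      calc c₀ * R ^ 2 = R * (c₀ * R) := by ring
        _ ≤ _ := by
          gcongr
          exact (mul_le_mul_of_nonneg_left e2 hc₀.le).trans e3
    rw [inv_mul_eq_div]
    have e5 : (t + y * Complex.I : ℂ).re = t := by simp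
    rw [e5]
    gcongr
  refine (intervalIntegral.norm_integral_le_of_norm_le hMc (ae_of_all _ h1)
    (Continuous.intervalIntegrable (by fun_prop) _ _)).trans ?_
  rw [intervalIntegral.integral_const_mul]
  calc _ ≤ (c₀ * R ^ 2)⁻¹ * (Real.exp ((c - b) * x) / x) := by
        gcongr; exact integral_exp_mul_le hx M c
    _ = _ := by field_simp

/-- Moving the line of integration of the Bromwich integral. -/
lemma norm_bromwich_integral_sub_le {D : ℂ → ℂ} (hD : Differentiable ℂ D) {b c c₀ R x : ℝ}
    (hbc : b < c) (hDb : D b ≠ 0) (hzero : ∀ z, D z = 0 → z.re < b)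
    (hsimple : ∀ z, D z = 0 → deriv D z ≠ 0) (hx : 0 < x) (hR : 0 < R) (hc₀ : 0 < c₀)
    (hh : ∀ z : ℂ, z.re ≤ c → |z.im| = R → c₀ * ‖z‖ ≤ ‖D z‖)
    (hstrip : ∃ u₀, ∀ z : ℂ, z.re ≤ u₀ → |z.im| ≤ R → 1 ≤ ‖D z‖) (S : Finset ℂ)
    (hS : ∀ z, z ∈ S ↔ D z = 0 ∧ |z.im| < R) :
    ‖(∫ y in -R..R, bromwich D b x (c + y * Complex.I)) - 2 * Real.pi * (1 / D b +
      ∑ z ∈ S, Complex.exp ((z - b) * x) / ((z - b) * deriv D z))‖ ≤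
        2 * (Real.exp ((c - b) * x) / (x * c₀ * R ^ 2)) := by
  classical
  obtain ⟨u₀, hu₀⟩ := hstrip
  set K := Real.exp ((c - b) * x) / (x * c₀ * R ^ 2) with hK
  set L := (∫ y in -R..R, bromwich D b x (c + y * Complex.I)) - 2 * Real.pi * (1 / D b +
      ∑ z ∈ S, Complex.exp ((z - b) * x) / ((z - b) * deriv D z)) with hL
  have hbS : (b : ℂ) ∉ S := fun h => hDb ((hS _).1 h).1
  have hbound : ∀ᶠ M in atTop, ‖L‖ ≤ 2 * K + Real.exp ((-M - b) * x) * (2 * R) := by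
    filter_upwards [eventually_gt_atTop (-u₀), eventually_gt_atTop (-b + 1),
      eventually_gt_atTop (-c)] with M hM1 hM2 hM3
    have hDne : ∀ z : ℂ, z.re = -M → |z.im| ≤ R → 1 ≤ ‖D z‖ := fun z hz hz' =>
      hu₀ z (by linarith) hz'
    -- the poles inside the rectangle
    have hrect : ∀ z ∈ Icc (-M) c ×ℂ Icc (-R) R, D z = 0 → z ∈ S := by
      intro z hz hz0
      refine (hS z).2 ⟨hz0, lt_of_le_of_ne (abs_le.2 hz.2) fun h => ?_⟩
      have h1 := hh z hz.1.2 h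
      rw [hz0, norm_zero] at h1
      have h2 := Complex.abs_im_le_norm z
      rw [h] at h2
      nlinarith
    have hclosed : IsClosed {z : ℂ | D z = 0 ∧ z ∉ S} := by
      have e : {z : ℂ | D z = 0 ∧ z ∉ S} = {z : ℂ | D z = 0} ∩ {z | R ≤ |z.im|} := by
        ext z
        simp only [mem_ofPred_eq, mem_inter_iff, hS]
        constructor
        · rintro ⟨h1, h2⟩; exact ⟨h1, not_lt.1 fun h => h2 ⟨h1, h⟩⟩
        · rintro ⟨h1, h2⟩; exact ⟨h1, fun h => absurd h.2 (not_lt.2 h2)⟩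
      rw [e]
      exact (isClosed_eq hD.continuous continuous_const).inter
        (isClosed_le continuous_const (by fun_prop))
    have hres := rectIntegral_eq_sum_residues (a := -M) (b := c) (c := -R) (d := R)
      (by linarith) (by linarith) hclosed.isOpen_compl
      (fun z hz h => h.2 (hrect z hz h.1)) (insert (b : ℂ) S) (by
        intro p hp
        rcases Finset.mem_insert.1 hp with rfl | hp
        · exact ⟨⟨by simp; linarith, by simpa using hbc⟩, by simpa using hR⟩
        · obtain ⟨h1, h2⟩ := (hS p).1 hp
          refine ⟨⟨not_le.1 fun h => ?_, (hzero p h1).trans hbc⟩, abs_lt.1 h2⟩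
          have := hu₀ p (by linarith) h2.le
          rw [h1, norm_zero] at this
          linarith)
      (fun z => if z = b then 1 / D b else Complex.exp ((z - b) * x) / ((z - b) * deriv D z))
      (bromwich D b x) (by
        intro z hz
        have hzb : z ≠ b := fun h => hz.2 (by simp [h])
        have hz0 : D z ≠ 0 := fun h => hz.1 ⟨h, fun h' => hz.2 (by simp [h'])⟩
        refine DifferentiableAt.differentiableWithinAt ?_
        refine DifferentiableAt.div (by fun_prop) (by fun_prop)
          (mul_ne_zero (sub_ne_zero.2 hzb) hz0))
      (by
        intro p hp
        rcases Finset.mem_insert.1 hp with rfl | hp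
        · simpa using tendsto_mul_bromwich_base hD x hDb
        · have hpb : p ≠ b := fun h => hbS (h ▸ hp)
          simp only [if_neg hpb]
          exact tendsto_mul_bromwich_zero hD ((hS p).1 hp).1 hpb (hsimple p ((hS p).1 hp).1))
    have hsum : ∑ z ∈ insert (b : ℂ) S, (if z = b then 1 / D b else
        Complex.exp ((z - b) * x) / ((z - b) * deriv D z)) =
        1 / D b + ∑ z ∈ S, Complex.exp ((z - b) * x) / ((z - b) * deriv D z) := by
      rw [Finset.sum_insert hbS, if_pos rfl]
      congr 1
      refine Finset.sum_congr rfl fun z hz => if_neg fun h : z = b => hbS (h ▸ hz)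
    rw [hsum, rectIntegral] at hres
    have e1 := norm_horizontal_integral_bromwich_le (b := b) (M := -M) (y := -R) hx hR hc₀
      (by linarith) (by rw [abs_neg, abs_of_pos hR]) hh
    have e2 := norm_horizontal_integral_bromwich_le (b := b) (M := -M) (y := R) hx hR hc₀
      (by linarith) (abs_of_pos hR) hh
    have e3 : ‖∫ y in -R..R, bromwich D b x ((-M : ℝ) + y * Complex.I)‖ ≤
        Real.exp ((-M - b) * x) * |R - -R| := by
      refine intervalIntegral.norm_integral_le_of_norm_le_const fun y hy => ?_
      rw [uIoc_of_le (by linarith)] at hy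
      rw [norm_bromwich]
      have f1 : ((-M : ℝ) + y * Complex.I : ℂ).re = -M := by simp
      have f2 := hDne ((-M : ℝ) + y * Complex.I) f1 (by simpa [abs_le] using ⟨hy.1.le, hy.2⟩)
      have f3 : 1 ≤ ‖((-M : ℝ) + y * Complex.I : ℂ) - b‖ := by
        refine le_trans ?_ (Complex.abs_re_le_norm _)
        rw [Complex.sub_re, f1, Complex.ofReal_re, abs_of_nonpos (by linarith)]
        linarith
      rw [f1]
      exact div_le_self (Real.exp_pos _).le (one_le_mul_of_one_le_of_one_le f3 f2)
    have e4 : |R - -R| = 2 * R := by rw [abs_of_pos (by linarith)]; ring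
    rw [e4] at e3
    set I₁ := ∫ t in -M..c, bromwich D b x (t + (-R : ℝ) * Complex.I)
    set I₂ := ∫ t in -M..c, bromwich D b x (t + R * Complex.I)
    set I₃ := ∫ y in -R..R, bromwich D b x ((-M : ℝ) + y * Complex.I)
    have e5 : L = Complex.I * (I₁ - I₂) + I₃ := by
      rw [hL]
      have hI := Complex.I_mul_I
      linear_combination (-Complex.I) * hres +
        ((∫ y in -R..R, bromwich D b x (c + y * Complex.I)) - I₃ - 2 * Real.pi * (1 / D b +
          ∑ z ∈ S, Complex.exp ((z - b) * x) / ((z - b) * deriv D z))) * hI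
    rw [e5]
    refine (norm_add_le _ _).trans (add_le_add ?_ e3)
    rw [norm_mul, Complex.norm_I, one_mul]
    refine (norm_sub_le _ _).trans ?_
    linarith
  have hlim : Tendsto (fun M : ℝ => 2 * K + Real.exp ((-M - b) * x) * (2 * R)) atTop
      (𝓝 (2 * K + 0 * (2 * R))) := by
    refine tendsto_const_nhds.add (Tendsto.mul_const _ (Real.tendsto_exp_atBot.comp ?_))
    refine Tendsto.atBot_mul_const hx ?_
    exact tendsto_atBot_add_const_right _ _ tendsto_neg_atTop_atBot
  rw [zero_mul, add_zero] at hlim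
  exact ge_of_tendsto hlim hbound

section LaplaceInversion

variable {w : ℝ → ℂ}

lemma continuous_primitive_of_integrable (hw : Integrable w) :
    Continuous fun t => ∫ x in (0 : ℝ)..t, w x :=
  intervalIntegral.continuous_primitive (fun _ _ => hw.intervalIntegrable) 0

lemma norm_primitive_le (hw : Integrable w) (t : ℝ) : ‖∫ x in (0 : ℝ)..t, w x‖ ≤ ∫ x, ‖w x‖ := by
  refine intervalIntegral.norm_integral_le_integral_norm_uIoc.trans ?_
  exact setIntegral_le_integral hw.norm (ae_of_all _ fun x => norm_nonneg _)

lemma norm_exp_neg_mul (s : ℂ) (t : ℝ) : ‖Complex.exp (-s * t)‖ = Real.exp (-s.re * t) := by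
  rw [Complex.norm_exp]; simp

lemma integrableOn_exp_neg_mul_primitive (hw : Integrable w) {s : ℂ} (hs : 0 < s.re) :
    IntegrableOn (fun t : ℝ => Complex.exp (-s * t) * ∫ x in (0 : ℝ)..t, w x) (Ioi 0) := by
  have h1 := continuous_primitive_of_integrable hw
  refine ((exp_neg_integrableOn_Ioi 0 hs).mul_const (∫ x, ‖w x‖)).mono'
    (Continuous.aestronglyMeasurable (by fun_prop)) (ae_of_all _ fun t => ?_)
  rw [norm_mul, norm_exp_neg_mul]
  gcongr
  exact norm_primitive_le hw t

/-- The Laplace transform of a primitive. -/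
lemma integral_exp_neg_mul_primitive (hw : Integrable w) (hc : ∀ t, 0 < t → ContinuousAt w t)
    {s : ℂ} (hs : 0 < s.re) :
    ∫ t in Ioi (0 : ℝ), Complex.exp (-s * t) * ∫ x in (0 : ℝ)..t, w x =
      (∫ t in Ioi (0 : ℝ), Complex.exp (-s * t) * w t) / s := by
  have hs0 : s ≠ 0 := by rintro rfl; simp at hs
  set V : ℝ → ℂ := fun t => ∫ x in (0 : ℝ)..t, w x with hV
  have hVc : Continuous V := continuous_primitive_of_integrable hw
  have hVd : ∀ t ∈ Ioi (0 : ℝ), HasDerivAt V (w t) t := fun t ht =>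
    intervalIntegral.integral_hasDerivAt_right hw.intervalIntegrable
      hw.aestronglyMeasurable.stronglyMeasurableAtFilter (hc t ht)
  set v : ℝ → ℂ := fun t => -(Complex.exp (-s * t) / s) with hv
  have hvd : ∀ t ∈ Ioi (0 : ℝ), HasDerivAt v (Complex.exp (-s * t)) t := by
    intro t _
    have h1 : HasDerivAt (fun t : ℝ => -s * (t : ℂ)) (-s) t := by
      simpa using (Complex.ofRealCLM.hasDerivAt (x := t)).const_mul (-s)
    refine (h1.cexp.div_const s).neg.congr_deriv ?_
    field_simp
  have hvc : Continuous v := by fun_prop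
  have hint : IntegrableOn (fun t : ℝ => Complex.exp (-s * t) * w t) (Ioi 0) := by
    refine Integrable.bdd_mul (c := 1) hw.integrableOn
      (Continuous.aestronglyMeasurable (by fun_prop)) ?_
    filter_upwards [ae_restrict_mem measurableSet_Ioi] with t ht
    rw [norm_exp_neg_mul, Real.exp_le_one_iff]
    have : 0 < s.re * t := mul_pos hs ht
    linarith
  have hzero : Tendsto (V * v) (𝓝[>] 0) (𝓝 0) := by
    have h1 : Tendsto (V * v) (𝓝[>] 0) (𝓝 ((V * v) 0)) :=
      ((hVc.mul hvc).tendsto 0).mono_left nhdsWithin_le_nhds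
    simpa [hV] using h1
  have hinfty : Tendsto (V * v) atTop (𝓝 0) := by
    have h1 : Tendsto (fun t : ℝ => (∫ x, ‖w x‖) * (Real.exp (-s.re * t) / ‖s‖)) atTop
        (𝓝 ((∫ x, ‖w x‖) * (0 / ‖s‖))) := by
      refine ((Real.tendsto_exp_atBot.comp ?_).div_const _).const_mul _
      exact tendsto_id.const_mul_atTop_of_neg (by linarith)
    rw [zero_div, mul_zero] at h1
    refine squeeze_zero_norm (fun t => ?_) h1
    rw [Pi.mul_apply, norm_mul, norm_neg, norm_div, norm_exp_neg_mul]
    gcongr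
    exact norm_primitive_le hw t
  have h2 := integral_Ioi_mul_deriv_eq_deriv_mul hVd hvd
    (by
      refine (integrableOn_exp_neg_mul_primitive hw hs).congr (ae_of_all _ fun t => ?_)
      exact mul_comm _ _)
    (by
      refine (hint.div_const s).neg.congr (ae_of_all _ fun t => ?_)
      simp only [Pi.neg_apply, Pi.mul_apply, hv]
      ring) hzero hinfty
  rw [sub_zero, zero_sub, ← integral_neg] at h2
  rw [← integral_div]
  calc _ = ∫ t in Ioi (0 : ℝ), V t * Complex.exp (-s * t) := by simp only [mul_comm, hV]
    _ = _ := h2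
    _ = _ := by
      congr 1; ext t; simp only [hv]; ring

/-- Laplace inversion for the primitive of an integrable function. -/
theorem tendsto_laplace_inversion (hw : Integrable w) (hc : ∀ t, 0 < t → ContinuousAt w t)
    {C R₀ : ℝ} (hdecay : ∀ y : ℝ, R₀ ≤ |y| →
      ‖∫ t in Ioi (0 : ℝ), Complex.exp (-(1 + y * Complex.I) * t) * w t‖ ≤ C / |y|)
    {R : ℕ → ℝ} (hR : Tendsto R atTop atTop) {x : ℝ} (hx : 0 < x) :
    Tendsto (fun j => ∫ y in -R j..R j, Complex.exp ((1 + y * Complex.I) * x) /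
        (1 + y * Complex.I) * ∫ t in Ioi (0 : ℝ), Complex.exp (-(1 + y * Complex.I) * t) * w t)
      atTop (𝓝 (2 * Real.pi * ∫ t in (0 : ℝ)..x, w t)) := by
  set L : ℝ → ℂ := fun y => ∫ t in Ioi (0 : ℝ), Complex.exp (-(1 + y * Complex.I) * t) * w t with hL
  set V : ℝ → ℂ := fun t => ∫ x in (0 : ℝ)..t, w x with hV
  have hVc : Continuous V := continuous_primitive_of_integrable hw
  set u : ℝ → ℂ := indicator (Ioi 0) fun t => Complex.exp (-1 * t) * V t with hu
  have hui : Integrable u := by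
    rw [hu, integrable_indicator_iff measurableSet_Ioi]
    exact integrableOn_exp_neg_mul_primitive hw (s := 1) (by simp)
  have hpi := Real.pi_pos
  have hF : ∀ ξ : ℝ, FourierTransform.fourier u ξ =
      L (2 * Real.pi * ξ) / (1 + (2 * Real.pi * ξ : ℝ) * Complex.I) := by
    intro ξ
    rw [hL, ← integral_exp_neg_mul_primitive hw hc (by simp),
      Real.fourier_real_eq_integral_exp_smul, ← integral_indicator measurableSet_Ioi]
    congr 1
    ext t
    by_cases ht : t ∈ Ioi (0 : ℝ)
    · rw [indicator_of_mem ht, hu, indicator_of_mem ht, smul_eq_mul, ← mul_assoc, ← Complex.exp_add]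
      congr 2
      push_cast; ring
    · rw [indicator_of_notMem ht, hu, indicator_of_notMem ht, smul_zero]
  have hFc : Continuous (FourierTransform.fourier u) :=
    VectorFourier.fourierIntegral_continuous Real.continuous_fourierChar
      (innerSL ℝ).continuous₂ hui
  have hFi : Integrable (FourierTransform.fourier u) := by
    set R' := max R₀ 1
    set N := ∫ t, ‖u t‖
    have hN : 0 ≤ N := integral_nonneg fun t => norm_nonneg _
    have hNb : ∀ ξ : ℝ, ‖FourierTransform.fourier u ξ‖ ≤ N := fun ξ =>
      VectorFourier.norm_fourierIntegral_le_integral_norm _ _ _ _ _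
    refine (integrable_inv_one_add_sq.const_mul (2 * |C| + N * (1 + R' ^ 2))).mono'
      hFc.aestronglyMeasurable (ae_of_all _ fun ξ => ?_)
    have hξ : ξ ^ 2 ≤ |2 * Real.pi * ξ| ^ 2 := by
      rw [sq_abs, mul_pow]
      have : 1 ≤ (2 * Real.pi) ^ 2 := by nlinarith [Real.pi_gt_three]
      nlinarith [sq_nonneg ξ]
    have hpos : 0 < 1 + ξ ^ 2 := by positivity
    rw [← div_eq_mul_inv, le_div_iff₀ hpos]
    rcases le_total R' |2 * Real.pi * ξ| with h | h
    · have h1 : 1 ≤ |2 * Real.pi * ξ| := (le_max_right _ _).trans h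
      have h2 := hdecay (2 * Real.pi * ξ) ((le_max_left _ _).trans h)
      set a := |2 * Real.pi * ξ| with ha
      have ha0 : 0 < a := by linarith
      have h3 : a ≤ ‖(1 + (2 * Real.pi * ξ : ℝ) * Complex.I : ℂ)‖ := by
        refine le_trans ?_ (Complex.abs_im_le_norm _)
        simp [ha]
      have h4 : ‖FourierTransform.fourier u ξ‖ ≤ |C| / a / a := by
        rw [hF, norm_div]
        have h5 : C / a ≤ |C| / a := by gcongr; exact le_abs_self C
        exact div_le_div₀ (by positivity) (h2.trans h5) ha0 h3
      have h6 : 1 + ξ ^ 2 ≤ 2 * (a * a) := by nlinarith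
      calc _ ≤ |C| / a / a * (2 * (a * a)) := by gcongr
        _ = 2 * |C| := by field_simp
        _ ≤ _ := by
          have : 0 ≤ N * (1 + R' ^ 2) := by positivity
          linarith
    · have h1 : |2 * Real.pi * ξ| ^ 2 ≤ R' ^ 2 := by gcongr
      calc _ ≤ N * (1 + R' ^ 2) := mul_le_mul (hNb ξ) (by linarith) hpos.le hN
        _ ≤ _ := by linarith [abs_nonneg C]
  have huc : ContinuousAt u x := by
    have h1 : ContinuousAt (fun t : ℝ => Complex.exp (-1 * t) * V t) x := by fun_prop
    refine h1.congr ?_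
    filter_upwards [Ioi_mem_nhds hx] with t ht
    rw [hu, indicator_of_mem ht]
  have hinv := hui.fourierInv_fourier_eq hFi huc
  rw [Real.fourierInv_eq'] at hinv
  set F : ℝ → ℂ := fun y => Complex.exp (y * x * Complex.I) * (L y / (1 + y * Complex.I)) with hFdef
  have hFF : ∀ ξ : ℝ, Complex.exp (↑(2 * Real.pi * inner ℝ ξ x) * Complex.I) •
      FourierTransform.fourier u ξ = F (2 * Real.pi * ξ) := by
    intro ξ
    rw [hF, smul_eq_mul, hFdef]
    simp only [RCLike.inner_apply, conj_trivial]
    push_cast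
    ring_nf
  have hFint : Integrable fun ξ : ℝ => F (2 * Real.pi * ξ) := by
    simp_rw [← hFF]
    refine Integrable.bdd_mul (c := 1) hFi (Continuous.aestronglyMeasurable (by fun_prop))
      (ae_of_all _ fun ξ => ?_)
    rw [Complex.norm_exp_ofReal_mul_I]
  simp_rw [hFF] at hinv
  have hlim := intervalIntegral_tendsto_integral hFint
    (a := fun j => -(R j / (2 * Real.pi))) (b := fun j => R j / (2 * Real.pi))
    (tendsto_neg_atTop_atBot.comp (hR.atTop_div_const (by positivity)))
    (hR.atTop_div_const (by positivity))
  rw [hinv] at hlim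
  have h1 := hlim.const_mul (2 * Real.pi * Complex.exp x)
  have h2 : 2 * Real.pi * Complex.exp x * u x = 2 * Real.pi * V x := by
    rw [hu, indicator_of_mem (show x ∈ Ioi 0 from hx)]
    have : Complex.exp x * Complex.exp (-1 * x) = 1 := by rw [← Complex.exp_add]; simp
    linear_combination (2 * Real.pi * V x) * this
  rw [h2] at h1
  refine h1.congr fun j => ?_
  rw [intervalIntegral.integral_comp_mul_left (fun y => F y) (by positivity)]
  have e1 : 2 * Real.pi * -(R j / (2 * Real.pi)) = -R j := by field_simp
  have e2 : 2 * Real.pi * (R j / (2 * Real.pi)) = R j := by field_simp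
  rw [e1, e2, Complex.real_smul, ← mul_assoc]
  have e3 : 2 * (Real.pi : ℂ) * Complex.exp x * ((2 * Real.pi)⁻¹ : ℝ) = Complex.exp x := by
    have : (Real.pi : ℂ) ≠ 0 := Complex.ofReal_ne_zero.2 hpi.ne'
    push_cast; field_simp
  rw [e3, ← intervalIntegral.integral_const_mul]
  congr 1
  ext y
  rw [hFdef]
  have e4 : Complex.exp ((1 + y * Complex.I) * x) =
      Complex.exp x * Complex.exp (y * x * Complex.I) := by
    rw [← Complex.exp_add]; ring_nf
  rw [e4]
  ring

end LaplaceInversion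

/-- A function whose reciprocal is a Laplace transform has no zeros in the half-plane of
convergence. -/
lemma re_le_of_eq_zero_of_laplace {D : ℂ → ℂ} (hD : Differentiable ℂ D) (hne : ∃ z, D z ≠ 0) {φ : ℝ}
    {W : ℝ → ℝ}
    (hint : ∀ z : ℂ, φ < z.re → IntegrableOn (fun x : ℝ => Complex.exp (-z * x) * W x) (Ioi 0))
    (hlap : ∀ z : ℂ, φ < z.re → ∫ x in Ioi (0 : ℝ), Complex.exp (-z * x) * W x = 1 / D z)
    {z : ℂ} (hz : D z = 0) : z.re ≤ φ := by
  by_contra! hlt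
  obtain ⟨a, ha, haz⟩ := exists_between hlt
  set K := ∫ x in Ioi (0 : ℝ), ‖Complex.exp (-(a : ℂ) * x) * W x‖ with hK
  have hK0 : 0 ≤ K := integral_nonneg fun x => norm_nonneg _
  have hbound : ∀ y : ℂ, a < y.re → ‖1 / D y‖ ≤ K := by
    intro y hy
    rw [← hlap y (ha.trans hy)]
    refine (norm_integral_le_integral_norm _).trans ?_
    refine setIntegral_mono_on (hint y (ha.trans hy)).norm (hint a (by simpa using ha)).norm
      measurableSet_Ioi fun x hx => ?_
    rw [norm_mul, norm_mul, norm_exp_neg_mul, norm_exp_neg_mul, Complex.ofReal_re]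
    have : 0 < x := hx
    gcongr
  obtain ⟨z₁, hz₁⟩ := hne
  have hev : ∀ᶠ y in 𝓝[≠] z, D y ≠ 0 := by
    rcases (hD.analyticAt z).eventually_eq_zero_or_eventually_ne_zero with h | h
    · exfalso
      have hA : AnalyticOnNhd ℂ D univ := fun z _ => hD.analyticAt z
      exact hz₁ (congrFun (hA.eq_of_eventuallyEq (g := fun _ => 0)
        (fun z _ => analyticAt_const) h) z₁)
    · exact h
  have h1 : Tendsto D (𝓝[≠] z) (𝓝 0) := by
    rw [← hz]; exact (hD.continuous.tendsto z).mono_left nhdsWithin_le_nhds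
  have h2 : ∀ᶠ y in 𝓝[≠] z, ‖D y‖ < 1 / (K + 1) := by
    have := h1.norm
    rw [norm_zero] at this
    exact this.eventually_lt_const (by positivity)
  have h3 : ∀ᶠ y in 𝓝[≠] z, a < y.re :=
    nhdsWithin_le_nhds (Complex.continuous_re.continuousAt.eventually_const_lt haz)
  obtain ⟨y, ⟨h4, h5⟩, h6⟩ := ((hev.and h2).and h3).exists
  have h7 := hbound y h6
  have h8 : 0 < ‖D y‖ := norm_pos_iff.2 h4
  rw [norm_div, norm_one, div_le_iff₀ h8] at h7
  rw [lt_div_iff₀ (by positivity)] at h5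
  nlinarith

section Series

variable {D : ℂ → ℂ} {A β : ℂ} {p m k φ : ℝ} {W : ℝ → ℝ}

lemma ExpPowerAsymptotic.exists_symbol_ne_zero {c : ℝ}
    (h : ExpPowerAsymptotic (fun w => D (-w)) A β p m k c) : ∃ z, D z ≠ 0 := by
  obtain ⟨w, hw⟩ := h.exists_ne_zero
  exact ⟨-w, hw⟩

lemma finite_zeros_strip (hD : Differentiable ℂ D) (hne : ∃ z, D z ≠ 0)
    (hre : ∀ z, D z = 0 → z.re ≤ φ) {R : ℝ}
    (hstrip : ∃ u₀, ∀ z : ℂ, z.re ≤ u₀ → |z.im| ≤ R → 1 ≤ ‖D z‖) :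
    {z | D z = 0 ∧ |z.im| < R}.Finite := by
  obtain ⟨u₀, hu₀⟩ := hstrip
  refine (finite_zeros_inter hD hne (|u₀| + |φ| + R)).subset ?_
  rintro z ⟨hz, hzi⟩
  refine ⟨hz, ?_⟩
  have h1 : u₀ < z.re := by
    by_contra! hlt
    have := hu₀ z hlt hzi.le
    rw [hz, norm_zero] at this
    linarith
  have h2 : |z.re| ≤ |u₀| + |φ| := by
    rw [abs_le]
    have := hre z hz
    constructor <;> linarith [neg_abs_le u₀, le_abs_self φ, abs_nonneg φ, abs_nonneg u₀]
  rw [Metric.mem_closedBall, dist_zero_right]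
  linarith [Complex.norm_le_abs_re_add_abs_im z]

/-- Residue expansion of the primitive of the exponentially tilted scale function. -/
lemma hasSum_primitive (h : ExpPowerAsymptotic (fun w => D (-w)) A β p m k (φ + 1 + 1))
    (hconj : ∀ z, D (starRingEnd ℂ z) = starRingEnd ℂ (D z))
    (hre : ∀ z, D z = 0 → z.re ≤ φ) (hsimple : ∀ z, D z = 0 → deriv D z ≠ 0)
    (hW0 : ∀ x < 0, W x = 0) (hWc : ContinuousOn W (Ici 0))
    (hint : ∀ z : ℂ, φ < z.re → IntegrableOn (fun x : ℝ => Complex.exp (-z * x) * W x) (Ioi 0))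
    (hlap : ∀ z : ℂ, φ < z.re → ∫ x in Ioi (0 : ℝ), Complex.exp (-z * x) * W x = 1 / D z)
    {x : ℝ} (hx : 0 < x) :
    HasSum (fun z : {z : ℂ | D z = 0} => Complex.exp ((z - (φ + 1 : ℝ)) * x) /
        ((z - (φ + 1 : ℝ)) * deriv D z))
      ((∫ t in (0 : ℝ)..x, Complex.exp (-(φ + 1 : ℝ) * t) * W t) - 1 / D (φ + 1 : ℝ)) := by
  set b : ℝ := φ + 1 with hb
  have hD := h.differentiable_symbol
  have hDb : D b ≠ 0 := fun h0 => by
    have := hre _ h0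
    rw [Complex.ofReal_re] at this
    linarith
  have hzb : ∀ z, D z = 0 → z.re < b := fun z hz => by linarith [hre z hz]
  set w : ℝ → ℂ := fun t => Complex.exp (-b * t) * W t with hw
  have hwi : Integrable w := by
    rw [← integrableOn_univ, ← Iio_union_Ici (a := (0 : ℝ)), integrableOn_union,
      integrableOn_Ici_iff_integrableOn_Ioi]
    refine ⟨?_, hint b (by rw [Complex.ofReal_re]; linarith)⟩
    refine (integrableOn_zero (μ := volume) (s := Iio (0 : ℝ))).congr_fun (fun t ht => ?_)
      measurableSet_Iio
    simp [hw, hW0 t ht]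
  have hwc : ∀ t, 0 < t → ContinuousAt w t := by
    intro t ht
    have := hWc.continuousAt (Ici_mem_nhds ht)
    exact ContinuousAt.mul (by fun_prop) (Complex.continuous_ofReal.continuousAt.comp this)
  have hL : ∀ y : ℝ, ∫ t in Ioi (0 : ℝ), Complex.exp (-(1 + y * Complex.I) * t) * w t =
      1 / D (((b + 1 : ℝ) : ℂ) + y * Complex.I) := by
    intro y
    rw [← hlap _ (by simp; linarith)]
    congr 1
    ext t
    rw [hw]
    simp only
    rw [← mul_assoc, ← Complex.exp_add]
    congr 2
    push_cast; ring
  obtain ⟨R₀, c₁, hc₁, hvert⟩ := h.exists_symbol_vertical hconj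
  obtain ⟨R, c₀, hc₀, hR, hR0, hhor⟩ := h.exists_symbol_horizontal hconj
  have hinv := tendsto_laplace_inversion hwi hwc (C := c₁⁻¹) (R₀ := max R₀ 1) (fun y hy => by
    rw [hL, norm_div, norm_one]
    have h1 := hvert (((b + 1 : ℝ) : ℂ) + y * Complex.I) (by simp)
      (by simpa using (le_max_left _ _).trans hy)
    have h2 : |y| ≤ ‖((b + 1 : ℝ) : ℂ) + y * Complex.I‖ := by
      refine le_trans ?_ (Complex.abs_im_le_norm _)
      simp
    have h3 : 0 < |y| := lt_of_lt_of_le one_pos ((le_max_right _ _).trans hy)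
    rw [← one_div, div_div]
    gcongr
    exact (mul_le_mul_of_nonneg_left h2 hc₁.le).trans h1) hR hx
  have hbrom : ∀ y : ℝ, Complex.exp ((1 + y * Complex.I) * x) / (1 + y * Complex.I) *
      (∫ t in Ioi (0 : ℝ), Complex.exp (-(1 + y * Complex.I) * t) * w t) =
      bromwich D b x ((b + 1 : ℝ) + y * Complex.I) := by
    intro y
    have e : ((b + 1 : ℝ) : ℂ) + y * Complex.I - b = 1 + y * Complex.I := by push_cast; ring
    rw [hL, bromwich, e, div_mul_div_comm, mul_one]
  simp_rw [hbrom] at hinv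
  set T : {z : ℂ | D z = 0} → ℂ := fun z => Complex.exp ((z - b) * x) / ((z - b) * deriv D z)
    with hT
  have hfin : ∀ j, {z | D z = 0 ∧ |z.im| < R j}.Finite := fun j =>
    finite_zeros_strip hD h.exists_symbol_ne_zero hre (h.exists_symbol_strip hconj (R j))
  classical
  have hclose : ∀ j, ‖(∫ y in -R j..R j, bromwich D b x ((b + 1 : ℝ) + y * Complex.I)) -
      2 * Real.pi * (1 / D b + ∑ z ∈ ((hfin j).toFinset).subtype (· ∈ {z : ℂ | D z = 0}), T z)‖ ≤
      2 * (Real.exp ((b + 1 - b) * x) / (x * c₀ * R j ^ 2)) := by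
    intro j
    have h1 := norm_bromwich_integral_sub_le hD (lt_add_one b) hDb hzb hsimple hx (hR0 j) hc₀
      (hhor j) (h.exists_symbol_strip hconj (R j)) (hfin j).toFinset (fun z => by simp)
    rwa [← Finset.sum_subtype_of_mem (p := (· ∈ {z : ℂ | D z = 0}))
      (fun z => Complex.exp ((z - b) * x) / ((z - b) * deriv D z))
      (fun z hz => ((hfin j).mem_toFinset.1 hz).1)] at h1
  have hsum : Summable T := by
    refine Summable.of_norm_bounded
      (((h.summable_symbol_zeros hconj (fun z hz => by linarith [hre z hz]) hx)).mul_left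
        (Real.exp (-b * x))) fun z => ?_
    have h1 : 1 ≤ ‖(z : ℂ) - b‖ := by
      refine le_trans ?_ (Complex.abs_re_le_norm _)
      rw [Complex.sub_re, Complex.ofReal_re, abs_of_nonpos (by linarith [hre z z.2])]
      linarith [hre z z.2]
    have h2 : 0 < ‖deriv D z‖ := norm_pos_iff.2 (hsimple z z.2)
    rw [hT, norm_div, norm_mul, Complex.norm_exp, mul_div_assoc', ← Real.exp_add]
    have h3 : (((z : ℂ) - b) * x).re = -b * x + x * (z : ℂ).re := by simp; ring
    rw [h3]
    gcongr
    exact le_mul_of_one_le_left h2.le h1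
  have hatTop : Tendsto (fun j => ((hfin j).toFinset).subtype (· ∈ {z : ℂ | D z = 0})) atTop
      atTop := by
    refine tendsto_atTop.2 fun F => ?_
    have h1 : ∀ᶠ j in atTop, ∀ z ∈ F, |(z : ℂ).im| < R j :=
      (Finset.eventually_all F).2 fun z _ => hR.eventually_gt_atTop _
    filter_upwards [h1] with j hj z hz
    rw [Finset.mem_subtype, Set.Finite.mem_toFinset]
    exact ⟨z.2, hj z hz⟩
  have hlim1 := ((hsum.hasSum.comp hatTop).const_add (1 / D b)).const_mul (2 * Real.pi : ℂ)
  have hlim2 : Tendsto (fun j => 2 * (Real.exp ((b + 1 - b) * x) / (x * c₀ * R j ^ 2))) atTop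
      (𝓝 0) := by
    have h1 : Tendsto (fun j => x * c₀ * R j ^ 2) atTop atTop :=
      ((tendsto_pow_atTop two_ne_zero).comp hR).const_mul_atTop (by positivity)
    simpa using (h1.const_div_atTop (Real.exp ((b + 1 - b) * x))).const_mul 2
  have hlim3 := hinv.sub (squeeze_zero_norm hclose hlim2)
  simp only [sub_sub_cancel, sub_zero] at hlim3
  have heq := tendsto_nhds_unique hlim3 hlim1
  have hpi : (2 * Real.pi : ℂ) ≠ 0 := by simp [Real.pi_ne_zero]
  have heq' := mul_left_cancel₀ hpi heq
  rw [heq', add_sub_cancel_left]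
  exact hsum.hasSum

/-- The scale function as a sum over the zeros of its symbol. -/
theorem hasSum_scale (h : ExpPowerAsymptotic (fun w => D (-w)) A β p m k (φ + 1 + 1))
    (hconj : ∀ z, D (starRingEnd ℂ z) = starRingEnd ℂ (D z))
    (hre : ∀ z, D z = 0 → z.re ≤ φ) (hsimple : ∀ z, D z = 0 → deriv D z ≠ 0)
    (hW0 : ∀ x < 0, W x = 0) (hWc : ContinuousOn W (Ici 0))
    (hint : ∀ z : ℂ, φ < z.re → IntegrableOn (fun x : ℝ => Complex.exp (-z * x) * W x) (Ioi 0))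
    (hlap : ∀ z : ℂ, φ < z.re → ∫ x in Ioi (0 : ℝ), Complex.exp (-z * x) * W x = 1 / D z)
    {x : ℝ} (hx : 0 < x) :
    HasSum (fun z : {z : ℂ | D z = 0} => Complex.exp (z * x) / deriv D z) (W x) := by
  have hV := fun (x : ℝ) (hx : 0 < x) =>
    hasSum_primitive h hconj hre hsimple hW0 hWc hint hlap hx
  set b : ℝ := φ + 1 with hb
  set u : {z : ℂ | D z = 0} → ℝ := fun z =>
    Real.exp (-b * (x / 2)) * (Real.exp (x / 2 * (z : ℂ).re) / ‖deriv D z‖) with hu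
  have husum : Summable u :=
    (h.summable_symbol_zeros hconj (fun z hz => by linarith [hre z hz]) (half_pos hx)).mul_left _
  have hne : ∀ z : {z : ℂ | D z = 0}, (z : ℂ) - b ≠ 0 := by
    intro z h0
    have := congrArg Complex.re h0
    simp only [Complex.sub_re, Complex.ofReal_re, Complex.zero_re] at this
    linarith [hre z z.2]
  have hbound : ∀ (z : {z : ℂ | D z = 0}) (y : ℝ), y ∈ Ioi (x / 2) →
      ‖Complex.exp ((z - b) * y) / deriv D z‖ ≤ u z := by
    intro z y hy
    rw [hu, norm_div, Complex.norm_exp]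
    simp only
    rw [mul_div_assoc', ← Real.exp_add]
    gcongr
    have h1 : (((z : ℂ) - b) * y).re = ((z : ℂ).re - b) * y := by simp
    rw [h1]
    have h2 := hre z z.2
    have h3 : x / 2 < y := hy
    nlinarith
  have hder := hasDerivAt_tsum_of_isPreconnected (y₀ := x) (y := x) husum
    (isOpen_Ioi (a := x / 2)) isPreconnected_Ioi
    (g := fun (z : {z : ℂ | D z = 0}) (y : ℝ) =>
      Complex.exp ((z - b) * y) / ((z - b) * deriv D z))
    (g' := fun z y => Complex.exp ((z - b) * y) / deriv D z)
    (fun z y _ => by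
      have h1 : HasDerivAt (fun y : ℝ => ((z : ℂ) - b) * (y : ℂ)) ((z : ℂ) - b) y := by
        simpa using (Complex.ofRealCLM.hasDerivAt (x := y)).const_mul ((z : ℂ) - b)
      refine (h1.cexp.div_const _).congr_deriv ?_
      rw [mul_comm (Complex.exp _), mul_div_mul_left _ _ (hne z)])
    hbound (half_lt_self hx) (hV x hx).summable (half_lt_self hx)
  have hwloc : ∀ y, 0 < y → ContinuousAt (fun t : ℝ => Complex.exp (-(b : ℂ) * t) * W t) y :=
    fun y hy => ContinuousAt.mul (by fun_prop)
      (Complex.continuous_ofReal.continuousAt.comp (hWc.continuousAt (Ici_mem_nhds hy)))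
  have hcont : ContinuousOn (fun t : ℝ => Complex.exp (-(b : ℂ) * t) * W t) (Ici 0) :=
    ContinuousOn.mul (by fun_prop) (Complex.continuous_ofReal.comp_continuousOn hWc)
  have hder2 : HasDerivAt (fun x : ℝ => (∫ t in (0 : ℝ)..x, Complex.exp (-(b : ℂ) * t) * W t) -
      1 / D b) (Complex.exp (-(b : ℂ) * x) * W x) x := by
    refine (intervalIntegral.integral_hasDerivAt_right ?_ ?_ (hwloc x hx)).sub_const _
    · exact (hcont.mono (by rw [uIcc_of_le hx.le]; exact Icc_subset_Ici_self)).intervalIntegrable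
    · exact ContinuousOn.stronglyMeasurableAtFilter isOpen_Ioi
        (hcont.mono Ioi_subset_Ici_self) x hx
  have heq := hder.unique (hder2.congr_of_eventuallyEq (by
    filter_upwards [Ioi_mem_nhds hx] with y hy using (hV y hy).tsum_eq))
  have hs : Summable fun z : {z : ℂ | D z = 0} => Complex.exp ((z - b) * x) / deriv D z :=
    Summable.of_norm_bounded husum fun z => hbound z x (half_lt_self hx)
  have h1 := (heq ▸ hs.hasSum).mul_left (Complex.exp (b * x))
  rw [← mul_assoc, ← Complex.exp_add, neg_mul, add_neg_cancel, Complex.exp_zero, one_mul] at h1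
  refine h1.congr_fun fun z => ?_
  rw [mul_div_assoc', ← Complex.exp_add]
  ring_nf

end Series

/-- An infinite set with finite sublevel sets can be enumerated monotonically. -/
lemma exists_monotone_enumeration {α : Type*} {U : Set α} (hU : U.Infinite) (r : α → ℝ)
    (hfin : ∀ R, {x ∈ U | r x ≤ R}.Finite) :
    ∃ ζ : ℕ → α, Function.Injective ζ ∧ range ζ = U ∧ Monotone fun n => r (ζ n) := by
  classical
  have hmin : ∀ F : Finset α, ∃ x ∈ U, x ∉ F ∧ ∀ y ∈ U, y ∉ F → r x ≤ r y := by
    intro F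
    obtain ⟨x₀, hx₀, hx₀F⟩ := hU.exists_notMem_finset F
    obtain ⟨x, ⟨⟨hx, hxF⟩, hxr⟩, hxm⟩ := ((hfin (r x₀)).subset
      (fun y (hy : y ∈ {y | (y ∈ U ∧ y ∉ F) ∧ r y ≤ r x₀}) => ⟨hy.1.1, hy.2⟩)).exists_minimalFor r _
      ⟨x₀, ⟨hx₀, hx₀F⟩, le_rfl⟩
    refine ⟨x, hx, hxF, fun y hy hyF => ?_⟩
    rcases le_total (r y) (r x) with h | h
    · exact hxm ⟨⟨hy, hyF⟩, h.trans hxr⟩ h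
    · exact h
  choose m hmU hmF hmr using hmin
  let F : ℕ → Finset α := fun n => Nat.rec ∅ (fun _ F => insert (m F) F) n
  have hF : ∀ n, F (n + 1) = insert (m (F n)) (F n) := fun n => rfl
  have hFm : Monotone F := monotone_nat_of_le_succ fun n => by
    rw [hF]; exact Finset.subset_insert _ _
  have hmem : ∀ i j, i < j → m (F i) ∈ F j := fun i j hij =>
    hFm (Nat.succ_le_of_lt hij) (by rw [Nat.succ_eq_add_one, hF]; exact Finset.mem_insert_self _ _)
  have hinj : Function.Injective fun n => m (F n) := by
    intro i j h
    have hij : m (F i) = m (F j) := h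
    rcases lt_trichotomy i j with h | h | h
    · exact absurd (hij ▸ hmem i j h) (hmF (F j))
    · exact h
    · exact absurd (hij.symm ▸ hmem j i h) (hmF (F i))
  refine ⟨fun n => m (F n), hinj, subset_antisymm ?_ fun x hx => ?_, ?_⟩
  · rintro _ ⟨n, rfl⟩
    exact hmU _
  · by_contra hxr
    have hxF : ∀ n, x ∉ F n := by
      intro n
      induction n with
      | zero => simp [F]
      | succ n ih =>
        rw [hF, Finset.mem_insert, not_or]
        exact ⟨fun h => hxr ⟨n, h.symm⟩, ih⟩
    refine Set.infinite_range_of_injective hinj ((hfin (r x)).subset ?_)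
    rintro _ ⟨n, rfl⟩
    exact ⟨hmU _, hmr _ x hx (hxF n)⟩
  · refine monotone_nat_of_le_succ fun n => hmr _ _ (hmU _) fun h => hmF (F (n + 1)) ?_
    exact hFm (Nat.le_succ n) h

/-- Grouping the zeros of a real symbol into conjugate pairs. -/
lemma tendstoUniformlyOn_conj_pairs {D : ℂ → ℂ} {φ a : ℝ} (haφ : a < φ) (ha : a ≤ 0)
    (hDa : D a = 0) (hDφ : D φ = 0) (hconj : ∀ z, D (starRingEnd ℂ z) = starRingEnd ℂ (D z))
    (hzero : ∀ z, D z = 0 → z = a ∨ z = φ ∨ (z.im ≠ 0 ∧ z.re < a)) {ζ : ℕ → ℂ}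
    (hζ : BijOn ζ (Ici 1) {z : ℂ | 0 < z.re ∧ 0 < z.im ∧ D (-z) = 0})
    (hsum : ∀ s : ℝ, 0 < s →
      Summable fun z : {z : ℂ | D z = 0} => Real.exp (s * (z : ℂ).re) / ‖deriv D z‖)
    {W : ℝ → ℝ} (hW : ∀ x : ℝ, 0 < x →
      HasSum (fun z : {z : ℂ | D z = 0} => Complex.exp (z * x) / deriv D z) (W x))
    {ε : ℝ} (hε : 0 < ε) :
    TendstoUniformlyOn (fun (N : ℕ) (x : ℝ) => Complex.exp (φ * x) / deriv D φ +
      Complex.exp (a * x) / deriv D a +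
      2 * ((∑ n ∈ Finset.Icc 1 N, (Complex.exp (-ζ n * x) / deriv D (-ζ n)).re : ℝ) : ℂ))
      (fun x => (W x : ℂ)) atTop (Ici ε) := by
  classical
  obtain ⟨g, hg⟩ : ∃ g : ℝ → ℂ → ℂ, ∀ x z, g x z = Complex.exp (z * x) / deriv D z :=
    ⟨_, fun _ _ => rfl⟩
  simp only [← hg] at hW ⊢
  have hgc : ∀ x z, g x (starRingEnd ℂ z) = starRingEnd ℂ (g x z) := by
    intro x z
    rw [hg, hg, deriv_conj_of_conj hconj, map_div₀, ← Complex.exp_conj, map_mul,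
      Complex.conj_ofReal]
  set Z : Set ℂ := {z | D z = 0 ∧ z ≠ φ} with hZ
  -- the zeros that have been used in the `N`-th partial sum
  set F : ℕ → Finset ℂ := fun N => insert (a : ℂ) ((Finset.Icc 1 N).image (fun n => -ζ n) ∪
    (Finset.Icc 1 N).image (fun n => -starRingEnd ℂ (ζ n))) with hF
  have hζ1 : ∀ n, 1 ≤ n → 0 < (ζ n).re ∧ 0 < (ζ n).im ∧ D (-ζ n) = 0 := fun n hn =>
    hζ.mapsTo hn
  have hFZ : ∀ N, ∀ z ∈ F N, z ∈ Z := by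
    intro N z hz
    simp only [hF, Finset.mem_insert, Finset.mem_union, Finset.mem_image, Finset.mem_Icc] at hz
    rcases hz with rfl | ⟨n, hn, rfl⟩ | ⟨n, hn, rfl⟩
    · exact ⟨hDa, fun h => haφ.ne (Complex.ofReal_injective h)⟩
    · obtain ⟨-, h2, h3⟩ := hζ1 n hn.1
      refine ⟨h3, fun h => ?_⟩
      have := congrArg Complex.im h
      simp at this
      linarith
    · obtain ⟨-, h2, h3⟩ := hζ1 n hn.1
      refine ⟨by rw [← map_neg, hconj, h3, map_zero], fun h => ?_⟩
      have := congrArg Complex.im h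
      simp at this
      linarith
  have hinj : ∀ N, InjOn ζ (Finset.Icc 1 N) := fun N =>
    hζ.injOn.mono fun n hn => (Finset.mem_Icc.1 hn).1
  have hFsum : ∀ N x, ∑ z ∈ F N, g x z = g x a +
      2 * ((∑ n ∈ Finset.Icc 1 N, (g x (-ζ n)).re : ℝ) : ℂ) := by
    intro N x
    have hdisj : Disjoint ((Finset.Icc 1 N).image (fun n => -ζ n))
        ((Finset.Icc 1 N).image (fun n => -starRingEnd ℂ (ζ n))) := by
      rw [Finset.disjoint_left]
      intro z hz hz'
      obtain ⟨n, hn, rfl⟩ := Finset.mem_image.1 hz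
      obtain ⟨n', hn', h⟩ := Finset.mem_image.1 hz'
      have h1 := (hζ1 n (Finset.mem_Icc.1 hn).1).2.1
      have h2 := (hζ1 n' (Finset.mem_Icc.1 hn').1).2.1
      have := congrArg Complex.im h
      simp at this
      linarith
    have hnot : (a : ℂ) ∉ (Finset.Icc 1 N).image (fun n => -ζ n) ∪
        (Finset.Icc 1 N).image (fun n => -starRingEnd ℂ (ζ n)) := by
      simp only [Finset.mem_union, Finset.mem_image, Finset.mem_Icc, not_or, not_exists, not_and]
      constructor
      · intro n hn h
        have h1 := (hζ1 n hn.1).2.1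
        have := congrArg Complex.im h
        simp at this
        linarith
      · intro n hn h
        have h1 := (hζ1 n hn.1).2.1
        have := congrArg Complex.im h
        simp at this
        linarith
    rw [hF, Finset.sum_insert hnot, Finset.sum_union hdisj,
      Finset.sum_image (fun n hn n' hn' h => hinj N hn hn' (neg_injective h)),
      Finset.sum_image (fun n hn n' hn' h => hinj N hn hn'
        ((starRingEnd ℂ).injective (neg_injective h))), ← Finset.sum_add_distrib,
      Complex.ofReal_sum, Finset.mul_sum]
    congr 1
    refine Finset.sum_congr rfl fun n _ => ?_
    rw [← map_neg, hgc, Complex.add_conj]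
    push_cast
    rfl
  have hatTop : Tendsto (fun N => (F N).subtype (· ∈ Z)) atTop atTop := by
    refine tendsto_atTop.2 fun G => ?_
    have hG : ∀ z ∈ G, ∀ᶠ N in atTop, (z : ℂ) ∈ F N := by
      intro z _
      simp only [hF, Finset.mem_insert, Finset.mem_union, Finset.mem_image, Finset.mem_Icc]
      rcases hzero z z.2.1 with h | h | ⟨h1, h2⟩
      · exact Eventually.of_forall fun N => Or.inl h
      · exact absurd h z.2.2
      · rcases lt_or_gt_of_ne h1 with h3 | h3
        · obtain ⟨n, hn, hnz⟩ := hζ.surjOn (show -(z : ℂ) ∈ _ from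
            ⟨by simp; linarith, by simpa using h3, by simpa using z.2.1⟩)
          filter_upwards [eventually_ge_atTop n] with N hN
          exact Or.inr (Or.inl ⟨n, ⟨hn, hN⟩, by rw [hnz, neg_neg]⟩)
        · obtain ⟨n, hn, hnz⟩ := hζ.surjOn (show -starRingEnd ℂ (z : ℂ) ∈ _ from
            ⟨by simp; linarith, by simpa using h3, by simp [hconj, z.2.1]⟩)
          filter_upwards [eventually_ge_atTop n] with N hN
          exact Or.inr (Or.inr ⟨n, ⟨hn, hN⟩, by rw [hnz]; simp⟩)
    filter_upwards [(Finset.eventually_all G).2 hG] with N hN z hz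
    exact Finset.mem_subtype.2 (hN z hz)
  have hWsum : ∀ x : ℝ, 0 < x → HasSum (fun z : Z => g x z) (W x - g x φ) := by
    intro x hx
    have h1 := hasSum_subtype_iff_indicator.1 (hW x hx)
    have h2 := hasSum_ite_sub_hasSum h1 (φ : ℂ)
    rw [indicator_of_mem (show (φ : ℂ) ∈ {z | D z = 0} from hDφ)] at h2
    refine hasSum_subtype_iff_indicator.2 (h2.congr_fun fun z => ?_)
    by_cases hzφ : z = φ
    · rw [if_pos hzφ, indicator_of_notMem fun h => h.2 hzφ]
    · rw [if_neg hzφ]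
      by_cases hz : D z = 0
      · rw [indicator_of_mem (show z ∈ Z from ⟨hz, hzφ⟩),
          indicator_of_mem (show z ∈ {z | D z = 0} from hz)]
      · rw [indicator_of_notMem (show z ∉ Z from fun h => hz h.1),
          indicator_of_notMem (show z ∉ {z | D z = 0} from hz)]
  have hu : Summable fun z : Z => Real.exp (ε * (z : ℂ).re) / ‖deriv D z‖ :=
    (hsum ε hε).comp_injective (i := fun z : Z => (⟨z, z.2.1⟩ : {z : ℂ | D z = 0}))
      fun z z' h => Subtype.ext (congrArg (fun z : {z : ℂ | D z = 0} => (z : ℂ)) h)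
  have hunif := tendstoUniformlyOn_tsum (f := fun (z : Z) (x : ℝ) => g x z) hu (s := Ici ε) (by
    intro z x hx
    rw [hg, norm_div, Complex.norm_exp]
    gcongr
    have h1 : ((z : ℂ) * x).re = (z : ℂ).re * x := by simp
    rw [h1]
    have h2 : (z : ℂ).re ≤ 0 := by
      rcases hzero z z.2.1 with h | h | h
      · rw [h]; simpa using ha
      · exact absurd h z.2.2
      · linarith [h.2]
    have h3 : ε ≤ x := hx
    nlinarith)
  rw [Metric.tendstoUniformlyOn_iff] at hunif ⊢
  intro η hη
  filter_upwards [hatTop.eventually (hunif η hη)] with N hN x hx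
  have h1 := hN x hx
  rw [(hWsum x (hε.trans_le hx)).tsum_eq, Finset.sum_subtype_of_mem (g x) (hFZ N), hFsum] at h1
  rw [dist_eq_norm] at h1 ⊢
  convert h1 using 2
  ring

end SNLevy

theorem theorem3 {Ω : Type*} [MeasurableSpace Ω] (P : Measure Ω) [IsProbabilityMeasure P]
    (Y : ℝ≥0 → Ω → ℝ) (σ μ : ℝ) (ν : Measure ℝ) (k q : ℝ)
    -- `Y` is a Lévy process with characteristics `(σ, μ, ν)`
    (hσ : 0 ≤ σ) (hν : SNLevy.IsLevyMeasure ν) (hY : SNLevy.HasTriplet P Y σ μ ν)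
    -- its jumps are negative and bounded by `k`
    (hk : SNLevy.SupportedExactly ν k)
    -- `-Y` is not a subordinator
    (hmono : 0 < σ ∨ ¬ SNLevy.BoundedVariation ν ∨ 0 < μ)
    (hreg : SNLevy.IsRegular ν k)
    (hq : 0 < q ∨ (q = 0 ∧ 0 < SNLevy.Phi (SNLevy.laplaceExponent σ μ ν) q))
    -- all solutions of `ψ(z) = q` are simple
    (hsimple : ∀ z : ℂ, SNLevy.laplaceExponent σ μ ν z = q →
      deriv (SNLevy.laplaceExponent σ μ ν) z ≠ 0) :
    (∃ ζ : ℕ → ℂ, SNLevy.IsRootSequence (SNLevy.laplaceExponent σ μ ν) q ζ) ∧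
    ∀ ζ : ℕ → ℂ, SNLevy.IsRootSequence (SNLevy.laplaceExponent σ μ ν) q ζ →
    ∀ W : ℝ → ℝ, SNLevy.IsScaleFunction (SNLevy.laplaceExponent σ μ ν) q W →
      (∀ x : ℝ, 0 < x →
        Tendsto (fun N => SNLevy.partialSum (SNLevy.laplaceExponent σ μ ν) q ζ N x) atTop
          (𝓝 (W x : ℂ))) ∧
      ∀ ε : ℝ, 0 < ε →
        TendstoUniformlyOn (fun N x => SNLevy.partialSum (SNLevy.laplaceExponent σ μ ν) q ζ N x)
          (fun x => (W x : ℂ)) atTop (Ici ε) := by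
  obtain ⟨a, ha, hΦ, hga, hgΦ, huniq, hout⟩ := SNLevy.exists_real_roots σ μ hσ hν hk hmono hq
  have hψ := SNLevy.differentiable_laplaceExponent σ μ hν hk
  have hcases : ∀ z : ℂ, SNLevy.laplaceExponent σ μ ν z = q → _ := fun z hz =>
    SNLevy.root_cases σ μ hν hk hmono hga hgΦ huniq hout hz
  have hψa := (SNLevy.laplaceExponent_ofReal_eq_iff σ μ hν hk a q).2 hga
  have hψΦ := (SNLevy.laplaceExponent_ofReal_eq_iff σ μ hν hk _ q).2 hgΦ
  have hofReal := SNLevy.laplaceExponent_ofReal_eq_iff σ μ hν hk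
  have hψconj := SNLevy.laplaceExponent_conj σ μ ν
  have hasymp : ∀ c : ℝ, 0 ≤ c → ∃ (A β : ℂ) (p m : ℝ), SNLevy.ExpPowerAsymptotic
      (fun w => SNLevy.laplaceExponent σ μ ν (-w) - q) A β p m k c := by
    intro c hc
    obtain ⟨A, B, p, n, hA, hB, hp, h⟩ :=
      SNLevy.exists_laplaceExponent_asymptotic hσ hν hk hmono hreg hc q
    obtain ⟨β, hβ⟩ := SNLevy.exists_expPowerAsymptotic
      ((hψ.comp differentiable_neg).sub_const (q : ℂ)) hA hB hp hk.pos hc h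
    exact ⟨A, β, p, _, hβ⟩
  set ψ := SNLevy.laplaceExponent σ μ ν with hψdef
  set Φ := SNLevy.Phi ψ q with hΦdef
  obtain ⟨A, β, p, m, hsym⟩ := hasymp (Φ + 1 + 1) (by linarith)
  refine ⟨?_, fun ζ hζ W hW => ?_⟩
  · -- enumerate the roots in the open first quadrant
    have hinf : {z : ℂ | 0 < z.re ∧ 0 < z.im ∧ ψ (-z) = q}.Infinite := by
      intro hfin
      obtain ⟨M, hM⟩ := (hfin.image Complex.im).bddAbove
      obtain ⟨z, h1, h2, h3⟩ := hsym.exists_abs_im_ge (max 0 M + 1)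
      have h4 := le_max_left 0 M
      have h5 := le_max_right 0 M
      have h6 := hM ⟨z, ⟨h2, by linarith, sub_eq_zero.1 h3⟩, rfl⟩
      linarith
    obtain ⟨ξ, hinj, hrange, hmon⟩ := SNLevy.exists_monotone_enumeration hinf (fun z => ‖z‖)
      fun R => (SNLevy.finite_zeros_inter hsym.differentiable hsym.exists_ne_zero R).subset
        fun z hz => ⟨sub_eq_zero.2 hz.1.2.2, by simpa using hz.2⟩
    refine ⟨fun n => if n = 0 then ((-a : ℝ) : ℂ) else ξ (n - 1), ⟨by simp, by simpa using ha,
      by simpa using hψa, ⟨?_, ?_, ?_⟩, ?_⟩⟩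
    · intro n hn
      have hn' : n ≠ 0 := Nat.one_le_iff_ne_zero.1 hn
      simp only [if_neg hn']
      rw [← hrange]; exact mem_range_self _
    · intro n hn n' hn' h
      have h0 : n ≠ 0 := Nat.one_le_iff_ne_zero.1 hn
      have h0' : n' ≠ 0 := Nat.one_le_iff_ne_zero.1 hn'
      simp only [if_neg h0, if_neg h0'] at h
      have := hinj h
      omega
    · rw [← hrange]
      rintro _ ⟨n, rfl⟩
      exact ⟨n + 1, by simp, by simp⟩
    · intro n hn n' hn' h
      have h0 : n ≠ 0 := Nat.one_le_iff_ne_zero.1 hn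
      have h0' : n' ≠ 0 := Nat.one_le_iff_ne_zero.1 hn'
      simp only [if_neg h0, if_neg h0']
      exact hmon (by omega)
  · have hd : ∀ z, deriv (fun z => ψ z - q) z = deriv ψ z := fun z => deriv_sub_const _
    have hD : Differentiable ℂ fun z => ψ z - q := hψ.sub_const _
    have hconj : ∀ z, (fun z => ψ z - (q : ℂ)) (starRingEnd ℂ z) =
        starRingEnd ℂ ((fun z => ψ z - (q : ℂ)) z) := fun z => by simp [hψconj]
    have hre : ∀ z, (fun z => ψ z - (q : ℂ)) z = 0 → z.re ≤ Φ := fun z hz =>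
      SNLevy.re_le_of_eq_zero_of_laplace hD
        (SNLevy.ExpPowerAsymptotic.exists_symbol_ne_zero (D := fun z => ψ z - q) hsym)
        hW.integrableOn hW.laplace hz
    have hζ0 : -ζ 0 = (a : ℂ) := by
      have h1 : -ζ 0 = ((-(ζ 0).re : ℝ) : ℂ) := by
        apply Complex.ext <;> simp [hζ.im_zero]
      have h2 := hζ.eq_zero
      rw [h1, hofReal] at h2
      rw [h1]
      rcases huniq _ h2 with h3 | h3
      · rw [h3]
      · linarith [hζ.re_zero]
    have huniform : ∀ ε : ℝ, 0 < ε → TendstoUniformlyOn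
        (fun N x => SNLevy.partialSum ψ q ζ N x) (fun x => (W x : ℂ)) atTop (Ici ε) := by
      intro ε hε
      have h1 := SNLevy.tendstoUniformlyOn_conj_pairs (D := fun z => ψ z - q) (φ := Φ) (a := a)
        (by linarith) ha (sub_eq_zero.2 hψa) (sub_eq_zero.2 hψΦ) hconj (by
          intro z hz
          rcases hcases z (sub_eq_zero.1 hz) with h | h | ⟨h1, h2 | h2⟩
          · exact Or.inl h
          · exact Or.inr (Or.inl h)
          · exact Or.inr (Or.inr ⟨h1, h2⟩)
          · exact absurd (hre z hz) (not_le.2 h2)) (ζ := ζ) (by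
          simpa only [sub_eq_zero] using hζ.bijOn)
        (fun s hs => SNLevy.ExpPowerAsymptotic.summable_symbol_zeros (D := fun z => ψ z - q) hsym
          hconj (fun z hz => by linarith [hre z hz]) hs)
        (fun x hx => SNLevy.hasSum_scale (D := fun z => ψ z - q) hsym hconj hre
          (fun z hz => by rw [hd]; exact hsimple z (sub_eq_zero.1 hz)) hW.eq_zero hW.continuousOn
          hW.integrableOn hW.laplace hx) hε
      simp only [hd] at h1
      refine h1.congr (Eventually.of_forall fun N x _ => ?_)
      simp only [SNLevy.partialSum, hζ0, ← hΦdef]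
    exact ⟨fun x hx => (huniform x hx).tendsto_at self_mem_Ici, huniform⟩
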